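/- Fix $n$ and $\hbar>0$. For $\psi\in\mathcal S(\mathbb R^n)$ let $$W\psi(x,p)=\Big(\tfrac1{2\pi\hbar}\Big)^n\int_{\mathbb R^n}e^{-\frac i\hbar p\cdot y}\,\psi(x+\tfrac12y)\,\overline{\psi(x-\tfrac12y)}\,dy$$ be the Wigner transform, extended to $\psi\in\mathcal S'(\mathbb R^n)$, with $W\psi\in\mathcal S'(\mathbb R^{2n})$, by $$\langle W\psi,\Phi\rangle=\langle\psi\otimes\overline\psi,K_\Phi\rangle,\qquad K_\Phi(u,v)=\Big(\tfrac1{2\pi\hbar}\Big)^n\int_{\mathbb R^n} e^{-\frac i\hbar p\cdot(u-v)}\,\Phi\big(\tfrac{u+v}2,p\big)\,dp .$$ For $T\in\mathcal S'(\mathbb R^{2n})$ and $M\in GL(2n,\mathbb R)$, $T\circ M$ is the usual composition, $\langle T\circ M,\Phi\rangle=|\det M|^{-1}\langle T,\Phi\circ M^{-1}\rangle$. Let $J=\begin{pmatrix}0&I\\-I&0\end{pmatrix}$ and $C=\begin{pmatrix}I&0\\0&-I\end{pmatrix}$; $M$ is symplectic ($M\in\mathrm{Sp}(n)$) if $M^TJM=J$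 and antisymplectic if $M^TJM=-J$ (equivalently $CM\in\mathrm{Sp}(n)$). The metaplectic group $\mathrm{Mp}(n)$ is the group of unitary operators on $L^2(\mathbb R^n)$ generated by the quadratic Fourier transforms $$\widehat S_{\mathcal W,m}f(x)=\Big(\tfrac1{2\pi i\hbar}\Big)^{n/2}i^m\sqrt{|\det L|}\int_{\mathbb R^n} e^{\frac i\hbar \mathcal W(x,x')}f(x')\,dx',\qquad \mathcal W(x,x')=\tfrac12Px\cdot x-Lx\cdot x'+\tfrac12Qx'\cdot x',$$ with $P,Q$ real symmetric, $L$ real with $\det L\neq0$, $m\in\mathbb Z$, $m\pi\equiv\arg\det L \pmod{2\pi}$, and $i^{-n/2}=e^{-i\pi n/4}$; the covering projection $\mathrm{Mp}(n)\to\mathrm{Sp}(n)$ is the homomorphism that sends $\widehat S_{\mathcal W,m}$ to $$S_{\mathcal W}=\begin{pmatrix}L^{-1}Q&L^{-1}\\PL^{-1}Q-L^T&PL^{-1}\end{pmatrix}.$$ Metaplectic operators preserve $\mathcal S(\mathbb R^n)$ and act on $\mathcal S'(\mathbb R^n)$ by $\langle\widehat S\psi,\varphi\rangle=\langle\psi,\overline{\widehat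 S^{-1}\overline\varphi}\rangle$. **Theorem 1.** Let $M\in GL(2n,\mathbb R)$. (i) If $M$ is antisymplectic, then $S=CM\in\mathrm{Sp}(n)$, there are metaplectic operators covering $S$, and for every $\widehat S\in\mathrm{Mp}(n)$ covering $S$ and every $\psi\in\mathcal S'(\mathbb R^n)$, $$W\psi\circ M=W(\widehat S^{-1}\overline\psi).$$ (ii) Conversely, suppose that for every $\psi\in\mathcal S(\mathbb R^n)$ there is $\psi'\in\mathcal S'(\mathbb R^n)$ with $W\psi\circ M=W\psi'$. Then $M$ is symplectic or antisymplectic. (iii) If $M$ is symplectic or antisymplectic, then for every $\psi\in\mathcal S'(\mathbb R^n)$ there is $\psi'\in\mathcal S'(\mathbb R^n)$ with $W\psi\circ M=W\psi'$. Together with (ii): the linear covariance group of the Wigner transform consists exactly of the symplectic and the antisymplectic matrices. -/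

import Mathlib

open MeasureTheory SchwartzMap LineDeriv
open scoped SchwartzMap FourierTransform ContDiff ComplexConjugate

section Schwartz

theorem schwartz_bound {E F E' F' : Type*}
    [NormedAddCommGroup E] [NormedSpace ℝ E] [NormedAddCommGroup F] [NormedSpace ℝ F]
    [NormedAddCommGroup E'] [NormedSpace ℝ E'] [NormedAddCommGroup F'] [NormedSpace ℝ F']
    (B : 𝓢(E, F) →L[ℝ] 𝓢(E', F')) (s : Finset (ℕ × ℕ)) :
    ∃ (s' : Finset (ℕ × ℕ)) (C : ℝ), 0 ≤ C ∧ ∀ f,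
      s.sup (schwartzSeminormFamily ℝ E' F') (B f) ≤
        C * s'.sup (schwartzSeminormFamily ℝ E F) f := by
  have hq : Continuous ((s.sup (schwartzSeminormFamily ℝ E' F')).comp B.toLinearMap) := by
    have h1 := ((schwartz_withSeminorms ℝ E' F').finset_sups).continuous_seminorm s
    exact h1.comp B.continuous
  obtain ⟨s', C, -, h⟩ := Seminorm.bound_of_continuous (schwartz_withSeminorms ℝ E F) _ hq
  exact ⟨s', C, C.2, fun f => h f⟩

theorem schwartz_taylor_zero {D V : Type*} [NormedAddCommGroup D] [NormedSpace ℝ D]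
    [NormedAddCommGroup V] [NormedSpace ℝ V] (Φ : 𝓢(D, V)) (k : ℕ) :
    ∃ C : ℝ, 0 ≤ C ∧ ∀ v : D, ‖v‖ ≤ 1 → ∀ z : D,
      ‖z‖ ^ k * ‖Φ (z + v) - Φ z - fderiv ℝ Φ z v‖ ≤ C * ‖v‖ ^ 2 := by
  set A := 2 ^ k * (Finset.Iic (k, 1)).sup (fun m => SchwartzMap.seminorm ℝ m.1 m.2)
    (fderivCLM ℝ D V Φ) with hA
  refine ⟨2 ^ k * A, by positivity, fun v hv z => ?_⟩
  have hz : ‖z‖ ^ k ≤ 2 ^ k * 1 * (1 + ‖z‖) ^ k := by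
    have : ‖z‖ ^ k ≤ (1 + ‖z‖) ^ k := by gcongr; linarith
    have h2 : (1:ℝ) ≤ 2 ^ k := one_le_pow₀ (by norm_num)
    nlinarith [show (0:ℝ) ≤ (1 + ‖z‖) ^ k by positivity]
  -- second derivative bound near z
  have h2 : ∀ w ∈ Metric.closedBall z ‖v‖,
      (1 + ‖z‖) ^ k * ‖fderiv ℝ (fderivCLM ℝ D V Φ) w‖ ≤ 2 ^ k * A := by
    intro w hw
    have hw' : ‖w - z‖ ≤ 1 := by
      have := mem_closedBall_iff_norm.1 hw
      linarith
    have h3 : 1 + ‖z‖ ≤ 2 * (1 + ‖w‖) := by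
      have : ‖z‖ ≤ ‖w‖ + ‖w - z‖ := by
        have := norm_sub_le w (w - z)
        simpa using this
      linarith [norm_nonneg w]
    calc (1 + ‖z‖) ^ k * ‖fderiv ℝ (fderivCLM ℝ D V Φ) w‖
        ≤ (2 * (1 + ‖w‖)) ^ k * ‖fderiv ℝ (fderivCLM ℝ D V Φ) w‖ := by gcongr
      _ = 2 ^ k * ((1 + ‖w‖) ^ k * ‖iteratedFDeriv ℝ 1 (fderivCLM ℝ D V Φ) w‖) := by
          rw [norm_iteratedFDeriv_one, mul_pow, mul_assoc]
      _ ≤ 2 ^ k * A := by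
          gcongr
          exact one_add_le_sup_seminorm_apply (𝕜 := ℝ) (m := (k, 1)) le_rfl le_rfl _ w
  have hpos : (0:ℝ) < (1 + ‖z‖) ^ k := by positivity
  have h3 : ∀ w ∈ Metric.closedBall z ‖v‖,
      ‖fderiv ℝ (fderivCLM ℝ D V Φ) w‖ ≤ 2 ^ k * A / (1 + ‖z‖) ^ k := by
    intro w hw
    rw [le_div_iff₀ hpos, mul_comm]
    exact h2 w hw
  have hzmem : z ∈ Metric.closedBall z ‖v‖ := by simp
  have h4 : ∀ w ∈ Metric.closedBall z ‖v‖,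
      ‖fderiv ℝ Φ w - fderiv ℝ Φ z‖ ≤ 2 ^ k * A / (1 + ‖z‖) ^ k * ‖v‖ := by
    intro w hw
    have := (convex_closedBall z ‖v‖).norm_image_sub_le_of_norm_fderiv_le
      (f := (fderivCLM ℝ D V Φ)) (𝕜 := ℝ) (fun x _ => (fderivCLM ℝ D V Φ).differentiableAt) h3 hzmem hw
    refine this.trans ?_
    gcongr
    exact mem_closedBall_iff_norm.1 hw
  have hvmem : z + v ∈ Metric.closedBall z ‖v‖ := by simp
  have h5 := (convex_closedBall z ‖v‖).norm_image_sub_le_of_norm_hasFDerivWithin_le'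
    (f := Φ) (𝕜 := ℝ) (f' := fderiv ℝ Φ) (φ := fderiv ℝ Φ z)
    (fun x _ => (Φ.hasFDerivAt x).hasFDerivWithinAt) h4 hzmem hvmem
  simp only [add_sub_cancel_left] at h5
  calc ‖z‖ ^ k * ‖Φ (z + v) - Φ z - fderiv ℝ Φ z v‖
      ≤ (1 + ‖z‖) ^ k * (2 ^ k * A / (1 + ‖z‖) ^ k * ‖v‖ * ‖v‖) := by
        gcongr
        linarith
    _ = 2 ^ k * A * ‖v‖ ^ 2 := by field_simp

theorem schwartz_taylor {D : Type} [NormedAddCommGroup D] [NormedSpace ℝ D] (k m : ℕ) :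
    ∀ {V : Type} [NormedAddCommGroup V] [NormedSpace ℝ V] (Φ : 𝓢(D, V)),
    ∃ C : ℝ, 0 ≤ C ∧ ∀ v : D, ‖v‖ ≤ 1 → ∀ z,
      ‖z‖ ^ k * ‖iteratedFDeriv ℝ m (Φ.compSubConstCLM ℝ (-v) - Φ - ∂_{v} Φ) z‖ ≤ C * ‖v‖ ^ 2 := by
  induction m with
  | zero =>
    intro V _ _ Φ
    obtain ⟨C, hC, h⟩ := schwartz_taylor_zero Φ k
    refine ⟨C, hC, fun v hv z => ?_⟩
    simpa [lineDerivOp_apply_eq_fderiv] using h v hv z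
  | succ m ih =>
    intro V _ _ Φ
    obtain ⟨C, hC, h⟩ := ih (fderivCLM ℝ D V Φ)
    refine ⟨C, hC, fun v hv z => ?_⟩
    refine le_trans (le_of_eq ?_) (h v hv z)
    rw [← norm_iteratedFDeriv_fderiv]
    congr 3
    have key : fderivCLM ℝ D V (Φ.compSubConstCLM ℝ (-v) - Φ - ∂_{v} Φ) =
      (fderivCLM ℝ D V Φ).compSubConstCLM ℝ (-v) - (fderivCLM ℝ D V Φ) - ∂_{v} (fderivCLM ℝ D V Φ) := by
      rw [map_sub, map_sub]
      congr 1
      · congr 1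
        ext1 x
        rw [fderivCLM_apply, compSubConstCLM_apply, fderivCLM_apply]
        have : (⇑(Φ.compSubConstCLM ℝ (-v)) : D → V) = fun y => Φ (y - (-v)) := by
          ext y; rfl
        rw [this, fderiv_comp_sub]
      · ext1 x
        ext1 u
        rw [fderivCLM_apply, lineDerivOp_apply_eq_fderiv]
        have e1 : (⇑(∂_{v} Φ : 𝓢(D, V)) : D → V) = fun y => fderiv ℝ Φ y v := by
          ext y; rfl
        have e2 : (⇑(fderivCLM ℝ D V Φ) : D → (D →L[ℝ] V)) = fderiv ℝ Φ := by
          ext1 y; rfl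
        rw [e1, e2]
        have hd : DifferentiableAt ℝ (fderiv ℝ Φ) x := by
          rw [← e2]; exact (fderivCLM ℝ D V Φ).differentiableAt
        rw [fderiv_clm_apply hd (differentiableAt_const v)]
        simp only [fderiv_fun_const, Pi.zero_apply, ContinuousLinearMap.comp_zero, zero_add,
          ContinuousLinearMap.flip_apply]
        exact second_derivative_symmetric (f := Φ) (f' := fderiv ℝ Φ) (x := x)
          (fun y => Φ.hasFDerivAt y) hd.hasFDerivAt u v
    rw [← key]
    rfl

variable {E F G : Type} [NormedAddCommGroup E] [NormedSpace ℝ E]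
  [NormedAddCommGroup F] [NormedSpace ℝ F] [NormedAddCommGroup G] [NormedSpace ℝ G]

theorem conj_bound (f : E → ℂ) (n : ℕ) (x : E) :
    ‖iteratedFDeriv ℝ n (fun x => conj (f x)) x‖ = ‖iteratedFDeriv ℝ n f x‖ :=
  Complex.conjLIE.norm_iteratedFDeriv_comp_left f x n

/-- Complex conjugation of Schwartz functions. -/
noncomputable def conjSchwartz : 𝓢(E, ℂ) →L⋆[ℂ] 𝓢(E, ℂ) :=
  mkCLM (fun f x => conj (f x)) (fun f g x => by simp) (fun a f x => by simp)
    (fun f => Complex.conjCLE.contDiff.comp (f.smooth ⊤))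
    (fun p => ⟨{p}, 1, zero_le_one, fun f x => by
      rw [conj_bound, Finset.sup_singleton, one_mul]
      exact SchwartzMap.le_seminorm ℂ p.1 p.2 f x⟩)

@[simp] theorem conjSchwartz_apply (f : 𝓢(E, ℂ)) (x : E) : conjSchwartz f x = conj (f x) := rfl

/-- The complex conjugate of a tempered distribution: `⟨ψ̄, φ⟩` is the conjugate of `⟨ψ, φ̄⟩`. -/
noncomputable def conjDistribution (ψ : 𝓢'(E, ℂ)) : 𝓢'(E, ℂ) :=
  ContinuousLinearMap.toPointwiseConvergenceCLM _ _ _ _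
    (((starL ℂ : ℂ ≃L⋆[ℂ] ℂ) : ℂ →L⋆[ℂ] ℂ).comp ((ψ : 𝓢(E, ℂ) →L[ℂ] ℂ).comp conjSchwartz))

@[simp] theorem conjDistribution_apply (ψ : 𝓢'(E, ℂ)) (f : 𝓢(E, ℂ)) :
    conjDistribution ψ f = conj (ψ (conjSchwartz f)) := rfl

/-- The partial function `Φ(x, ·)` of a Schwartz function `Φ` of two variables. -/
noncomputable def sliceCLM (x : E) : 𝓢(E × F, ℂ) →L[ℂ] 𝓢(F, ℂ) :=
  compCLMOfAntilipschitz ℂ (K := 1) (g := fun y : F => (x, y))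
    (by
      have h : (fun y : F => (x, y)) = fun y => ContinuousLinearMap.inr ℝ E F y + (x, 0) := by
        ext y <;> simp
      rw [h]
      exact (ContinuousLinearMap.hasTemperateGrowth _).add (.const _))
    (fun y z => by simp [Prod.edist_eq])

@[simp] theorem sliceCLM_apply (x : E) (Φ : 𝓢(E × F, ℂ)) (y : F) :
    sliceCLM x Φ y = Φ (x, y) := rfl

theorem norm_iteratedFDeriv_slice_le (m : ℕ) (Φ : 𝓢(E × F, ℂ)) (x : E) (y : F) :
    ‖iteratedFDeriv ℝ m (sliceCLM x Φ) y‖ ≤ ‖iteratedFDeriv ℝ m Φ (x, y)‖ := by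
  have h : (⇑(sliceCLM x Φ) : F → ℂ) =
      (fun w => Φ (w + (x, 0))) ∘ (ContinuousLinearMap.inr ℝ E F) := by
    ext y; simp
  rw [h, ContinuousLinearMap.iteratedFDeriv_comp_right (i := m) (n := ∞)]
  · rw [iteratedFDeriv_comp_add_right]
    refine (ContinuousMultilinearMap.norm_compContinuousLinearMap_le _ _).trans ?_
    have h1 : ‖ContinuousLinearMap.inr ℝ E F‖ ≤ 1 := ContinuousLinearMap.norm_inr_le_one ..
    calc _ ≤ ‖iteratedFDeriv ℝ m Φ ((ContinuousLinearMap.inr ℝ E F) y + (x, 0))‖ *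
          ∏ _i : Fin m, (1:ℝ) := by gcongr
      _ = _ := by simp
  · exact (Φ.smooth ⊤).comp (contDiff_id.add contDiff_const)
  · exact mod_cast le_top

theorem pow_mul_seminorm_slice_le (j k m : ℕ) (Φ : 𝓢(E × F, ℂ)) (x : E) :
    ‖x‖ ^ j * SchwartzMap.seminorm ℝ k m (sliceCLM x Φ) ≤
      SchwartzMap.seminorm ℝ (j + k) m Φ := by
  rcases (pow_nonneg (norm_nonneg x) j).eq_or_lt with h | h
  · rw [← h, zero_mul]; positivity
  rw [← le_div_iff₀' h]
  refine SchwartzMap.seminorm_le_bound ℝ k m _ (by positivity) fun y => ?_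
  rw [le_div_iff₀' h]
  calc _ ≤ ‖(x, y)‖ ^ j * (‖(x, y)‖ ^ k * ‖iteratedFDeriv ℝ m Φ (x, y)‖) := by
        gcongr
        · exact norm_fst_le (x, y)
        · exact norm_snd_le (x, y)
        · exact norm_iteratedFDeriv_slice_le ..
    _ = ‖(x, y)‖ ^ (j + k) * ‖iteratedFDeriv ℝ m Φ (x, y)‖ := by rw [pow_add, mul_assoc]
    _ ≤ _ := SchwartzMap.le_seminorm ℝ _ _ Φ _

theorem pow_mul_sup_seminorm_slice_le (j : ℕ) (s : Finset (ℕ × ℕ)) (Φ : 𝓢(E × F, ℂ)) (x : E) :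
    ‖x‖ ^ j * s.sup (schwartzSeminormFamily ℝ F ℂ) (sliceCLM x Φ) ≤
      (s.image fun p => (j + p.1, p.2)).sup (schwartzSeminormFamily ℝ (E × F) ℂ) Φ := by
  rcases (pow_nonneg (norm_nonneg x) j).eq_or_lt with h | h
  · rw [← h, zero_mul]; positivity
  rw [← le_div_iff₀' h]
  refine Seminorm.finset_sup_apply_le (by positivity) fun p hp => ?_
  rw [le_div_iff₀' h]
  refine (pow_mul_seminorm_slice_le j p.1 p.2 Φ x).trans ?_
  have : (j + p.1, p.2) ∈ s.image fun p => (j + p.1, p.2) := Finset.mem_image_of_mem _ hp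
  exact Seminorm.le_def.1 (Finset.le_sup (f := schwartzSeminormFamily ℝ (E × F) ℂ) this) Φ

/-- The value `(L Φ(x, ·))(q)`, where the operator `L` acts on the second variable only. -/
noncomputable def sndFun (L : 𝓢(F, ℂ) →L[ℂ] 𝓢(G, ℂ)) (Φ : 𝓢(E × F, ℂ)) (w : E × G) : ℂ :=
  L (sliceCLM w.1 Φ) w.2

theorem sndFun_zero_bound (L : 𝓢(F, ℂ) →L[ℂ] 𝓢(G, ℂ)) (k : ℕ) :
    ∃ (s : Finset (ℕ × ℕ)) (C : ℝ), 0 ≤ C ∧ ∀ (Φ : 𝓢(E × F, ℂ)) (w : E × G),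
      ‖w‖ ^ k * ‖sndFun L Φ w‖ ≤ C * s.sup (schwartzSeminormFamily ℝ (E × F) ℂ) Φ := by
  obtain ⟨s, C, hC, h⟩ := schwartz_bound (L.restrictScalars ℝ) {(0, 0), (k, 0)}
  refine ⟨(s.image fun p => (k + p.1, p.2)) ∪ (s.image fun p => (0 + p.1, p.2)), C + C,
    by positivity, fun Φ w => ?_⟩
  have hk0 : ∀ l ∈ ({(0, 0), (k, 0)} : Finset (ℕ × ℕ)), ∀ f : 𝓢(F, ℂ), ∀ q,
      ‖q‖ ^ l.1 * ‖L f q‖ ≤ C * s.sup (schwartzSeminormFamily ℝ F ℂ) f := by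
    intro l hl f q
    have h2 : l.2 = 0 := by
      simp only [Finset.mem_insert, Finset.mem_singleton] at hl
      rcases hl with rfl | rfl <;> rfl
    refine le_trans ?_ (h f)
    refine le_trans ?_ (Seminorm.le_def.1
      (Finset.le_sup (f := schwartzSeminormFamily ℝ G ℂ) hl) _)
    have := SchwartzMap.le_seminorm ℝ l.1 0 (L f) q
    rw [norm_iteratedFDeriv_zero] at this
    rw [schwartzSeminormFamily, h2]
    exact this
  have mono : ∀ (j : ℕ), (s.image fun p => (j + p.1, p.2)) ⊆
      (s.image fun p => (k + p.1, p.2)) ∪ (s.image fun p => (0 + p.1, p.2)) →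
      ‖w.1‖ ^ j * s.sup (schwartzSeminormFamily ℝ F ℂ) (sliceCLM w.1 Φ) ≤
      ((s.image fun p => (k + p.1, p.2)) ∪ (s.image fun p => (0 + p.1, p.2))).sup
        (schwartzSeminormFamily ℝ (E × F) ℂ) Φ := fun j hj =>
    (pow_mul_sup_seminorm_slice_le j s Φ w.1).trans
      (Seminorm.le_def.1 (Finset.sup_mono hj) Φ)
  have h1 : ‖w.1‖ ^ k * ‖sndFun L Φ w‖ ≤ C * ((s.image fun p => (k + p.1, p.2)) ∪
      (s.image fun p => (0 + p.1, p.2))).sup (schwartzSeminormFamily ℝ (E × F) ℂ) Φ := by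
    have a := hk0 (0, 0) (by simp) (sliceCLM w.1 Φ) w.2
    simp only [pow_zero, one_mul] at a
    calc _ ≤ ‖w.1‖ ^ k * (C * s.sup (schwartzSeminormFamily ℝ F ℂ) (sliceCLM w.1 Φ)) := by
          gcongr; exact a
      _ = C * (‖w.1‖ ^ k * s.sup (schwartzSeminormFamily ℝ F ℂ) (sliceCLM w.1 Φ)) := by ring
      _ ≤ _ := by gcongr; exact mono k Finset.subset_union_left
  have h2 : ‖w.2‖ ^ k * ‖sndFun L Φ w‖ ≤ C * ((s.image fun p => (k + p.1, p.2)) ∪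
      (s.image fun p => (0 + p.1, p.2))).sup (schwartzSeminormFamily ℝ (E × F) ℂ) Φ := by
    have a := hk0 (k, 0) (by simp) (sliceCLM w.1 Φ) w.2
    have b := mono 0 Finset.subset_union_right
    rw [pow_zero, one_mul] at b
    refine a.trans ?_
    gcongr
  have h3 : ‖w‖ ^ k ≤ ‖w.1‖ ^ k + ‖w.2‖ ^ k := by
    rw [Prod.norm_def]
    rcases max_choice ‖w.1‖ ‖w.2‖ with h | h <;> rw [h] <;> simp
  calc _ ≤ (‖w.1‖ ^ k + ‖w.2‖ ^ k) * ‖sndFun L Φ w‖ := by gcongr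
    _ ≤ _ := by linarith

theorem sndFun_sum {ι : Type*} (t : Finset ι) (L : 𝓢(F, ℂ) →L[ℂ] 𝓢(G, ℂ))
    (c : ι → ℝ) (Φ : ι → 𝓢(E × F, ℂ)) (w : E × G) :
    sndFun L (∑ i ∈ t, c i • Φ i) w = ∑ i ∈ t, c i • sndFun L (Φ i) w := by
  have h : ∀ (c : ℝ) (f : 𝓢(F, ℂ)), L (c • f) = c • L f := fun c f =>
    (L.restrictScalars ℝ).map_smul c f
  have h' : ∀ (c : ℝ) (f : 𝓢(E × F, ℂ)), sliceCLM w.1 (c • f) = c • sliceCLM w.1 f := fun c f =>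
    ((sliceCLM w.1).restrictScalars ℝ).map_smul c f
  simp [sndFun, map_sum, h, h']

variable [FiniteDimensional ℝ E] [FiniteDimensional ℝ G]

open Module Asymptotics in
theorem hasFDerivAt_sndFun (L : 𝓢(F, ℂ) →L[ℂ] 𝓢(G, ℂ)) (Φ : 𝓢(E × F, ℂ)) (w : E × G) :
    HasFDerivAt (sndFun L Φ)
      (∑ i, (((finBasis ℝ E).coord i).toContinuousLinearMap ∘L
          ContinuousLinearMap.fst ℝ E G).smulRight
            (sndFun L (∂_{((finBasis ℝ E i, 0) : E × F)} Φ) w) +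
        ∑ j, (((finBasis ℝ G).coord j).toContinuousLinearMap ∘L
          ContinuousLinearMap.snd ℝ E G).smulRight
            (sndFun (lineDerivOpCLM ℂ 𝓢(G, ℂ) (finBasis ℝ G j) ∘L L) Φ w)) w := by
  obtain ⟨x, q⟩ := w
  let D (i) : 𝓢(E × F, ℂ) := ∂_{((finBasis ℝ E i, 0) : E × F)} Φ
  have hD : ∀ h : E, (∂_{((h, 0) : E × F)} Φ : 𝓢(E × F, ℂ)) =
      ∑ i, (finBasis ℝ E).coord i h • D i := by
    intro h
    ext z
    simp only [sum_apply, smul_apply, D, lineDerivOp_apply_eq_fderiv]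
    conv_lhs => rw [← (finBasis ℝ E).sum_repr h]
    have : ((∑ i, ((finBasis ℝ E).repr h) i • (finBasis ℝ E) i, 0) : E × F) =
      ContinuousLinearMap.inl ℝ E F (∑ i, ((finBasis ℝ E).repr h) i • (finBasis ℝ E) i) := rfl
    rw [this, map_sum, map_sum]
    simp [-map_sum, -ContinuousLinearMap.inl_apply]
    rfl
  -- the increment in the first variable
  let R (h : E) : 𝓢(E × F, ℂ) := Φ.compSubConstCLM ℝ (-((h, 0) : E × F)) - Φ - ∂_{((h, 0) : E × F)} Φ
  have split : sndFun L Φ = fun w' : E × G => sndFun L (R (w'.1 - x)) (x, w'.2) +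
      ((∑ i, (finBasis ℝ E).coord i (w'.1 - x) • sndFun L (D i) (x, w'.2)) +
        sndFun L Φ (x, w'.2)) := by
    ext w'
    rw [← sndFun_sum, ← hD]
    simp only [sndFun, R, map_sub, sub_apply]
    have : sliceCLM x (Φ.compSubConstCLM ℝ (-((w'.1 - x, 0) : E × F))) = sliceCLM w'.1 Φ := by
      ext y
      simp
    rw [this]
    ring
  have hL : ∀ (f : 𝓢(G, ℂ)), HasFDerivAt (fun w' : E × G => f w'.2)
      (fderiv ℝ f q ∘L ContinuousLinearMap.snd ℝ E G) (x, q) := fun f =>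
    (f.hasFDerivAt q).comp (x, q) (hasFDerivAt_snd (p := (x, q)))
  -- remainder
  have h1 : HasFDerivAt (fun w' : E × G => sndFun L (R (w'.1 - x)) (x, w'.2))
      (0 : E × G →L[ℝ] ℂ) (x, q) := by
    obtain ⟨s, C, hC, hs⟩ := sndFun_zero_bound (E := E) L 0
    have hT : ∃ C' : ℝ, 0 ≤ C' ∧ ∀ h : E, ‖h‖ ≤ 1 →
        s.sup (schwartzSeminormFamily ℝ (E × F) ℂ) (R h) ≤ C' * ‖h‖ ^ 2 := by
      choose Ct hCt ht using fun p : ℕ × ℕ => schwartz_taylor p.1 p.2 Φ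
      refine ⟨∑ p ∈ s, Ct p, Finset.sum_nonneg fun p _ => hCt p, fun h hh => ?_⟩
      refine Seminorm.finset_sup_apply_le (by positivity [Finset.sum_nonneg fun p (_ : p ∈ s) => hCt p]) fun p hp => ?_
      have hn : ‖((h, 0) : E × F)‖ = ‖h‖ := by simp [Prod.norm_def]
      calc _ ≤ Ct p * ‖h‖ ^ 2 := by
            refine SchwartzMap.seminorm_le_bound ℝ p.1 p.2 _ (by have := hCt p; positivity) fun z => ?_
            have := ht p (h, 0) (by rw [hn]; exact hh) z
            rwa [hn] at this
        _ ≤ _ := by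
            gcongr
            exact Finset.single_le_sum (fun p _ => hCt p) hp
    obtain ⟨C', hC', hT⟩ := hT
    rw [hasFDerivAt_iff_isLittleO_nhds_zero]
    have hO : (fun v : E × G => sndFun L (R (((x, q) + v).1 - x)) (x, ((x, q) + v).2) -
        sndFun L (R (((x, q) : E × G).1 - x)) (x, ((x, q) : E × G).2) - (0 : E × G →L[ℝ] ℂ) v)
        =O[nhds 0] fun v => ‖v‖ ^ 2 := by
      have hR0 : R 0 = 0 := by
        ext z
        simp [R, lineDerivOp_apply_eq_fderiv]
        have : ((0, 0) : E × F) = 0 := rfl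
        simp [this]
      refine IsBigO.of_bound (C * C') ?_
      filter_upwards [Metric.closedBall_mem_nhds (0 : E × G) one_pos] with v hv
      have hv' : ‖v.1‖ ≤ 1 := (norm_fst_le v).trans (mem_closedBall_zero_iff.1 hv)
      have a := hs (R v.1) (x, q + v.2)
      have b := hT v.1 hv'
      simp only [pow_zero, one_mul] at a
      have e0 : sndFun L (0 : 𝓢(E × F, ℂ)) (x, q) = 0 := by simp [sndFun]
      simp only [Prod.fst_add, Prod.snd_add, add_sub_cancel_left, sub_self, hR0, e0, sub_zero,
        zero_apply, norm_pow, norm_norm]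
      calc _ ≤ _ := a
        _ ≤ C * (C' * ‖v.1‖ ^ 2) := by gcongr
        _ ≤ C * (C' * ‖v‖ ^ 2) := by gcongr; exact norm_fst_le v
        _ = _ := by ring
    refine hO.trans_isLittleO ?_
    have := (isLittleO_norm_pow_id (E' := E × G) one_lt_two).mono (le_refl (nhds 0))
    exact this
  -- middle term
  have h2 : ∀ i, HasFDerivAt (fun w' : E × G =>
      (finBasis ℝ E).coord i (w'.1 - x) • sndFun L (D i) (x, w'.2))
      ((((finBasis ℝ E).coord i).toContinuousLinearMap ∘L
          ContinuousLinearMap.fst ℝ E G).smulRight (sndFun L (D i) (x, q))) (x, q) := by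
    intro i
    have ha : HasFDerivAt (fun w' : E × G => (finBasis ℝ E).coord i (w'.1 - x))
        (((finBasis ℝ E).coord i).toContinuousLinearMap ∘L ContinuousLinearMap.fst ℝ E G) (x, q) := by
      have := (((finBasis ℝ E).coord i).toContinuousLinearMap.hasFDerivAt (x := x - x)).comp (x, q)
        ((hasFDerivAt_fst (𝕜 := ℝ) (E := E) (F := G) (p := (x, q))).sub_const x)
      exact this
    have hb := hL (L (sliceCLM x (D i)))
    have := ha.smul hb
    refine this.congr_fderiv ?_
    simp [sndFun]
  have h3 := hL (L (sliceCLM x Φ))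
  rw [split]
  refine (h1.add ((HasFDerivAt.fun_sum fun i _ => h2 i).add h3)).congr_fderiv ?_
  rw [zero_add]
  congr 1
  refine ContinuousLinearMap.ext fun v => ?_
  simp only [ContinuousLinearMap.comp_apply, ContinuousLinearMap.coe_snd', sndFun,
    sum_apply, ContinuousLinearMap.smulRight_apply,
    LinearMap.coe_toContinuousLinearMap', lineDerivOpCLM_apply, lineDerivOp_apply_eq_fderiv]
  conv_lhs => rw [← (finBasis ℝ G).sum_repr v.2]
  rw [map_sum]
  simp

open Module in
theorem sndFun_smooth_bound (n : ℕ) : ∀ (L : 𝓢(F, ℂ) →L[ℂ] 𝓢(G, ℂ)),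
    (∀ Φ : 𝓢(E × F, ℂ), ContDiff ℝ n (sndFun (E := E) L Φ)) ∧
    ∀ k : ℕ, ∃ (s : Finset (ℕ × ℕ)) (C : ℝ), 0 ≤ C ∧ ∀ (Φ : 𝓢(E × F, ℂ)) (w : E × G),
      ‖w‖ ^ k * ‖iteratedFDeriv ℝ n (sndFun L Φ) w‖ ≤
        C * s.sup (schwartzSeminormFamily ℝ (E × F) ℂ) Φ := by
  induction n with
  | zero =>
    intro L
    refine ⟨fun Φ => ?_, fun k => ?_⟩
    · rw [Nat.cast_zero, contDiff_zero]
      exact continuous_iff_continuousAt.2 fun w => (hasFDerivAt_sndFun L Φ w).continuousAt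
    · simpa using sndFun_zero_bound L k
  | succ n ih =>
    intro L
    let A (i) : ℂ →L[ℝ] (E × G →L[ℝ] ℂ) := ContinuousLinearMap.smulRightL ℝ (E × G) ℂ
      (((finBasis ℝ E).coord i).toContinuousLinearMap ∘L ContinuousLinearMap.fst ℝ E G)
    let B (j) : ℂ →L[ℝ] (E × G →L[ℝ] ℂ) := ContinuousLinearMap.smulRightL ℝ (E × G) ℂ
      (((finBasis ℝ G).coord j).toContinuousLinearMap ∘L ContinuousLinearMap.snd ℝ E G)
    let D (i) : 𝓢(E × F, ℂ) →L[ℝ] 𝓢(E × F, ℂ) :=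
      lineDerivOpCLM ℝ 𝓢(E × F, ℂ) ((finBasis ℝ E i, 0) : E × F)
    let L' (j) := lineDerivOpCLM ℂ 𝓢(G, ℂ) (finBasis ℝ G j) ∘L L
    have hfd : ∀ Φ : 𝓢(E × F, ℂ), fderiv ℝ (sndFun L Φ) = fun w =>
        ∑ i, A i (sndFun L (D i Φ) w) + ∑ j, B j (sndFun (L' j) Φ w) := fun Φ => by
      ext1 w
      exact (hasFDerivAt_sndFun L Φ w).fderiv
    have hA : ∀ Φ i, ContDiff ℝ n fun w => A i (sndFun L (D i Φ) w) := fun Φ i =>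
      (A i).contDiff.comp ((ih L).1 (D i Φ))
    have hB : ∀ Φ j, ContDiff ℝ n fun w => B j (sndFun (E := E) (L' j) Φ w) := fun Φ j =>
      (B j).contDiff.comp ((ih (L' j)).1 Φ)
    refine ⟨fun Φ => ?_, fun k => ?_⟩
    · rw [Nat.cast_succ, contDiff_succ_iff_fderiv]
      refine ⟨fun w => (hasFDerivAt_sndFun L Φ w).differentiableAt, by simp, ?_⟩
      rw [hfd]
      exact (ContDiff.sum fun i _ => hA Φ i).add (ContDiff.sum fun j _ => hB Φ j)
    · have h1 : ∀ i, ∃ (s : Finset (ℕ × ℕ)) (C : ℝ), 0 ≤ C ∧ ∀ (Φ : 𝓢(E × F, ℂ)) (w : E × G),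
          ‖w‖ ^ k * ‖iteratedFDeriv ℝ n (fun w => A i (sndFun L (D i Φ) w)) w‖ ≤
            C * s.sup (schwartzSeminormFamily ℝ (E × F) ℂ) Φ := by
        intro i
        obtain ⟨s, C, hC, h⟩ := (ih L).2 k
        obtain ⟨s', C', hC', h'⟩ := schwartz_bound (D i) s
        refine ⟨s', ‖A i‖ * (C * C'), by positivity, fun Φ w => ?_⟩
        have := (A i).norm_iteratedFDeriv_comp_left (x := w) (N := n)
          ((ih L).1 (D i Φ)).contDiffAt le_rfl
        calc _ ≤ ‖w‖ ^ k * (‖A i‖ * ‖iteratedFDeriv ℝ n (sndFun L (D i Φ)) w‖) := by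
              gcongr; exact this
          _ = ‖A i‖ * (‖w‖ ^ k * ‖iteratedFDeriv ℝ n (sndFun L (D i Φ)) w‖) := by ring
          _ ≤ ‖A i‖ * (C * (C' * s'.sup (schwartzSeminormFamily ℝ (E × F) ℂ) Φ)) := by
              refine mul_le_mul_of_nonneg_left ((h (D i Φ) w).trans ?_) (A i).opNorm_nonneg
              exact mul_le_mul_of_nonneg_left (h' Φ) hC
          _ = _ := by ring
      have h2 : ∀ j, ∃ (s : Finset (ℕ × ℕ)) (C : ℝ), 0 ≤ C ∧ ∀ (Φ : 𝓢(E × F, ℂ)) (w : E × G),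
          ‖w‖ ^ k * ‖iteratedFDeriv ℝ n (fun w => B j (sndFun (L' j) Φ w)) w‖ ≤
            C * s.sup (schwartzSeminormFamily ℝ (E × F) ℂ) Φ := by
        intro j
        obtain ⟨s, C, hC, h⟩ := (ih (L' j)).2 k
        refine ⟨s, ‖B j‖ * C, by positivity, fun Φ w => ?_⟩
        have := (B j).norm_iteratedFDeriv_comp_left (x := w) (N := n)
          ((ih (L' j)).1 Φ).contDiffAt le_rfl
        calc _ ≤ ‖w‖ ^ k * (‖B j‖ * ‖iteratedFDeriv ℝ n (sndFun (L' j) Φ) w‖) := by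
              gcongr; exact this
          _ = ‖B j‖ * (‖w‖ ^ k * ‖iteratedFDeriv ℝ n (sndFun (L' j) Φ) w‖) := by ring
          _ ≤ ‖B j‖ * (C * s.sup (schwartzSeminormFamily ℝ (E × F) ℂ) Φ) := by
              exact mul_le_mul_of_nonneg_left (h Φ w) (B j).opNorm_nonneg
          _ = _ := by ring
      choose s1 C1 hC1 h1 using h1
      choose s2 C2 hC2 h2 using h2
      let s := (Finset.univ.biUnion s1) ∪ (Finset.univ.biUnion s2)
      refine ⟨s, ∑ i, C1 i + ∑ j, C2 j, add_nonneg (Finset.sum_nonneg fun i _ => hC1 i)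
        (Finset.sum_nonneg fun i _ => hC2 i), fun Φ w => ?_⟩
      rw [← norm_iteratedFDeriv_fderiv, hfd]
      have e : iteratedFDeriv ℝ n (fun w => ∑ i, A i (sndFun L (D i Φ) w) +
          ∑ j, B j (sndFun (L' j) Φ w)) w =
          ∑ i, iteratedFDeriv ℝ n (fun w => A i (sndFun L (D i Φ) w)) w +
          ∑ j, iteratedFDeriv ℝ n (fun w => B j (sndFun (L' j) Φ w)) w := by
        rw [fun_iteratedFDeriv_add (ContDiff.sum fun i _ => hA Φ i)
          (ContDiff.sum fun j _ => hB Φ j)]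
        beta_reduce
        rw [iteratedFDeriv_fun_sum_apply (fun i _ => (hA Φ i).contDiffAt),
          iteratedFDeriv_fun_sum_apply (fun j _ => (hB Φ j).contDiffAt)]
      rw [e]
      calc _ ≤ ‖w‖ ^ k * (∑ i, ‖iteratedFDeriv ℝ n (fun w => A i (sndFun L (D i Φ) w)) w‖ +
          ∑ j, ‖iteratedFDeriv ℝ n (fun w => B j (sndFun (L' j) Φ w)) w‖) := by
            gcongr
            exact (norm_add_le _ _).trans (add_le_add (norm_sum_le _ _) (norm_sum_le _ _))
        _ = ∑ i, ‖w‖ ^ k * ‖iteratedFDeriv ℝ n (fun w => A i (sndFun L (D i Φ) w)) w‖ +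
          ∑ j, ‖w‖ ^ k * ‖iteratedFDeriv ℝ n (fun w => B j (sndFun (L' j) Φ w)) w‖ := by
            rw [mul_add, Finset.mul_sum, Finset.mul_sum]
        _ ≤ ∑ i, C1 i * s.sup (schwartzSeminormFamily ℝ (E × F) ℂ) Φ +
            ∑ j, C2 j * s.sup (schwartzSeminormFamily ℝ (E × F) ℂ) Φ := by
            refine add_le_add (Finset.sum_le_sum fun i _ => ?_) (Finset.sum_le_sum fun j _ => ?_)
            · refine (h1 i Φ w).trans (mul_le_mul_of_nonneg_left ?_ (hC1 i))
              exact Seminorm.le_def.1 (Finset.sup_mono ((Finset.subset_biUnion_of_mem s1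
                (Finset.mem_univ i)).trans Finset.subset_union_left)) Φ
            · refine (h2 j Φ w).trans (mul_le_mul_of_nonneg_left ?_ (hC2 j))
              exact Seminorm.le_def.1 (Finset.sup_mono ((Finset.subset_biUnion_of_mem s2
                (Finset.mem_univ j)).trans Finset.subset_union_right)) Φ
        _ = _ := by rw [← Finset.sum_mul, ← Finset.sum_mul, ← add_mul]

/-- The operator `1 ⊗ L`: it applies `L` to a Schwartz function `Φ(x, y)` in the variable `y`. -/
noncomputable def sndOp (L : 𝓢(F, ℂ) →L[ℂ] 𝓢(G, ℂ)) : 𝓢(E × F, ℂ) →L[ℂ] 𝓢(E × G, ℂ) :=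
  mkCLM (σ := RingHom.id ℂ) (fun Φ => sndFun L Φ) (fun Φ Ψ w => by simp [sndFun])
    (fun a Φ w => by simp [sndFun])
    (fun Φ => contDiff_infty.2 fun n => (sndFun_smooth_bound n L).1 Φ)
    (fun p => by
      obtain ⟨s, C, hC, h⟩ := (sndFun_smooth_bound (E := E) p.2 L).2 p.1
      refine ⟨s, C, hC, fun Φ w => (h Φ w).trans (mul_le_mul_of_nonneg_left ?_ hC)⟩
      refine Seminorm.finset_sup_apply_le (apply_nonneg _ _) fun i hi => ?_
      exact Seminorm.le_def.1 (Finset.le_sup (f := schwartzSeminormFamily ℂ (E × F) ℂ) hi) Φ)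

@[simp] theorem sndOp_apply (L : 𝓢(F, ℂ) →L[ℂ] 𝓢(G, ℂ)) (Φ : 𝓢(E × F, ℂ)) (x : E) (q : G) :
    sndOp L Φ (x, q) = L (sliceCLM x Φ) q := rfl

/-- A tempered distribution, as an operator into the Schwartz space of the one-point space. -/
noncomputable def toPointOp (T : 𝓢'(F, ℂ)) : 𝓢(F, ℂ) →L[ℂ] 𝓢(Fin 0 → ℝ, ℂ) :=
  mkCLM (σ := RingHom.id ℂ) (fun f _ => T f) (fun f g _ => map_add T f g)
    (fun a f _ => map_smul T a f) (fun _ => contDiff_const) (fun p => by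
      have hq : Continuous ((normSeminorm ℂ ℂ).comp (T : 𝓢(F, ℂ) →L[ℂ] ℂ).toLinearMap) :=
        continuous_norm.comp (T : 𝓢(F, ℂ) →L[ℂ] ℂ).continuous
      obtain ⟨s, C, -, h⟩ := Seminorm.bound_of_continuous (schwartz_withSeminorms ℂ F ℂ) _ hq
      refine ⟨s, C, C.2, fun f x => le_trans ?_ (h f)⟩
      have hx : ‖x‖ ^ p.1 ≤ 1 := by
        rw [Subsingleton.elim x 0, norm_zero]
        exact zero_pow_le_one p.1
      have h0 : ‖iteratedFDeriv ℝ p.2 (fun _ : Fin 0 → ℝ => T f) x‖ ≤ ‖T f‖ := by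
        rcases Nat.eq_zero_or_pos p.2 with h | h
        · rw [h, norm_iteratedFDeriv_zero]
        · rw [iteratedFDeriv_const_of_ne h.ne']
          simp
      calc _ ≤ 1 * ‖T f‖ := by gcongr
        _ = ‖T f‖ := one_mul _)

/-- `x ↦ T(Φ(x, ·))`, for a Schwartz function `Φ` of two variables and a tempered distribution `T`
in the second one; it is again a Schwartz function. -/
noncomputable def sndPair (T : 𝓢'(F, ℂ)) : 𝓢(E × F, ℂ) →L[ℂ] 𝓢(E, ℂ) :=
  compCLMOfContinuousLinearEquiv ℂ (ContinuousLinearEquiv.prodUnique ℝ E (Fin 0 → ℝ)).symm ∘L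
    sndOp (toPointOp T)

@[simp] theorem sndPair_apply (T : 𝓢'(F, ℂ)) (Φ : 𝓢(E × F, ℂ)) (x : E) :
    sndPair T Φ x = T (sliceCLM x Φ) := rfl

/-- The tensor product `S ⊗ T` of two tempered distributions:
`⟨S ⊗ T, Φ⟩ = ⟨S(x), ⟨T(y), Φ(x, y)⟩⟩`. -/
noncomputable def tensorDistribution (S : 𝓢'(E, ℂ)) (T : 𝓢'(F, ℂ)) : 𝓢'(E × F, ℂ) :=
  PointwiseConvergenceCLM.precomp ℂ (sndPair T) S

theorem tensorDistribution_apply (S : 𝓢'(E, ℂ)) (T : 𝓢'(F, ℂ)) (Φ : 𝓢(E × F, ℂ)) :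
    tensorDistribution S T Φ = S (sndPair T Φ) := rfl

end Schwartz

section Wigner

variable {n : ℕ}

/-- Configuration space `ℝⁿ`. Phase space `ℝ²ⁿ` is `ℝⁿ × ℝⁿ`, with points `z = (x, p)`. -/
abbrev Rn (n : ℕ) := EuclideanSpace ℝ (Fin n)

/-- The linear change of variables `(u, v) ↦ ((u + v) / 2, (u - v) / (2πħ))`. -/
noncomputable def midpointEquiv {ħ : ℝ} (hħ : 0 < ħ) : (Rn n × Rn n) ≃L[ℝ] (Rn n × Rn n) :=
  LinearEquiv.toContinuousLinearEquiv
    { toFun := fun w => ((1 / 2 : ℝ) • (w.1 + w.2), (2 * Real.pi * ħ)⁻¹ • (w.1 - w.2))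
      invFun := fun w => (w.1 + (Real.pi * ħ) • w.2, w.1 - (Real.pi * ħ) • w.2)
      map_add' := fun a b => by ext <;> simp <;> ring
      map_smul' := fun c a => by ext <;> simp <;> ring
      left_inv := fun w => by
        have := Real.pi_pos
        ext <;> simp <;> field_simp <;> ring
      right_inv := fun w => by
        have := Real.pi_pos
        ext <;> simp <;> field_simp <;> ring }

/-- The kernel `(u, v) ↦ (2πħ)⁻ⁿ ∫ e^{-(i/ħ) p·(u - v)} Φ((u + v) / 2, p) dp`. -/
noncomputable def weylKernel {ħ : ℝ} (hħ : 0 < ħ) : 𝓢(Rn n × Rn n, ℂ) →L[ℂ] 𝓢(Rn n × Rn n, ℂ) :=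
  ((1 / (2 * Real.pi * ħ) : ℝ) ^ n : ℂ) •
    (compCLMOfContinuousLinearEquiv ℂ (midpointEquiv hħ) ∘L
      sndOp (fourierTransformCLM ℂ : 𝓢(Rn n, ℂ) →L[ℂ] 𝓢(Rn n, ℂ)))

theorem weylKernel_apply {ħ : ℝ} (hħ : 0 < ħ) (Φ : 𝓢(Rn n × Rn n, ℂ)) (u v : Rn n) :
    weylKernel hħ Φ (u, v) = ((1 / (2 * Real.pi * ħ) : ℝ) ^ n : ℂ) *
      ∫ p : Rn n, Complex.exp (-(Complex.I / ħ) * (inner ℝ p (u - v) : ℝ)) *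
        Φ ((1 / 2 : ℝ) • (u + v), p) := by
  have h : weylKernel hħ Φ (u, v) = ((1 / (2 * Real.pi * ħ) : ℝ) ^ n : ℂ) *
      𝓕 (sliceCLM ((1 / 2 : ℝ) • (u + v)) Φ) ((2 * Real.pi * ħ)⁻¹ • (u - v)) := rfl
  rw [h, SchwartzMap.fourier_coe, Real.fourier_eq']
  congr 1
  refine integral_congr_ae (.of_forall fun p => ?_)
  simp only [smul_eq_mul, sliceCLM_apply, inner_smul_right]
  congr 2
  have := Real.pi_pos
  push_cast
  field_simp

/-- The Wigner transform of a tempered distribution `ψ`: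
`⟨Wψ, Φ⟩ = ⟨ψ ⊗ ψ̄, K⟩`, with `K(u, v) = (2πħ)⁻ⁿ ∫ e^{-(i/ħ) p·(u - v)} Φ((u + v) / 2, p) dp`. -/
noncomputable def wigner {ħ : ℝ} (hħ : 0 < ħ) (ψ : 𝓢'(Rn n, ℂ)) : 𝓢'(Rn n × Rn n, ℂ) :=
  PointwiseConvergenceCLM.precomp ℂ (weylKernel hħ) (tensorDistribution ψ (conjDistribution ψ))

/-- The integral that defines the Wigner transform of a Schwartz function. -/
noncomputable def wignerFun (ħ : ℝ) (f : 𝓢(Rn n, ℂ)) (z : Rn n × Rn n) : ℂ :=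
  ((1 / (2 * Real.pi * ħ) : ℝ) ^ n : ℂ) * ∫ y : Rn n,
    Complex.exp (-(Complex.I / ħ) * (inner ℝ z.2 y : ℝ)) * f (z.1 + (1 / 2 : ℝ) • y) *
      conj (f (z.1 - (1 / 2 : ℝ) • y))

end Wigner

section PhaseSpace

variable {n : ℕ}

/-- The linear action of a real `2n × 2n` matrix on phase space. -/
noncomputable def phaseMap (M : Matrix (Fin n ⊕ Fin n) (Fin n ⊕ Fin n) ℝ) :
    (Rn n × Rn n) →ₗ[ℝ] (Rn n × Rn n) where
  toFun z :=
    (WithLp.toLp 2 fun i => M.mulVec (Sum.elim z.1.ofLp z.2.ofLp) (Sum.inl i),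
      WithLp.toLp 2 fun i => M.mulVec (Sum.elim z.1.ofLp z.2.ofLp) (Sum.inr i))
  map_add' z w := by
    have h : Sum.elim (z + w).1.ofLp (z + w).2.ofLp =
        Sum.elim z.1.ofLp z.2.ofLp + Sum.elim w.1.ofLp w.2.ofLp := by
      ext i; rcases i with i | i <;> rfl
    ext i <;> simp [-Prod.fst_add, -Prod.snd_add, h, Matrix.mulVec_add]
  map_smul' c z := by
    have h : Sum.elim (c • z).1.ofLp (c • z).2.ofLp = c • Sum.elim z.1.ofLp z.2.ofLp := by
      ext i; rcases i with i | i <;> rfl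
    ext i <;> simp [-Prod.smul_fst, -Prod.smul_snd, h, Matrix.mulVec_smul]

theorem phaseMap_phaseMap (M N : Matrix (Fin n ⊕ Fin n) (Fin n ⊕ Fin n) ℝ) (z : Rn n × Rn n) :
    phaseMap M (phaseMap N z) = phaseMap (M * N) z := by
  have h : Sum.elim (phaseMap N z).1.ofLp (phaseMap N z).2.ofLp =
      N.mulVec (Sum.elim z.1.ofLp z.2.ofLp) := by
    ext i; rcases i with i | i <;> rfl
  have h' : ∀ w : Rn n × Rn n, phaseMap M w =
    (WithLp.toLp 2 fun i => M.mulVec (Sum.elim w.1.ofLp w.2.ofLp) (Sum.inl i),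
      WithLp.toLp 2 fun i => M.mulVec (Sum.elim w.1.ofLp w.2.ofLp) (Sum.inr i)) := fun _ => rfl
  rw [h', h, Matrix.mulVec_mulVec]
  rfl

theorem phaseMap_one (z : Rn n × Rn n) :
    phaseMap (1 : Matrix (Fin n ⊕ Fin n) (Fin n ⊕ Fin n) ℝ) z = z := by
  ext i <;> simp [phaseMap]

/-- The linear automorphism `z ↦ Mz` of phase space, for `M ∈ GL(2n, ℝ)`. -/
noncomputable def phaseEquiv (M : GL (Fin n ⊕ Fin n) ℝ) :
    (Rn n × Rn n) ≃L[ℝ] (Rn n × Rn n) :=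
  LinearEquiv.toContinuousLinearEquiv
    { phaseMap (M : Matrix (Fin n ⊕ Fin n) (Fin n ⊕ Fin n) ℝ) with
      invFun := phaseMap ((M⁻¹ : GL (Fin n ⊕ Fin n) ℝ) : Matrix (Fin n ⊕ Fin n) (Fin n ⊕ Fin n) ℝ)
      left_inv := fun z => by
        change phaseMap _ (phaseMap _ z) = z
        rw [phaseMap_phaseMap, ← Units.val_mul, inv_mul_cancel, Units.val_one, phaseMap_one]
      right_inv := fun z => by
        change phaseMap _ (phaseMap _ z) = z
        rw [phaseMap_phaseMap, ← Units.val_mul, mul_inv_cancel, Units.val_one, phaseMap_one] }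

/-- The composition `T ∘ M` of a tempered distribution on phase space with `M ∈ GL(2n, ℝ)`:
`⟨T ∘ M, Φ⟩ = |det M|⁻¹ ⟨T, Φ ∘ M⁻¹⟩`. -/
noncomputable def compGL (T : 𝓢'(Rn n × Rn n, ℂ)) (M : GL (Fin n ⊕ Fin n) ℝ) :
    𝓢'(Rn n × Rn n, ℂ) :=
  ((|(M : Matrix (Fin n ⊕ Fin n) (Fin n ⊕ Fin n) ℝ).det|⁻¹ : ℝ) : ℂ) •
    PointwiseConvergenceCLM.precomp ℂ
      (compCLMOfContinuousLinearEquiv ℂ (phaseEquiv M).symm) T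

/-- The matrix `C` of the reflection `(x, p) ↦ (x, -p)`. -/
def reflectionMatrix (n : ℕ) : Matrix (Fin n ⊕ Fin n) (Fin n ⊕ Fin n) ℝ :=
  Matrix.fromBlocks 1 0 0 (-1)

/-- `M` is antisymplectic: it changes the sign of the standard symplectic form, `Mᵀ J M = -J`. -/
def IsAntisymplectic (M : Matrix (Fin n ⊕ Fin n) (Fin n ⊕ Fin n) ℝ) : Prop :=
  M.transpose * Matrix.J (Fin n) ℝ * M = -Matrix.J (Fin n) ℝ

end PhaseSpace

section Metaplectic

variable {n : ℕ}

/-- The Hilbert space `L²(ℝⁿ)`. -/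
noncomputable abbrev L2 (n : ℕ) := Lp ℂ 2 (volume : Measure (Rn n))

/-- The quadratic form `W(x, x') = ½ Px·x - Lx·x' + ½ Qx'·x'`. -/
noncomputable def generatingForm (P L Q : Matrix (Fin n) (Fin n) ℝ) (x x' : Rn n) : ℝ :=
  1 / 2 * inner ℝ (Matrix.toEuclideanCLM (𝕜 := ℝ) P x) x -
    inner ℝ (Matrix.toEuclideanCLM (𝕜 := ℝ) L x) x' +
    1 / 2 * inner ℝ (Matrix.toEuclideanCLM (𝕜 := ℝ) Q x') x'

/-- The constant `(2πiħ)^{-n/2} iᵐ √|det L|`, where `i^{-n/2} = e^{-iπn/4}`. -/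
noncomputable def quadraticFourierConst (ħ : ℝ) (L : Matrix (Fin n) (Fin n) ℝ) (m : ℤ) : ℂ :=
  ((1 / √(2 * Real.pi * ħ)) ^ n * √|L.det| : ℝ) *
    Complex.exp (-(Real.pi * n / 4 : ℝ) * Complex.I) * Complex.I ^ m

/-- `U` is the quadratic Fourier transform `Ŝ_{W,m}`:
`U f(x) = (2πiħ)^{-n/2} iᵐ √|det L| ∫ e^{(i/ħ) W(x, x')} f(x') dx'`, where `P`, `Q` are symmetric,
`L` is invertible and `mπ` is an argument of `det L`. -/
def IsQuadraticFourier (ħ : ℝ) (P L Q : Matrix (Fin n) (Fin n) ℝ) (m : ℤ)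
    (U : L2 n ≃ₗᵢ[ℂ] L2 n) : Prop :=
  P.IsSymm ∧ Q.IsSymm ∧ 0 < (-1 : ℝ) ^ m * L.det ∧
    ∀ f : 𝓢(Rn n, ℂ), U (f.toLp 2) =ᵐ[volume] fun x =>
      quadraticFourierConst ħ L m *
        ∫ x' : Rn n, Complex.exp (Complex.I / ħ * generatingForm P L Q x x') * f x'

/-- The free symplectic matrix `S_W` generated by `W`: `(x, p) = S_W (x', p')` if and only if
`p = ∂W/∂x(x, x')` and `p' = -∂W/∂x'(x, x')`. -/
noncomputable def freeSymplectic (P L Q : Matrix (Fin n) (Fin n) ℝ) :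
    Matrix (Fin n ⊕ Fin n) (Fin n ⊕ Fin n) ℝ :=
  Matrix.fromBlocks (L⁻¹ * Q) L⁻¹ (P * L⁻¹ * Q - L.transpose) (P * L⁻¹)

/-- The graph of the covering projection `Mp(n) → Sp(n)`: the group generated by the pairs
`(Ŝ_{W,m}, S_W)`. -/
noncomputable def metaplecticGraph (n : ℕ) (ħ : ℝ) :
    Subgroup ((L2 n ≃ₗᵢ[ℂ] L2 n) × Matrix.symplecticGroup (Fin n) ℝ) :=
  Subgroup.closure {a | ∃ P L Q m, IsQuadraticFourier ħ P L Q m a.1 ∧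
    (a.2 : Matrix (Fin n ⊕ Fin n) (Fin n ⊕ Fin n) ℝ) = freeSymplectic P L Q}

/-- The metaplectic group `Mp(n)`, a group of unitary operators on `L²(ℝⁿ)`. -/
noncomputable def metaplecticGroup (n : ℕ) (ħ : ℝ) : Subgroup (L2 n ≃ₗᵢ[ℂ] L2 n) :=
  (metaplecticGraph n ħ).map (MonoidHom.fst _ _)

/-- The metaplectic operator `U` covers the symplectic matrix `S`. -/
def Covers {ħ : ℝ} (U : metaplecticGroup n ħ) (S : Matrix.symplecticGroup (Fin n) ℝ) : Prop :=
  ((U : L2 n ≃ₗᵢ[ℂ] L2 n), S) ∈ metaplecticGraph n ħ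

theorem hasTemperateGrowth_expI :
    Function.HasTemperateGrowth (fun t : ℝ => Complex.exp (Complex.I * t)) := by
  have h : ∀ k : ℕ, iteratedDeriv k (fun t : ℝ => Complex.exp (Complex.I * t)) =
      fun t : ℝ => Complex.I ^ k * Complex.exp (Complex.I * t) := by
    intro k
    induction k with
    | zero => simp
    | succ k ih =>
      rw [iteratedDeriv_succ, ih]
      ext t
      have h1 : HasDerivAt (fun t : ℝ => Complex.I * (t : ℂ)) Complex.I t := by
        simpa using (Complex.ofRealCLM.hasDerivAt (x := t)).const_mul Complex.I
      rw [((h1.cexp).const_mul (Complex.I ^ k)).deriv, pow_succ]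
      ring
  refine ⟨?_, fun k => ⟨0, 1, fun t => ?_⟩⟩
  · exact Complex.contDiff_exp.comp (contDiff_const.mul Complex.ofRealCLM.contDiff)
  · rw [norm_iteratedFDeriv_eq_norm_iteratedDeriv, h, norm_mul, norm_pow, Complex.norm_I,
      Complex.norm_exp]
    simp

/-- The chirp `x ↦ e^{(i/2ħ) Px·x}`. -/
noncomputable def chirp (ħ : ℝ) (P : Matrix (Fin n) (Fin n) ℝ) (x : Rn n) : ℂ :=
  Complex.exp (Complex.I *
    ((1 / (2 * ħ) * inner ℝ (Matrix.toEuclideanCLM (𝕜 := ℝ) P x) x : ℝ) : ℂ))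

theorem hasTemperateGrowth_chirp (ħ : ℝ) (P : Matrix (Fin n) (Fin n) ℝ) :
    (chirp ħ P).HasTemperateGrowth := by
  have h : Function.HasTemperateGrowth fun x : Rn n =>
      1 / (2 * ħ) * inner ℝ (Matrix.toEuclideanCLM (𝕜 := ℝ) P x) x :=
    (Function.HasTemperateGrowth.const _).mul
      ((innerSL ℝ).bilinear_hasTemperateGrowth
        (ContinuousLinearMap.hasTemperateGrowth _) .id')
  exact hasTemperateGrowth_expI.comp h

theorem chirp_mul_chirp_neg (ħ : ℝ) (P : Matrix (Fin n) (Fin n) ℝ) (x : Rn n) :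
    chirp ħ P x * chirp ħ (-P) x = 1 := by
  rw [chirp, chirp, ← Complex.exp_add, ← Complex.exp_zero]
  congr 1
  simp

/-- Multiplication by a chirp, as an automorphism of the Schwartz space. -/
noncomputable def chirpEquiv (ħ : ℝ) (P : Matrix (Fin n) (Fin n) ℝ) :
    𝓢(Rn n, ℂ) ≃L[ℂ] 𝓢(Rn n, ℂ) :=
  ContinuousLinearEquiv.equivOfInverse (smulLeftCLM ℂ (chirp ħ P)) (smulLeftCLM ℂ (chirp ħ (-P)))
    (fun f => by
      ext x
      rw [smulLeftCLM_apply_apply (hasTemperateGrowth_chirp _ _),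
        smulLeftCLM_apply_apply (hasTemperateGrowth_chirp _ _), smul_smul, mul_comm,
        chirp_mul_chirp_neg, one_smul])
    (fun f => by
      ext x
      rw [smulLeftCLM_apply_apply (hasTemperateGrowth_chirp _ _),
        smulLeftCLM_apply_apply (hasTemperateGrowth_chirp _ _), smul_smul,
        chirp_mul_chirp_neg, one_smul])

theorem chirpEquiv_apply (ħ : ℝ) (P : Matrix (Fin n) (Fin n) ℝ) (f : 𝓢(Rn n, ℂ)) (x : Rn n) :
    chirpEquiv ħ P f x = chirp ħ P x * f x :=
  smulLeftCLM_apply_apply (hasTemperateGrowth_chirp _ _) f x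

/-- The dilation `x ↦ Lx / (2πħ)`. -/
noncomputable def dilationEquiv {ħ : ℝ} (hħ : 0 < ħ) (L : Matrix (Fin n) (Fin n) ℝ)
    (hL : L.det ≠ 0) : Rn n ≃L[ℝ] Rn n :=
  ContinuousLinearEquiv.equivOfInverse
    ((2 * Real.pi * ħ)⁻¹ • Matrix.toEuclideanCLM (𝕜 := ℝ) L)
    ((2 * Real.pi * ħ) • Matrix.toEuclideanCLM (𝕜 := ℝ) L⁻¹)
    (fun x => by
      have h0 : 2 * Real.pi * ħ ≠ 0 := by have := Real.pi_pos; positivity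
      simp only [smul_apply, map_smul]
      rw [smul_smul, inv_mul_cancel₀ h0, one_smul, ← mul_apply_eq_comp, ← map_mul,
        Matrix.nonsing_inv_mul _ (isUnit_iff_ne_zero.2 hL), map_one,
        one_apply_eq_self])
    (fun x => by
      have h0 : 2 * Real.pi * ħ ≠ 0 := by have := Real.pi_pos; positivity
      simp only [smul_apply, map_smul]
      rw [smul_smul, mul_inv_cancel₀ h0, one_smul, ← mul_apply_eq_comp, ← map_mul,
        Matrix.mul_nonsing_inv _ (isUnit_iff_ne_zero.2 hL), map_one,
        one_apply_eq_self])

/-- Composition with a linear automorphism, as an automorphism of the Schwartz space. -/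
noncomputable def compEquiv (g : Rn n ≃L[ℝ] Rn n) : 𝓢(Rn n, ℂ) ≃L[ℂ] 𝓢(Rn n, ℂ) :=
  ContinuousLinearEquiv.equivOfInverse (compCLMOfContinuousLinearEquiv ℂ g)
    (compCLMOfContinuousLinearEquiv ℂ g.symm) (fun f => by ext x; simp) (fun f => by ext x; simp)

theorem IsQuadraticFourier.exists_schwartz {ħ : ℝ} (hħ : 0 < ħ)
    {P L Q : Matrix (Fin n) (Fin n) ℝ} {m : ℤ} {U : L2 n ≃ₗᵢ[ℂ] L2 n}
    (h : IsQuadraticFourier ħ P L Q m U) :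
    ∃ A : 𝓢(Rn n, ℂ) ≃L[ℂ] 𝓢(Rn n, ℂ), ∀ f, U (f.toLp 2) = (A f).toLp 2 := by
  have hL : L.det ≠ 0 := fun h0 => by
    have := h.2.2.1
    rw [h0, mul_zero] at this
    exact lt_irrefl _ this
  have hc : quadraticFourierConst ħ L m ≠ 0 := by
    have := Real.pi_pos
    have : 0 < |L.det| := abs_pos.2 hL
    rw [quadraticFourierConst]
    refine mul_ne_zero (mul_ne_zero ?_ (Complex.exp_ne_zero _)) (zpow_ne_zero _ Complex.I_ne_zero)
    rw [Complex.ofReal_ne_zero]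
    positivity
  refine ⟨(((chirpEquiv ħ Q).trans (FourierTransform.fourierCLE ℂ 𝓢(Rn n, ℂ))).trans
    (compEquiv (dilationEquiv hħ L hL))).trans ((chirpEquiv ħ P).trans
      (ContinuousLinearEquiv.smulLeft (Units.mk0 _ hc))), fun f => ?_⟩
  refine Lp.ext ((h.2.2.2 f).trans (Filter.EventuallyEq.trans (.of_eq ?_)
    (SchwartzMap.coeFn_toLp _ 2 volume).symm))
  ext x
  have e : ((((chirpEquiv ħ Q).trans (FourierTransform.fourierCLE ℂ 𝓢(Rn n, ℂ))).trans
    (compEquiv (dilationEquiv hħ L hL))).trans ((chirpEquiv ħ P).trans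
      (ContinuousLinearEquiv.smulLeft (Units.mk0 _ hc)))) f x =
      quadraticFourierConst ħ L m * (chirp ħ P x * 𝓕 (chirpEquiv ħ Q f)
        ((2 * Real.pi * ħ)⁻¹ • Matrix.toEuclideanCLM (𝕜 := ℝ) L x)) := by
    change quadraticFourierConst ħ L m * chirpEquiv ħ P (compEquiv (dilationEquiv hħ L hL)
      (𝓕 (chirpEquiv ħ Q f))) x = _
    rw [chirpEquiv_apply]
    rfl
  rw [e, SchwartzMap.fourier_coe, Real.fourier_eq', ← integral_const_mul (chirp ħ P x)]
  congr 1
  refine integral_congr_ae (.of_forall fun y => ?_)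
  simp only [smul_eq_mul, chirpEquiv_apply, chirp, generatingForm, inner_smul_right, ← mul_assoc,
    ← Complex.exp_add]
  congr 2
  have := Real.pi_pos
  rw [real_inner_comm y]
  push_cast
  field_simp
  ring

/-- A metaplectic operator restricts to an automorphism of the Schwartz space. -/
theorem exists_schwartz {ħ : ℝ} (hħ : 0 < ħ) (U : metaplecticGroup n ħ) :
    ∃ A : 𝓢(Rn n, ℂ) ≃L[ℂ] 𝓢(Rn n, ℂ), ∀ f, (U : L2 n ≃ₗᵢ[ℂ] L2 n) (f.toLp 2) = (A f).toLp 2 := by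
  obtain ⟨U, a, ha, rfl⟩ := U
  change ∃ A : 𝓢(Rn n, ℂ) ≃L[ℂ] 𝓢(Rn n, ℂ), ∀ f, a.1 (f.toLp 2) = (A f).toLp 2
  induction ha using Subgroup.closure_induction with
  | mem a ha =>
    obtain ⟨P, L, Q, m, h, -⟩ := ha
    exact h.exists_schwartz hħ
  | one => exact ⟨ContinuousLinearEquiv.refl ℂ _, fun f => rfl⟩
  | mul a b _ _ iha ihb =>
    obtain ⟨A, hA⟩ := iha
    obtain ⟨B, hB⟩ := ihb
    refine ⟨B.trans A, fun f => ?_⟩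
    change a.1 (b.1 (f.toLp 2)) = _
    rw [hB, hA]
    rfl
  | inv a _ iha =>
    obtain ⟨A, hA⟩ := iha
    refine ⟨A.symm, fun f => ?_⟩
    change a.1.symm (f.toLp 2) = _
    rw [LinearIsometryEquiv.symm_apply_eq, hA, ContinuousLinearEquiv.apply_symm_apply]

/-- The restriction of a metaplectic operator to the Schwartz space. -/
noncomputable def metaplecticSchwartz {ħ : ℝ} (hħ : 0 < ħ) (U : metaplecticGroup n ħ) :
    𝓢(Rn n, ℂ) ≃L[ℂ] 𝓢(Rn n, ℂ) :=
  Classical.choose (exists_schwartz hħ U)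

theorem toLp_metaplecticSchwartz {ħ : ℝ} (hħ : 0 < ħ) (U : metaplecticGroup n ħ)
    (f : 𝓢(Rn n, ℂ)) :
    (metaplecticSchwartz hħ U f).toLp 2 = (U : L2 n ≃ₗᵢ[ℂ] L2 n) (f.toLp 2) :=
  (Classical.choose_spec (exists_schwartz hħ U) f).symm

/-- The extension of a metaplectic operator to the tempered distributions: `⟨Uψ, φ⟩ = ⟨ψ, χ⟩`,
where `χ` is the complex conjugate of `U⁻¹ φ̄`. -/
noncomputable def metaplecticDistribution {ħ : ℝ} (hħ : 0 < ħ) (U : metaplecticGroup n ħ)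
    (ψ : 𝓢'(Rn n, ℂ)) : 𝓢'(Rn n, ℂ) :=
  PointwiseConvergenceCLM.precomp ℂ
    (conjSchwartz.comp
      ((metaplecticSchwartz hħ U⁻¹ : 𝓢(Rn n, ℂ) →L[ℂ] 𝓢(Rn n, ℂ)).comp conjSchwartz)) ψ

end Metaplectic

theorem coe_schwartz_apply {E : Type} [NormedAddCommGroup E] [InnerProductSpace ℝ E]
    [FiniteDimensional ℝ E] [MeasurableSpace E] [BorelSpace E] (f g : 𝓢(E, ℂ)) :
    (f : 𝓢'(E, ℂ)) g = ∫ x, g x * f x :=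
  SchwartzMap.toTemperedDistributionCLM_apply_apply volume f g

theorem coe_metaplecticDistribution {n : ℕ} {ħ : ℝ} (hħ : 0 < ħ) (U : metaplecticGroup n ħ)
    (f : 𝓢(Rn n, ℂ)) : metaplecticDistribution hħ U (f : 𝓢'(Rn n, ℂ)) =
      (metaplecticSchwartz hħ U f : 𝓢(Rn n, ℂ)) := by
  ext g
  have h1 : ∀ a b : 𝓢(Rn n, ℂ), (b : 𝓢'(Rn n, ℂ)) (conjSchwartz a) =
      inner ℂ (a.toLp 2 (volume : Measure (Rn n))) (b.toLp 2) := by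
    intro a b
    rw [SchwartzMap.inner_toL2_toL2_eq a b volume, coe_schwartz_apply]
    refine integral_congr_ae (.of_forall fun x => ?_)
    simp [mul_comm]
  have h2 : conjSchwartz (conjSchwartz g) = g := by ext x; simp
  change (f : 𝓢'(Rn n, ℂ)) (conjSchwartz (metaplecticSchwartz hħ U⁻¹ (conjSchwartz g))) = _
  conv_rhs => rw [← h2]
  rw [h1, h1, toLp_metaplecticSchwartz, toLp_metaplecticSchwartz,
    ← LinearIsometryEquiv.inner_map_map (U : L2 n ≃ₗᵢ[ℂ] L2 n)]
  congr 1
  change (U : L2 n ≃ₗᵢ[ℂ] L2 n) ((U : L2 n ≃ₗᵢ[ℂ] L2 n).symm _) = _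
  rw [LinearIsometryEquiv.apply_symm_apply]

theorem measurePreserving_midpoint {n : ℕ} : MeasurePreserving
    (fun w : Rn n × Rn n => (w.1 + (1 / 2 : ℝ) • w.2, w.1 - (1 / 2 : ℝ) • w.2)) := by
  have h1 : MeasurePreserving (fun w : Rn n × Rn n => (w.1, w.2 + (1 / 2 : ℝ) • w.1)) :=
    (MeasurePreserving.id volume).skew_product (g := fun y x => x + (1 / 2 : ℝ) • y)
      (by fun_prop) (.of_forall fun y => (measurePreserving_add_right volume _).map_eq)
  have h2 : MeasurePreserving (fun w : Rn n × Rn n => (w.1, w.1 - w.2)) :=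
    (MeasurePreserving.id volume).skew_product (g := fun u y => u - y)
      (by fun_prop) (.of_forall fun u => (Measure.measurePreserving_sub_left volume u).map_eq)
  have hs : MeasurePreserving (Prod.swap : Rn n × Rn n → Rn n × Rn n) :=
    Measure.measurePreserving_swap
  have h3 := h2.comp (hs.comp (h1.comp hs))
  have e : (fun w : Rn n × Rn n => (w.1 + (1 / 2 : ℝ) • w.2, w.1 - (1 / 2 : ℝ) • w.2)) =
      (fun w : Rn n × Rn n => (w.1, w.1 - w.2)) ∘ Prod.swap ∘
        (fun w : Rn n × Rn n => (w.1, w.2 + (1 / 2 : ℝ) • w.1)) ∘ Prod.swap := by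
    ext w <;> simp
    ring
  rw [e]
  exact h3

/-- For a Schwartz function the Wigner transform is given by the usual integral. -/
theorem wigner_schwartz {n : ℕ} {ħ : ℝ} (hħ : 0 < ħ) (f : 𝓢(Rn n, ℂ)) (Φ : 𝓢(Rn n × Rn n, ℂ)) :
    wigner hħ (f : 𝓢'(Rn n, ℂ)) Φ = ∫ z, wignerFun ħ f z * Φ z := by
  set c : ℂ := ((1 / (2 * Real.pi * ħ) : ℝ) ^ n : ℂ) with hc
  let H : (Rn n × Rn n) × Rn n → ℂ := fun w =>
    Complex.exp (-(Complex.I / ħ) * (inner ℝ w.2 (w.1.1 - w.1.2) : ℝ)) *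
      Φ ((1 / 2 : ℝ) • (w.1.1 + w.1.2), w.2) * (f w.1.1 * conj (f w.1.2))
  have hHc : Continuous H := by
    have := f.continuous
    have := Φ.continuous
    fun_prop
  have hH : Integrable H := by
    set l := (volume : Measure (Rn n)).integrablePower with hl
    obtain ⟨D, hD⟩ : ∃ D : ℝ, ∀ x p : Rn n, ‖Φ (x, p)‖ ≤ D * (1 + ‖p‖) ^ (-(l : ℝ)) := by
      obtain ⟨C₁, -, h₁⟩ := Φ.decay 0 0
      obtain ⟨C₂, -, h₂⟩ := Φ.decay l 0
      refine ⟨2 ^ l * (C₁ + C₂), fun x p => ?_⟩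
      have := pow_mul_le_of_le_of_pow_mul_le (k := 0) (l := l) (norm_nonneg p)
        (norm_nonneg (Φ (x, p))) (C₁ := C₁) (C₂ := C₂) (by simpa using h₁ (x, p)) (by
          have := h₂ (x, p)
          rw [norm_iteratedFDeriv_zero] at this
          refine le_trans ?_ this
          rw [zero_add]
          gcongr
          exact norm_snd_le (x, p))
      simpa using this
    have hg : Integrable (fun w : (Rn n × Rn n) × Rn n => (f w.1.1 * conj (f w.1.2)) *
        ((D * (1 + ‖w.2‖) ^ (-(l : ℝ)) : ℝ) : ℂ)) := by
      refine Integrable.mul_prod (f := fun w : Rn n × Rn n => f w.1 * conj (f w.2))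
        (g := fun p : Rn n => ((D * (1 + ‖p‖) ^ (-(l : ℝ)) : ℝ) : ℂ)) ?_ ?_
      · exact Integrable.mul_prod f.integrable (conjSchwartz f).integrable
      · exact ((Measure.integrable_pow_neg_integrablePower volume).const_mul D).ofReal
    refine hg.mono hHc.aestronglyMeasurable (.of_forall fun w => ?_)
    have h1 : ‖Complex.exp (-(Complex.I / ħ) * (inner ℝ w.2 (w.1.1 - w.1.2) : ℝ))‖ = 1 := by
      rw [Complex.norm_exp]
      simp [Complex.div_re]
    have h2 := hD ((1 / 2 : ℝ) • (w.1.1 + w.1.2)) w.2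
    simp only [H]
    rw [norm_mul, norm_mul, h1, one_mul, norm_mul (f w.1.1 * _), mul_comm]
    gcongr
    rw [Complex.norm_real]
    exact h2.trans (le_abs_self _)
  have hH' : ∫ w, H w = ∫ w : Rn n × Rn n, ∫ p, H (w, p) := integral_prod _ hH
  have hL : wigner hħ (f : 𝓢'(Rn n, ℂ)) Φ = c * ∫ w, H w := by
    have hI : Integrable fun w : Rn n × Rn n => ∫ p, H (w, p) := hH.integral_prod_left
    have hI' : ∫ w : Rn n × Rn n, ∫ p, H (w, p) = ∫ u, ∫ v, ∫ p, H ((u, v), p) :=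
      integral_prod _ hI
    rw [hH', hI', ← integral_const_mul]
    change (f : 𝓢'(Rn n, ℂ)) (sndPair (conjDistribution (f : 𝓢'(Rn n, ℂ))) (weylKernel hħ Φ)) = _
    rw [coe_schwartz_apply]
    refine integral_congr_ae (.of_forall fun u => ?_)
    simp only [sndPair_apply, conjDistribution_apply, coe_schwartz_apply]
    rw [← integral_conj, ← integral_mul_const, ← integral_const_mul]
    refine integral_congr_ae (.of_forall fun v => ?_)
    simp only [conjSchwartz_apply, sliceCLM_apply, map_mul, Complex.conj_conj, weylKernel_apply]
    simp only [H]
    rw [integral_mul_const, ← hc]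
    ring
  have hρ : MeasurePreserving (fun w : (Rn n × Rn n) × Rn n =>
      ((w.1.1 + (1 / 2 : ℝ) • w.2, w.1.1 - (1 / 2 : ℝ) • w.2), w.1.2)) := by
    have ha : MeasurePreserving (MeasurableEquiv.prodAssoc : (Rn n × Rn n) × Rn n ≃ᵐ _) :=
      measurePreserving_prodAssoc volume volume volume
    have hs : MeasurePreserving (Prod.swap : Rn n × Rn n → Rn n × Rn n) :=
      Measure.measurePreserving_swap
    have hs' : MeasurePreserving (Prod.map id Prod.swap : Rn n × Rn n × Rn n → _) :=
      (MeasurePreserving.id volume).prod hs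
    have hm : MeasurePreserving (Prod.map (fun w : Rn n × Rn n =>
        (w.1 + (1 / 2 : ℝ) • w.2, w.1 - (1 / 2 : ℝ) • w.2)) (id : Rn n → Rn n)) :=
      measurePreserving_midpoint.prod (MeasurePreserving.id volume)
    exact hm.comp ((ha.symm _).comp (hs'.comp ha))
  have hR : ∫ z, wignerFun ħ f z * Φ z = c * ∫ w, H w := by
    have h1 : ∫ w, H w = ∫ w : (Rn n × Rn n) × Rn n,
        H ((w.1.1 + (1 / 2 : ℝ) • w.2, w.1.1 - (1 / 2 : ℝ) • w.2), w.1.2) := by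
      conv_lhs => rw [← hρ.map_eq]
      exact integral_map hρ.measurable.aemeasurable hHc.aestronglyMeasurable
    have h2 : Integrable fun w : (Rn n × Rn n) × Rn n =>
        H ((w.1.1 + (1 / 2 : ℝ) • w.2, w.1.1 - (1 / 2 : ℝ) • w.2), w.1.2) :=
      hρ.integrable_comp_of_integrable hH
    have h3 : (∫ w : (Rn n × Rn n) × Rn n,
        H ((w.1.1 + (1 / 2 : ℝ) • w.2, w.1.1 - (1 / 2 : ℝ) • w.2), w.1.2)) =
        ∫ z : Rn n × Rn n, ∫ y : Rn n,
          H ((z.1 + (1 / 2 : ℝ) • y, z.1 - (1 / 2 : ℝ) • y), z.2) := integral_prod _ h2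
    rw [h1, h3, ← integral_const_mul]
    refine integral_congr_ae (.of_forall fun z => ?_)
    simp only [wignerFun]
    rw [← hc, mul_assoc, ← integral_mul_const]
    congr 1
    refine integral_congr_ae (.of_forall fun y => ?_)
    have e1 : z.1 + (1 / 2 : ℝ) • y - (z.1 - (1 / 2 : ℝ) • y) = y := by
      ext i; simp; ring
    have e2 : (1 / 2 : ℝ) • (z.1 + (1 / 2 : ℝ) • y + (z.1 - (1 / 2 : ℝ) • y)) = z.1 := by
      ext i; simp; ring
    simp only [H, e1, e2]
    ring
  rw [hL, hR]

/-! ### Derivatives of functions obtained by acting in one variable. -/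

section PartialOperators

variable {E F G : Type} [NormedAddCommGroup E] [NormedSpace ℝ E]
  [NormedAddCommGroup F] [NormedSpace ℝ F] [NormedAddCommGroup G] [NormedSpace ℝ G]

/-! Sufficiency. Moving an operator off `ψ` and its conjugate turns covariance of `W` into an
identity between Schwartz kernels (`wigner_transport`, `IsWignerCovariant.of_kernel`). A quadratic
Fourier transform is a product of a constant, two chirps, a dilation and the Fourier transform. For
each factor the kernel identity is a change of variables in an integral, and the scalar factors
multiply to 1. Products and inverses are handled by induction on the graph of the covering
(`exists_covariant_of_mem_metaplecticGraph`), which gives `Wψ ∘ S = W(Ŝ⁻¹ψ)`. The covering is onto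
(`exists_covers`): a symplectic matrix with invertible upper right block has a generating form, and
a shear brings every other one to this case. Reflection of the momentum exchanges the two arguments
of the kernel, so `Wψ ∘ C = W(ψ̄)` (`wigner_conjDistribution`), and the antisymplectic case follows
from `M = CS`.

All this requires that distributions in different variables commute (`apply_sndPair_comm`). If one
of them is a Schwartz density, the integral is a Bochner integral in a Banach space of weighted
jets, to which the other distribution extends by Hahn-Banach. The general case is a limit of
regularizations.

Necessity. Only images of the Gaussian ground state `φ₀` are tested. If `ψ = Ŝ⁻¹φ₀`, then `Wψ ∘ M`
is a multiple of `Wφ₀ ∘ P` with `P = SM`, and it solves `ħ∂_a T + 2(Fa·z)T = 0` with `F = PᵀP`. If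
it equals `Wψ'`, these equations on the kernel side split into an operator in `u` plus one in `v`.
Hence `ψ'`, which is nonzero, is an eigenvector of the transpose of every operator in `u`. The
commutators of these operators are scalars, so they vanish, and their imaginary part says that `F`
is symplectic (`symplectic_of_wigner`).

It remains to solve `(SM)ᵀ(SM) J (SM)ᵀ(SM) = J` for all symplectic `S`. It says that `N = MJMᵀ`
satisfies `(SᵀS)N(SᵀS) = N`. Block diagonal `S` force `N = βJ`, and `S = 1` gives `β² = 1`
(`symplectic_or_antisymplectic`). -/

theorem lineDeriv_slice (x : E) (v : F) (K : 𝓢(E × F, ℂ)) :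
    (∂_{v} (sliceCLM x K) : 𝓢(F, ℂ)) = sliceCLM x (∂_{((0, v) : E × F)} K) := by
  ext y
  rw [sliceCLM_apply, lineDerivOp_apply_eq_fderiv, lineDerivOp_apply_eq_fderiv]
  have h : HasFDerivAt (fun y => K (x, y))
      (fderiv ℝ K (x, y) ∘L ContinuousLinearMap.inr ℝ E F) y :=
    (K.hasFDerivAt (x, y)).comp y (hasFDerivAt_prodMk_right x y)
  change fderiv ℝ (fun y => K (x, y)) y v = _
  rw [h.fderiv]
  rfl

variable [FiniteDimensional ℝ E]

theorem lineDeriv_fst_eq_sum (v : E) (K : 𝓢(E × F, ℂ)) :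
    (∂_{((v, 0) : E × F)} K : 𝓢(E × F, ℂ)) =
      ∑ i, (Module.finBasis ℝ E).coord i v • ∂_{((Module.finBasis ℝ E i, 0) : E × F)} K := by
  ext z
  simp only [sum_apply, smul_apply, lineDerivOp_apply_eq_fderiv]
  conv_lhs => rw [← (Module.finBasis ℝ E).sum_repr v]
  have : ((∑ i, ((Module.finBasis ℝ E).repr v) i • (Module.finBasis ℝ E) i, 0) : E × F) =
    ContinuousLinearMap.inl ℝ E F (∑ i, ((Module.finBasis ℝ E).repr v) i •
      (Module.finBasis ℝ E) i) := rfl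
  rw [this, map_sum, map_sum]
  simp [-map_sum, -ContinuousLinearMap.inl_apply]
  rfl

variable [FiniteDimensional ℝ G]

/-- The derivative formula `hasFDerivAt_sndFun` is given in a basis; linearity in the direction
reassembles it for an arbitrary `v`. -/
theorem lineDeriv_fst_sndOp (L : 𝓢(F, ℂ) →L[ℂ] 𝓢(G, ℂ)) (v : E) (K : 𝓢(E × F, ℂ)) :
    (∂_{((v, 0) : E × G)} (sndOp L K) : 𝓢(E × G, ℂ)) = sndOp L (∂_{((v, 0) : E × F)} K) := by
  ext w
  rw [lineDerivOp_apply_eq_fderiv, lineDeriv_fst_eq_sum]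
  change fderiv ℝ (sndFun L K) w (v, 0) = sndFun L _ w
  rw [(hasFDerivAt_sndFun L K w).fderiv, sndFun_sum]
  simp

theorem lineDeriv_snd_sndOp (L : 𝓢(F, ℂ) →L[ℂ] 𝓢(G, ℂ)) (v : G) (K : 𝓢(E × F, ℂ)) :
    (∂_{((0, v) : E × G)} (sndOp L K) : 𝓢(E × G, ℂ)) =
      sndOp (lineDerivOpCLM ℂ 𝓢(G, ℂ) v ∘L L) K := by
  ext ⟨x, q⟩
  have h : ∀ f : 𝓢(E × G, ℂ), (∂_{((0, v) : E × G)} f) (x, q) = ∂_{v} (sliceCLM x f) q :=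
    fun f => by rw [lineDeriv_slice]; rfl
  rw [h]
  rfl

theorem lineDeriv_sndPair (T : 𝓢'(F, ℂ)) (v : E) (K : 𝓢(E × F, ℂ)) :
    (∂_{v} (sndPair T K) : 𝓢(E, ℂ)) = sndPair T (∂_{((v, 0) : E × F)} K) := by
  change ∂_{v} (compCLMOfContinuousLinearEquiv ℂ
    (ContinuousLinearEquiv.prodUnique ℝ E (Fin 0 → ℝ)).symm (sndOp (toPointOp T) K)) = _
  rw [lineDerivOp_compCLMOfContinuousLinearEquiv]
  have e : (ContinuousLinearEquiv.prodUnique ℝ E (Fin 0 → ℝ)).symm v = (v, 0) :=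
    Prod.ext rfl (Subsingleton.elim _ _)
  rw [e]
  change compCLMOfContinuousLinearEquiv ℂ (ContinuousLinearEquiv.prodUnique ℝ E (Fin 0 → ℝ)).symm
    (∂_{((v, 0) : E × (Fin 0 → ℝ))} (sndOp (toPointOp T) K)) = _
  rw [lineDeriv_fst_sndOp]
  rfl

/-- Exchange of the two variables. -/
noncomputable def swapCLM : 𝓢(E × F, ℂ) →L[ℂ] 𝓢(F × E, ℂ) :=
  compCLMOfContinuousLinearEquiv ℂ (ContinuousLinearEquiv.prodComm ℝ F E)

omit [FiniteDimensional ℝ E] in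
@[simp] theorem swapCLM_apply (K : 𝓢(E × F, ℂ)) (y : F) (x : E) :
    swapCLM K (y, x) = K (x, y) := rfl

end PartialOperators

/-! ### A Banach space that carries a given tempered distribution. -/

section Jets

open scoped BoundedContinuousFunction

variable {E F : Type} [NormedAddCommGroup E] [NormedSpace ℝ E]
  [NormedAddCommGroup F] [NormedSpace ℝ F]

/-- The Banach space in which the Schwartz space is embedded by `weightedJet`. -/
def JetSpace (F : Type) [NormedAddCommGroup F] [NormedSpace ℝ F] (s : Finset (ℕ × ℕ)) :=
  (p : s) → F →ᵇ (F [×p.1.2]→L[ℝ] ℂ)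

noncomputable instance (s : Finset (ℕ × ℕ)) : NormedAddCommGroup (JetSpace F s) :=
  inferInstanceAs (NormedAddCommGroup ((p : s) → F →ᵇ (F [×p.1.2]→L[ℝ] ℂ)))

noncomputable instance (s : Finset (ℕ × ℕ)) : NormedSpace ℂ (JetSpace F s) :=
  inferInstanceAs (NormedSpace ℂ ((p : s) → F →ᵇ (F [×p.1.2]→L[ℝ] ℂ)))

instance (s : Finset (ℕ × ℕ)) : CompleteSpace (JetSpace F s) :=
  inferInstanceAs (CompleteSpace ((p : s) → F →ᵇ (F [×p.1.2]→L[ℝ] ℂ)))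

theorem JetSpace.norm_le_iff {s : Finset (ℕ × ℕ)} {r : ℝ} (hr : 0 ≤ r) (v : JetSpace F s) :
    ‖v‖ ≤ r ↔ ∀ p : s, ‖v p‖ ≤ r :=
  pi_norm_le_iff_of_nonneg hr

/-- Evaluation of a jet at a point. -/
noncomputable def JetSpace.eval {s : Finset (ℕ × ℕ)} (p : s) (y : F) (m : Fin p.1.2 → F) :
    JetSpace F s →L[ℂ] ℂ :=
  LinearMap.mkContinuous
    { toFun := fun v => v p y m
      map_add' := fun _ _ => rfl
      map_smul' := fun _ _ => rfl } (∏ i, ‖m i‖) fun v => by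
    rw [mul_comm]
    refine ((v p y).le_opNorm m).trans ?_
    gcongr
    exact ((v p).norm_coe_le_norm y).trans ((JetSpace.norm_le_iff (norm_nonneg _) v).1 le_rfl p)

/-- The functions `‖y‖ᵏ Dʲ g(y)`, for `(k, j) ∈ s`. -/
noncomputable def weightedJet (s : Finset (ℕ × ℕ)) : 𝓢(F, ℂ) →ₗ[ℂ] JetSpace F s where
  toFun g p := BoundedContinuousFunction.ofNormedAddCommGroup
    (fun y => ‖y‖ ^ p.1.1 • iteratedFDeriv ℝ p.1.2 g y)
    ((continuous_norm.pow _).smul ((g.smooth ⊤).continuous_iteratedFDeriv (mod_cast le_top)))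
    (SchwartzMap.seminorm ℝ p.1.1 p.1.2 g) (fun y => by
      rw [norm_smul, norm_pow, norm_norm]
      exact SchwartzMap.le_seminorm ℝ _ _ g y)
  map_add' f g := by
    refine funext fun p => BoundedContinuousFunction.ext fun y => ContinuousMultilinearMap.ext fun m => ?_
    have h := iteratedFDeriv_add_apply (𝕜 := ℝ) (i := p.1.2) (x := y)
      ((f.smooth p.1.2).contDiffAt) ((g.smooth p.1.2).contDiffAt)
    change ‖y‖ ^ p.1.1 • iteratedFDeriv ℝ p.1.2 (f + g : F → ℂ) y m = _
    rw [h]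
    exact smul_add _ _ _
  map_smul' c f := by
    refine funext fun p => BoundedContinuousFunction.ext fun y => ContinuousMultilinearMap.ext fun m => ?_
    have h := iteratedFDeriv_const_smul_apply (𝕜 := ℝ) (i := p.1.2) (x := y) (a := c)
      ((f.smooth p.1.2).contDiffAt)
    change ‖y‖ ^ p.1.1 • iteratedFDeriv ℝ p.1.2 (c • (f : F → ℂ)) y m = _
    rw [h]
    exact smul_comm _ _ _

theorem weightedJet_apply (s : Finset (ℕ × ℕ)) (g : 𝓢(F, ℂ)) (p : s) (y : F) (m : Fin p.1.2 → F) :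
    weightedJet s g p y m = ‖y‖ ^ p.1.1 • (∂^{m} g : 𝓢(F, ℂ)) y := by
  rw [iteratedLineDerivOp_eq_iteratedFDeriv]
  rfl

theorem norm_weightedJet_le (s : Finset (ℕ × ℕ)) (g : 𝓢(F, ℂ)) :
    ‖weightedJet s g‖ ≤ s.sup (schwartzSeminormFamily ℝ F ℂ) g := by
  refine (JetSpace.norm_le_iff (apply_nonneg _ _) _).2 fun p => ?_
  refine (BoundedContinuousFunction.norm_le (apply_nonneg _ _)).2 fun y => ?_
  change ‖‖y‖ ^ p.1.1 • iteratedFDeriv ℝ p.1.2 g y‖ ≤ _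
  rw [norm_smul, norm_pow, norm_norm]
  exact (SchwartzMap.le_seminorm ℝ _ _ g y).trans
    (Seminorm.le_def.1 (Finset.le_sup (f := schwartzSeminormFamily ℝ F ℂ) p.2) g)

/-- This inequality makes a continuous functional on the Schwartz space bounded for the jet norm. -/
theorem sup_seminorm_le_norm_weightedJet (s : Finset (ℕ × ℕ)) (g : 𝓢(F, ℂ)) :
    s.sup (schwartzSeminormFamily ℂ F ℂ) g ≤ ‖weightedJet s g‖ := by
  refine Seminorm.finset_sup_apply_le (norm_nonneg _) fun p hp => ?_
  refine SchwartzMap.seminorm_le_bound ℂ p.1 p.2 g (norm_nonneg _) fun y => ?_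
  have h : ‖weightedJet s g ⟨p, hp⟩ y‖ = ‖y‖ ^ p.1 * ‖iteratedFDeriv ℝ p.2 g y‖ := by
    change ‖‖y‖ ^ p.1 • iteratedFDeriv ℝ p.2 g y‖ = _
    rw [norm_smul, norm_pow, norm_norm]
  rw [← h]
  exact (BoundedContinuousFunction.norm_coe_le_norm _ y).trans
    ((JetSpace.norm_le_iff (norm_nonneg _) _).1 le_rfl _)

/-- Every tempered distribution factors through a Banach space of weighted jets. -/
theorem exists_jet_extension (T : 𝓢'(F, ℂ)) :
    ∃ (s : Finset (ℕ × ℕ)) (Λ : JetSpace F s →L[ℂ] ℂ), ∀ g, T g = Λ (weightedJet s g) := by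
  have hq : Continuous ((normSeminorm ℂ ℂ).comp (T : 𝓢(F, ℂ) →L[ℂ] ℂ).toLinearMap) :=
    continuous_norm.comp (T : 𝓢(F, ℂ) →L[ℂ] ℂ).continuous
  obtain ⟨s, C, -, h⟩ := Seminorm.bound_of_continuous (schwartz_withSeminorms ℂ F ℂ) _ hq
  have hT : ∀ g, ‖T g‖ ≤ C * ‖weightedJet s g‖ := fun g =>
    (h g).trans (mul_le_mul_of_nonneg_left (sup_seminorm_le_norm_weightedJet s g) C.2)
  -- The bound `hT` also shows that `T` depends only on the weighted jet, so it descends to the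
  -- range, where Hahn-Banach applies.
  have hker : LinearMap.ker (weightedJet (F := F) s) ≤
      LinearMap.ker (T : 𝓢(F, ℂ) →L[ℂ] ℂ).toLinearMap := fun g hg => by
    have := hT g
    rw [LinearMap.mem_ker.1 hg, norm_zero, mul_zero] at this
    exact norm_le_zero_iff.1 this
  let φ : LinearMap.range (weightedJet (F := F) s) →ₗ[ℂ] ℂ :=
    (Submodule.liftQ _ (T : 𝓢(F, ℂ) →L[ℂ] ℂ).toLinearMap hker) ∘ₗ
      (weightedJet (F := F) s).quotKerEquivRange.symm.toLinearMap
  have hφ : ∀ g, φ ⟨weightedJet s g, g, rfl⟩ = T g := fun g => by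
    have : (weightedJet (F := F) s).quotKerEquivRange.symm ⟨weightedJet s g, g, rfl⟩ =
        Submodule.Quotient.mk g := by
      rw [LinearEquiv.symm_apply_eq]
      rfl
    change Submodule.liftQ _ _ hker ((weightedJet (F := F) s).quotKerEquivRange.symm _) = _
    rw [this]
    rfl
  obtain ⟨Λ, hΛ, -⟩ := exists_extension_norm_eq (𝕜 := ℂ) _ (φ.mkContinuous C (by
    rintro ⟨_, g, rfl⟩
    rw [hφ]
    exact hT g))
  refine ⟨s, Λ, fun g => ?_⟩
  rw [← hφ]
  exact (hΛ ⟨weightedJet s g, g, rfl⟩).symm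

variable [FiniteDimensional ℝ E]

/-- The increment is the Taylor remainder, quadratic in `h` by `schwartz_taylor`, plus a derivative
that is linear in `h` through finitely many coordinates. -/
theorem tendsto_sup_seminorm_translate (s : Finset (ℕ × ℕ)) (K : 𝓢(E × F, ℂ)) :
    Filter.Tendsto (fun h : E => s.sup (schwartzSeminormFamily ℝ (E × F) ℂ)
      (K.compSubConstCLM ℝ (-((h, 0) : E × F)) - K)) (nhds 0) (nhds 0) := by
  choose C hC hT using fun p : ℕ × ℕ => schwartz_taylor p.1 p.2 K
  let q := s.sup (schwartzSeminormFamily ℝ (E × F) ℂ)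
  have hb : ∀ h : E, ‖h‖ ≤ 1 → q (K.compSubConstCLM ℝ (-((h, 0) : E × F)) - K) ≤
      (∑ p ∈ s, C p) * ‖h‖ ^ 2 + ∑ i, |(Module.finBasis ℝ E).coord i h| *
        q (∂_{((Module.finBasis ℝ E i, 0) : E × F)} K) := by
    intro h hh
    have hn : ‖((h, 0) : E × F)‖ = ‖h‖ := by simp [Prod.norm_def]
    have e : K.compSubConstCLM ℝ (-((h, 0) : E × F)) - K =
        (K.compSubConstCLM ℝ (-((h, 0) : E × F)) - K - ∂_{((h, 0) : E × F)} K) +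
          ∂_{((h, 0) : E × F)} K := by abel
    rw [e]
    refine (map_add_le_add q _ _).trans (add_le_add ?_ ?_)
    · refine Seminorm.finset_sup_apply_le
        (mul_nonneg (Finset.sum_nonneg fun p _ => hC p) (sq_nonneg _)) fun p hp => ?_
      calc _ ≤ C p * ‖h‖ ^ 2 := by
            refine SchwartzMap.seminorm_le_bound ℝ p.1 p.2 _ (by have := hC p; positivity)
              fun z => ?_
            have := hT p (h, 0) (by rw [hn]; exact hh) z
            rwa [hn] at this
        _ ≤ _ := by
            gcongr
            exact Finset.single_le_sum (fun p _ => hC p) hp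
    · rw [lineDeriv_fst_eq_sum]
      refine (Finset.le_sum_of_subadditive q (map_zero q).le (map_add_le_add q) _ _).trans (Finset.sum_le_sum fun i _ => ?_)
      rw [map_smul_eq_mul, Real.norm_eq_abs]
  have hlim : Filter.Tendsto (fun h : E => (∑ p ∈ s, C p) * ‖h‖ ^ 2 +
      ∑ i, |(Module.finBasis ℝ E).coord i h| *
        q (∂_{((Module.finBasis ℝ E i, 0) : E × F)} K)) (nhds 0) (nhds 0) := by
    have hc : Continuous fun h : E => (∑ p ∈ s, C p) * ‖h‖ ^ 2 +
      ∑ i, |(Module.finBasis ℝ E).coord i h| *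
        q (∂_{((Module.finBasis ℝ E i, 0) : E × F)} K) := by
      have : ∀ i, Continuous ((Module.finBasis ℝ E).coord i) := fun i =>
        ((Module.finBasis ℝ E).coord i).continuous_of_finiteDimensional
      fun_prop
    have := hc.tendsto 0
    simpa using this
  refine tendsto_of_tendsto_of_tendsto_of_le_of_le' tendsto_const_nhds hlim
    (.of_forall fun h => apply_nonneg _ _) ?_
  filter_upwards [Metric.closedBall_mem_nhds (0 : E) one_pos] with h hh
  exact hb h (mem_closedBall_zero_iff.1 hh)

/-- Moving the base point of a slice is a translation of `K` in the first variable. Continuity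
supplies the measurability needed for the Bochner integral. -/
theorem continuous_weightedJet_slice (s : Finset (ℕ × ℕ)) (K : 𝓢(E × F, ℂ)) :
    Continuous fun x : E => weightedJet s (sliceCLM x K) := by
  rw [continuous_iff_continuousAt]
  intro x
  rw [ContinuousAt, tendsto_iff_norm_sub_tendsto_zero]
  have h1 := (tendsto_sup_seminorm_translate s K).comp
    (tendsto_sub_nhds_zero_iff.2 (Filter.tendsto_id (x := nhds x)))
  refine squeeze_zero (fun _ => norm_nonneg _) (fun x' => ?_) h1
  rw [← map_sub]
  refine (norm_weightedJet_le s _).trans ?_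
  have e : sliceCLM x' K - sliceCLM x K =
      sliceCLM x (K.compSubConstCLM ℝ (-((x' - x, 0) : E × F)) - K) := by
    ext y
    simp
  rw [e]
  have := pow_mul_sup_seminorm_slice_le 0 s
    (K.compSubConstCLM ℝ (-((x' - x, 0) : E × F)) - K) x
  simpa using this

omit [FiniteDimensional ℝ E] in
theorem norm_weightedJet_slice_le (s : Finset (ℕ × ℕ)) (K : 𝓢(E × F, ℂ)) (x : E) :
    ‖weightedJet s (sliceCLM x K)‖ ≤ s.sup (schwartzSeminormFamily ℝ (E × F) ℂ) K := by
  refine (norm_weightedJet_le s _).trans ?_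
  have := pow_mul_sup_seminorm_slice_le 0 s K x
  simpa using this

end Jets

/-! ### Exchange of a distribution with an integral. -/

section Fubini

variable {E F : Type} [NormedAddCommGroup E] [InnerProductSpace ℝ E] [FiniteDimensional ℝ E]
  [MeasurableSpace E] [BorelSpace E] [NormedAddCommGroup F] [NormedSpace ℝ F]

omit [FiniteDimensional ℝ E] [MeasurableSpace E] [BorelSpace E] in
theorem iteratedLineDeriv_slice (x : E) {j : ℕ} (m : Fin j → F) (K : 𝓢(E × F, ℂ)) :
    (∂^{m} (sliceCLM x K) : 𝓢(F, ℂ)) = sliceCLM x (∂^{fun i => ((0, m i) : E × F)} K) := by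
  induction j with
  | zero => simp
  | succ j ih =>
    rw [iteratedLineDerivOp_succ_left, iteratedLineDerivOp_succ_left, ih, lineDeriv_slice]
    rfl

theorem iteratedLineDeriv_sndPair {E F : Type} [NormedAddCommGroup E] [NormedSpace ℝ E]
    [FiniteDimensional ℝ E] [NormedAddCommGroup F] [NormedSpace ℝ F]
    (T : 𝓢'(F, ℂ)) {j : ℕ} (m : Fin j → E) (K : 𝓢(E × F, ℂ)) :
    (∂^{m} (sndPair T K) : 𝓢(E, ℂ)) = sndPair T (∂^{fun i => ((m i, 0) : E × F)} K) := by
  induction j with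
  | zero => simp
  | succ j ih =>
    rw [iteratedLineDerivOp_succ_left, iteratedLineDerivOp_succ_left, ih, lineDeriv_sndPair]
    rfl

theorem iteratedLineDeriv_swap {E F : Type} [NormedAddCommGroup E] [NormedSpace ℝ E]
    [NormedAddCommGroup F] [NormedSpace ℝ F] {j : ℕ} (m : Fin j → F) (K : 𝓢(E × F, ℂ)) :
    (∂^{fun i => ((m i, 0) : F × E)} (swapCLM K) : 𝓢(F × E, ℂ)) =
      swapCLM (∂^{fun i => ((0, m i) : E × F)} K) := by
  induction j with
  | zero => simp
  | succ j ih =>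
    rw [iteratedLineDerivOp_succ_left, iteratedLineDerivOp_succ_left]
    have := ih (Fin.tail m)
    change ∂_{_} (∂^{fun i => ((Fin.tail m i, 0) : F × E)} (swapCLM K)) = _
    rw [this, swapCLM, lineDerivOp_compCLMOfContinuousLinearEquiv]
    rfl

variable [FiniteDimensional ℝ F]

/-- A tempered distribution in `y` commutes with the integration in `x` against a Schwartz
function. -/
theorem coe_schwartz_sndPair (σ : 𝓢(E, ℂ)) (T : 𝓢'(F, ℂ)) (K : 𝓢(E × F, ℂ)) :
    (σ : 𝓢'(E, ℂ)) (sndPair T K) = T (sndPair (σ : 𝓢'(E, ℂ)) (swapCLM K)) := by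
  obtain ⟨s, Λ, hΛ⟩ := exists_jet_extension T
  -- The Schwartz space is not normed, so the Bochner integral is formed in `JetSpace`: the jets are
  -- bounded in `x` and `σ` is integrable.
  have hint : Integrable fun x : E => σ x • weightedJet s (sliceCLM x K) := by
    refine Integrable.mono' (σ.integrable.norm.mul_const
      (s.sup (schwartzSeminormFamily ℝ (E × F) ℂ) K))
      (σ.continuous.smul (continuous_weightedJet_slice s K)).aestronglyMeasurable
      (.of_forall fun x => ?_)
    rw [norm_smul]
    gcongr
    exact norm_weightedJet_slice_le s K x
  have hI : ∫ x : E, σ x • weightedJet s (sliceCLM x K) =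
      weightedJet s (sndPair (σ : 𝓢'(E, ℂ)) (swapCLM K)) := by
    -- Point evaluations separate jets and commute with the integral, so the claim reduces to
    -- derivatives in `y` passing through both operations.
    refine funext fun p => BoundedContinuousFunction.ext fun y =>
      ContinuousMultilinearMap.ext fun m => ?_
    change JetSpace.eval p y m _ = _
    rw [← ContinuousLinearMap.integral_comp_comm _ hint, weightedJet_apply,
      iteratedLineDeriv_sndPair, iteratedLineDeriv_swap, sndPair_apply, coe_schwartz_apply,
      ← integral_smul]
    refine integral_congr_ae (.of_forall fun x => ?_)
    have : JetSpace.eval p y m (σ x • weightedJet s (sliceCLM x K)) =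
        σ x * weightedJet s (sliceCLM x K) p y m := rfl
    beta_reduce
    rw [this, weightedJet_apply, iteratedLineDeriv_slice]
    simp only [sliceCLM_apply, swapCLM_apply, Complex.real_smul]
    ring
  rw [hΛ, ← hI, ← ContinuousLinearMap.integral_comp_comm _ hint, coe_schwartz_apply]
  refine integral_congr_ae (.of_forall fun x => ?_)
  simp only [sndPair_apply, map_smul, hΛ, smul_eq_mul]
  ring

end Fubini

/-! ### Slowly varying cutoffs converge to the identity. -/

section Cutoff

variable {E V : Type} [NormedAddCommGroup E] [NormedSpace ℝ E]
  [NormedAddCommGroup V] [NormedSpace ℝ V]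

theorem hasTemperateGrowth_dilate (g : 𝓢(E, ℂ)) (π : V →L[ℝ] E) (t : ℝ) :
    (fun z : V => g (t • π z)).HasTemperateGrowth :=
  g.hasTemperateGrowth.comp (t • π).hasTemperateGrowth

/-- For `i = 0` this is the mean value inequality from `g 0 = 1`; for `i > 0` the chain rule yields
`tⁱ ≤ t`. The loss of `1 + ‖z‖` is harmless against a Schwartz function. -/
theorem norm_iteratedFDeriv_dilate_sub_le (g : 𝓢(E, ℂ)) (hg : g 0 = 1) (π : V →L[ℝ] E) (i : ℕ) :
    ∃ C : ℝ, 0 ≤ C ∧ ∀ t : ℝ, 0 < t → t ≤ 1 → ∀ z : V,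
      ‖iteratedFDeriv ℝ i (fun z : V => g (t • π z) - 1) z‖ ≤ C * t * (1 + ‖z‖) := by
  rcases Nat.eq_zero_or_pos i with rfl | hi
  · refine ⟨SchwartzMap.seminorm ℝ 0 1 g * ‖π‖, by positivity, fun t ht _ z => ?_⟩
    rw [norm_iteratedFDeriv_zero, ← hg]
    have h := convex_univ.norm_image_sub_le_of_norm_fderiv_le (f := g) (𝕜 := ℝ)
      (C := SchwartzMap.seminorm ℝ 0 1 g) (x := 0) (y := t • π z)
      (fun x _ => g.differentiableAt) (fun x _ => by
        rw [← norm_iteratedFDeriv_one]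
        exact norm_iteratedFDeriv_le_seminorm ℝ g 1 x) (Set.mem_univ _) (Set.mem_univ _)
    refine h.trans ?_
    rw [sub_zero, norm_smul, Real.norm_of_nonneg ht.le]
    calc _ ≤ SchwartzMap.seminorm ℝ 0 1 g * (t * (‖π‖ * ‖z‖)) := by
          gcongr
          exact π.le_opNorm z
      _ = SchwartzMap.seminorm ℝ 0 1 g * ‖π‖ * t * ‖z‖ := by ring
      _ ≤ _ := by gcongr; linarith
  · refine ⟨SchwartzMap.seminorm ℝ 0 i g * ‖π‖ ^ i, by positivity, fun t ht ht1 z => ?_⟩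
    have h0 : iteratedFDeriv ℝ i (fun z : V => g (t • π z) - 1) z =
        iteratedFDeriv ℝ i (g ∘ (t • π)) z := by
      have e : (fun z : V => g (t • π z) - 1) = (g ∘ (t • π)) - fun _ => (1 : ℂ) := rfl
      rw [e, iteratedFDeriv_sub_apply
        (((g.smooth i).comp (t • π).contDiff).contDiffAt) contDiff_const.contDiffAt,
        iteratedFDeriv_const_of_ne hi.ne', Pi.zero_apply, sub_zero]
    rw [h0, ContinuousLinearMap.iteratedFDeriv_comp_right _ (g.smooth i) _ le_rfl]
    refine (ContinuousMultilinearMap.norm_compContinuousLinearMap_le _ _).trans ?_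
    rw [Finset.prod_const, Finset.card_univ, Fintype.card_fin, norm_smul,
      Real.norm_of_nonneg ht.le, mul_pow]
    have ht' : t ^ i ≤ t := pow_le_of_le_one ht.le ht1 hi.ne'
    calc _ ≤ SchwartzMap.seminorm ℝ 0 i g * (t * ‖π‖ ^ i) := by
          gcongr
          exact norm_iteratedFDeriv_le_seminorm ℝ g i _
      _ = SchwartzMap.seminorm ℝ 0 i g * ‖π‖ ^ i * t * 1 := by ring
      _ ≤ _ := by gcongr; linarith [norm_nonneg z]

/-- Cutting off with `g(t·)`, where `g(0) = 1`, converges to the identity as `t → 0`. -/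
theorem tendsto_smulLeft_dilate (g : 𝓢(E, ℂ)) (hg : g 0 = 1) (π : V →L[ℝ] E) (K : 𝓢(V, ℂ)) :
    Filter.Tendsto (fun t : ℝ => smulLeftCLM ℂ (fun z : V => g (t • π z)) K)
      (nhdsWithin 0 (Set.Ioi 0)) (nhds K) := by
  rw [(schwartz_withSeminorms ℝ V ℂ).tendsto_nhds]
  rintro ⟨k, n⟩ ε hε
  choose C hC h using norm_iteratedFDeriv_dilate_sub_le g hg π
  set A := ∑ i ∈ Finset.range (n + 1), (n.choose i : ℝ) * (C i *
    (SchwartzMap.seminorm ℝ k (n - i) K + SchwartzMap.seminorm ℝ (k + 1) (n - i) K)) with hA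
  have hA0 : 0 ≤ A := Finset.sum_nonneg fun i _ => by have := hC i; positivity
  have key : ∀ t : ℝ, 0 < t → t ≤ 1 →
      SchwartzMap.seminorm ℝ k n (smulLeftCLM ℂ (fun z : V => g (t • π z)) K - K) ≤ A * t := by
    intro t ht ht1
    refine SchwartzMap.seminorm_le_bound ℝ k n _ (by positivity) fun z => ?_
    have e : (⇑(smulLeftCLM ℂ (fun z : V => g (t • π z)) K - K) : V → ℂ) =
        fun z => (g (t • π z) - 1) * K z := by
      ext z
      rw [sub_apply, smulLeftCLM_apply_apply (hasTemperateGrowth_dilate g π t), smul_eq_mul]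
      ring
    rw [e]
    have hsm : ContDiff ℝ n fun z : V => g (t • π z) - 1 :=
      ((g.smooth n).comp (t • π).contDiff).sub contDiff_const
    have hb := norm_iteratedFDeriv_mul_le hsm (K.smooth n) z (n := n) le_rfl
    calc _ ≤ ‖z‖ ^ k * ∑ i ∈ Finset.range (n + 1), (n.choose i : ℝ) *
          ‖iteratedFDeriv ℝ i (fun z : V => g (t • π z) - 1) z‖ *
            ‖iteratedFDeriv ℝ (n - i) K z‖ := by gcongr
      _ = ∑ i ∈ Finset.range (n + 1), ‖z‖ ^ k * ((n.choose i : ℝ) *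
          ‖iteratedFDeriv ℝ i (fun z : V => g (t • π z) - 1) z‖ *
            ‖iteratedFDeriv ℝ (n - i) K z‖) := Finset.mul_sum _ _ _
      _ ≤ ∑ i ∈ Finset.range (n + 1), (n.choose i : ℝ) * (C i *
          (SchwartzMap.seminorm ℝ k (n - i) K + SchwartzMap.seminorm ℝ (k + 1) (n - i) K)) * t := by
          refine Finset.sum_le_sum fun i _ => ?_
          calc _ ≤ ‖z‖ ^ k * ((n.choose i : ℝ) * (C i * t * (1 + ‖z‖)) *
                ‖iteratedFDeriv ℝ (n - i) K z‖) := by gcongr; exact h i t ht ht1 z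
            _ = (n.choose i : ℝ) * (C i * (‖z‖ ^ k * ‖iteratedFDeriv ℝ (n - i) K z‖ +
                ‖z‖ ^ (k + 1) * ‖iteratedFDeriv ℝ (n - i) K z‖)) * t := by ring
            _ ≤ _ := by
              have := hC i
              gcongr
              · exact SchwartzMap.le_seminorm ℝ _ _ K z
              · exact SchwartzMap.le_seminorm ℝ _ _ K z
      _ = A * t := by rw [hA, Finset.sum_mul]
  have hlim : Filter.Tendsto (fun t : ℝ => A * t) (nhdsWithin 0 (Set.Ioi 0)) (nhds 0) := by
    have : Filter.Tendsto (fun t : ℝ => A * t) (nhds 0) (nhds (A * 0)) :=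
      (continuous_const.mul continuous_id).tendsto 0
    rw [mul_zero] at this
    exact this.mono_left nhdsWithin_le_nhds
  filter_upwards [hlim.eventually_lt_const hε, self_mem_nhdsWithin,
    mem_nhdsWithin_of_mem_nhds (Iic_mem_nhds one_pos)] with t h1 h2 h3
  exact (key t h2 h3).trans_lt h1

end Cutoff

/-! ### Gaussians as Schwartz functions. -/

section Gaussian

variable {E : Type} [NormedAddCommGroup E] [InnerProductSpace ℝ E]

theorem iteratedDeriv_cexp_neg_mul (b : ℝ) (k : ℕ) :
    iteratedDeriv k (fun t : ℝ => Complex.exp (-b * t)) =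
      fun t : ℝ => (-b : ℂ) ^ k * Complex.exp (-b * t) := by
  induction k with
  | zero => simp
  | succ k ih =>
    rw [iteratedDeriv_succ, ih]
    ext t
    have h1 : HasDerivAt (fun t : ℝ => -(b : ℂ) * (t : ℂ)) (-b : ℂ) t := by
      simpa using (Complex.ofRealCLM.hasDerivAt (x := t)).const_mul (-(b : ℂ))
    rw [((h1.cexp).const_mul ((-b : ℂ) ^ k)).deriv, pow_succ]
    ring

/-- Bound the power by an exponential through `s ^ N / N! ≤ exp s` at `s = 2b(1 + r)`; the quadratic
exponent absorbs the linear one. -/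
theorem one_add_pow_mul_exp_neg_sq_le {b : ℝ} (hb : 0 < b) (N : ℕ) {r : ℝ} (hr : 0 ≤ r) :
    (1 + r) ^ N * Real.exp (-b * r ^ 2) ≤ Real.exp (3 * b) * (N.factorial / (2 * b) ^ N) := by
  have h1 : (2 * b * (1 + r)) ^ N / N.factorial ≤ Real.exp (2 * b * (1 + r)) :=
    Real.pow_div_factorial_le_exp _ (by positivity) N
  have h2 : (1 + r) ^ N ≤ N.factorial / (2 * b) ^ N * Real.exp (2 * b * (1 + r)) := by
    rw [div_le_iff₀ (by positivity), mul_pow] at h1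
    rw [div_mul_eq_mul_div, le_div_iff₀ (by positivity)]
    linarith
  calc _ ≤ N.factorial / (2 * b) ^ N * Real.exp (2 * b * (1 + r)) * Real.exp (-b * r ^ 2) := by
        gcongr
    _ = N.factorial / (2 * b) ^ N * Real.exp (2 * b * (1 + r) + -b * r ^ 2) := by
        rw [Real.exp_add]; ring
    _ ≤ N.factorial / (2 * b) ^ N * Real.exp (3 * b) := by
        gcongr
        -- Here `2b(1 + r) - br² = 3b - b(r - 1)²`.
        nlinarith [mul_nonneg hb.le (sq_nonneg (r - 1))]
    _ = _ := by ring

/-- The Gaussian `x ↦ exp(-b‖x‖²)` as a Schwartz function. -/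
noncomputable def gaussianSchwartz (E : Type) [NormedAddCommGroup E] [InnerProductSpace ℝ E]
    {b : ℝ} (hb : 0 < b) : 𝓢(E, ℂ) where
  toFun x := Complex.exp (-b * ((‖x‖ ^ 2 : ℝ) : ℂ))
  smooth' := by
    have : ContDiff ℝ ∞ fun x : E => ((‖x‖ ^ 2 : ℝ) : ℂ) :=
      Complex.ofRealCLM.contDiff.comp (contDiff_norm_sq ℝ)
    exact Complex.contDiff_exp.comp (contDiff_const.mul this)
  decay' k n := by
    obtain ⟨N, C, hC, h⟩ := Function.HasTemperateGrowth.norm_iteratedFDeriv_le_uniform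
      (Function.hasTemperateGrowth_norm_sq (H := E)) n
    have hg : ContDiff ℝ n fun t : ℝ => Complex.exp (-b * t) :=
      Complex.contDiff_exp.comp (contDiff_const.mul Complex.ofRealCLM.contDiff)
    refine ⟨n.factorial * (1 + b) ^ n * (1 + C) ^ n *
      (Real.exp (3 * b) * ((N * n + k).factorial / (2 * b) ^ (N * n + k))), fun x => ?_⟩
    have h1 : (1 : ℝ) ≤ (1 + ‖x‖) ^ N := one_le_pow₀ (by linarith [norm_nonneg x])
    have hcomp := norm_iteratedFDeriv_comp_le (n := n) (N := n) hg
      ((contDiff_norm_sq ℝ).of_le le_top : ContDiff ℝ n fun x : E => ‖x‖ ^ 2) le_rfl x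
      (C := (1 + b) ^ n * Real.exp (-b * ‖x‖ ^ 2)) (D := (1 + C) * (1 + ‖x‖) ^ N)
      (fun i hi => by
        rw [norm_iteratedFDeriv_eq_norm_iteratedDeriv, iteratedDeriv_cexp_neg_mul, norm_mul,
          norm_pow, norm_neg, Complex.norm_real, Real.norm_of_nonneg hb.le, Complex.norm_exp]
        have : b ^ i ≤ (1 + b) ^ n := calc
          b ^ i ≤ (1 + b) ^ i := by gcongr; linarith
          _ ≤ (1 + b) ^ n := pow_le_pow_right₀ (by linarith) hi
        have e : (-(b : ℂ) * ((‖x‖ ^ 2 : ℝ) : ℂ)).re = -b * ‖x‖ ^ 2 := by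
          rw [← Complex.ofReal_neg, ← Complex.ofReal_mul, Complex.ofReal_re]
        rw [e]
        gcongr)
      (fun i hi hin => by
        refine (h i hin x).trans ?_
        -- The chain rule bound wants the `i`-th derivative below `D ^ i`; a `D ≥ 1` that dominates
        -- every derivative suffices, since `i ≥ 1`.
        have h2 : (1 : ℝ) ≤ (1 + C) * (1 + ‖x‖) ^ N := one_le_mul_of_one_le_of_one_le (by linarith) h1
        refine le_trans ?_ (le_self_pow₀ h2 (by omega))
        gcongr
        linarith)
    have hb' := one_add_pow_mul_exp_neg_sq_le hb (N * n + k) (norm_nonneg x)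
    have hx : ‖x‖ ^ k ≤ (1 + ‖x‖) ^ k := by gcongr; linarith
    calc _ ≤ (1 + ‖x‖) ^ k * (n.factorial * ((1 + b) ^ n * Real.exp (-b * ‖x‖ ^ 2)) *
          ((1 + C) * (1 + ‖x‖) ^ N) ^ n) := mul_le_mul hx hcomp (norm_nonneg _) (by positivity)
      _ = n.factorial * (1 + b) ^ n * (1 + C) ^ n *
          ((1 + ‖x‖) ^ (N * n + k) * Real.exp (-b * ‖x‖ ^ 2)) := by
          rw [mul_pow, ← pow_mul, pow_add]; ring
      _ ≤ _ := by gcongr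

@[simp] theorem gaussianSchwartz_apply {b : ℝ} (hb : 0 < b) (x : E) :
    gaussianSchwartz E hb x = Complex.exp (-b * ((‖x‖ ^ 2 : ℝ) : ℂ)) := rfl

end Gaussian

/-! ### Tensor products of Schwartz functions. -/

section Tensor

variable {E F G : Type} [NormedAddCommGroup E] [NormedSpace ℝ E] [FiniteDimensional ℝ E]
  [NormedAddCommGroup F] [NormedSpace ℝ F] [FiniteDimensional ℝ F]
  [NormedAddCommGroup G] [NormedSpace ℝ G] [FiniteDimensional ℝ G]

/-- The tensor product `(x, y) ↦ f(x) g(y)` of two Schwartz functions. -/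
noncomputable def tensorSchwartz (f : 𝓢(E, ℂ)) (g : 𝓢(F, ℂ)) : 𝓢(E × F, ℂ) :=
  sndOp ((TemperedDistribution.delta (0 : Fin 0 → ℝ) : 𝓢(Fin 0 → ℝ, ℂ) →L[ℂ] ℂ).smulRight g)
    (compCLMOfContinuousLinearEquiv ℂ (ContinuousLinearEquiv.prodUnique ℝ E (Fin 0 → ℝ)) f)

@[simp] theorem tensorSchwartz_apply (f : 𝓢(E, ℂ)) (g : 𝓢(F, ℂ)) (x : E) (y : F) :
    tensorSchwartz f g (x, y) = f x * g y := rfl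

theorem sndPair_tensorSchwartz (T : 𝓢'(F, ℂ)) (f : 𝓢(E, ℂ)) (g : 𝓢(F, ℂ)) :
    sndPair T (tensorSchwartz f g) = T g • f := by
  ext x
  have : sliceCLM x (tensorSchwartz f g) = f x • g := by ext y; rfl
  rw [sndPair_apply, this, map_smul, smul_apply, smul_eq_mul, smul_eq_mul, mul_comm]

end Tensor

/-! ### Distributions in different variables commute. -/

section Commutation

variable {E F : Type} [NormedAddCommGroup E] [InnerProductSpace ℝ E] [FiniteDimensional ℝ E]
  [MeasurableSpace E] [BorelSpace E]
  [NormedAddCommGroup F] [NormedSpace ℝ F] [FiniteDimensional ℝ F]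

/-- Multiplication by the Gaussian `exp(-‖tx‖²)`. -/
noncomputable def gaussianCutoff (E : Type) [NormedAddCommGroup E] [InnerProductSpace ℝ E] (t : ℝ) :
    𝓢(E, ℂ) →L[ℂ] 𝓢(E, ℂ) :=
  smulLeftCLM ℂ fun x : E => gaussianSchwartz E one_pos (t • x)

/-- Regularization of a Schwartz function: a cutoff in frequency, followed by one in space. -/
noncomputable def regularize (E : Type) [NormedAddCommGroup E] [InnerProductSpace ℝ E]
    [FiniteDimensional ℝ E] [MeasurableSpace E] [BorelSpace E] (t u : ℝ) :
    𝓢(E, ℂ) →L[ℂ] 𝓢(E, ℂ) :=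
  gaussianCutoff E t ∘L (FourierTransform.fourierCLE ℂ 𝓢(E, ℂ)).symm ∘L gaussianCutoff E u ∘L
    (FourierTransform.fourierCLE ℂ 𝓢(E, ℂ))

theorem gaussianCutoff_apply (t : ℝ) (f : 𝓢(E, ℂ)) (x : E) :
    gaussianCutoff E t f x = gaussianSchwartz E one_pos (t • x) * f x :=
  smulLeftCLM_apply_apply (hasTemperateGrowth_dilate _ (ContinuousLinearMap.id ℝ E) t) f x

/-- Both cutoffs together give the regularization a Schwartz kernel `k(ξ, x)` acting on the Fourier
transform of `f`. Hence `S` composed with it has density the Fourier transform of `ξ ↦ S(k(ξ, ·))`.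
-/
theorem exists_schwartz_density (S : 𝓢'(E, ℂ)) {t u : ℝ} (ht : t ≠ 0) (hu : u ≠ 0) :
    ∃ σ : 𝓢(E, ℂ), ∀ f, S (regularize E t u f) = (σ : 𝓢'(E, ℂ)) f := by
  have ht2 : 0 < t ^ 2 := by positivity
  have hu2 : 0 < u ^ 2 := by positivity
  have hexp : Function.HasTemperateGrowth fun z : E × E =>
      Complex.exp (Complex.I * ((2 * Real.pi * inner ℝ z.1 z.2 : ℝ) : ℂ)) :=
    hasTemperateGrowth_expI.comp ((Function.HasTemperateGrowth.const _).mul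
      ((innerSL ℝ).bilinear_hasTemperateGrowth (ContinuousLinearMap.fst ℝ E E).hasTemperateGrowth
        (ContinuousLinearMap.snd ℝ E E).hasTemperateGrowth))
  let k : 𝓢(E × E, ℂ) := smulLeftCLM ℂ
    (fun z : E × E => Complex.exp (Complex.I * ((2 * Real.pi * inner ℝ z.1 z.2 : ℝ) : ℂ)))
    (tensorSchwartz (gaussianSchwartz E hu2) (gaussianSchwartz E ht2))
  refine ⟨𝓕 (sndPair S k), fun f => ?_⟩
  have hR : regularize E t u f = sndPair ((𝓕 f : 𝓢(E, ℂ)) : 𝓢'(E, ℂ)) (swapCLM k) := by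
    ext x
    rw [sndPair_apply, coe_schwartz_apply]
    change gaussianCutoff E t (𝓕⁻ (gaussianCutoff E u (𝓕 f))) x = _
    rw [gaussianCutoff_apply, SchwartzMap.fourierInv_coe, Real.fourierInv_eq',
      ← integral_const_mul]
    refine integral_congr_ae (.of_forall fun ξ => ?_)
    simp only [sliceCLM_apply, swapCLM_apply, smul_eq_mul, k, gaussianCutoff_apply]
    rw [smulLeftCLM_apply_apply hexp, tensorSchwartz_apply]
    simp only [gaussianSchwartz_apply, norm_smul, mul_pow, Real.norm_eq_abs, sq_abs, smul_eq_mul]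
    push_cast
    ring_nf
  -- `S` passes under the integral in `ξ`; the next line moves the Fourier transform from `f` to the
  -- other factor.
  rw [hR, ← coe_schwartz_sndPair, coe_schwartz_apply, coe_schwartz_apply]
  rw [← integral_fourier_mul_eq]
  simp only [mul_comm]

theorem sndOp_gaussianCutoff (t : ℝ) (K : 𝓢(F × E, ℂ)) :
    sndOp (gaussianCutoff E t) K =
      smulLeftCLM ℂ (fun z : F × E => gaussianSchwartz E one_pos
        (t • ContinuousLinearMap.snd ℝ F E z)) K := by
  ext ⟨y, x⟩
  rw [smulLeftCLM_apply_apply (hasTemperateGrowth_dilate _ _ t), sndOp_apply, gaussianCutoff_apply]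
  rfl

theorem tendsto_gaussianCutoff (f : 𝓢(E, ℂ)) :
    Filter.Tendsto (fun t : ℝ => gaussianCutoff E t f) (nhdsWithin 0 (Set.Ioi 0)) (nhds f) :=
  tendsto_smulLeft_dilate _ (by simp) (ContinuousLinearMap.id ℝ E) f

theorem tendsto_sndOp_gaussianCutoff (K : 𝓢(F × E, ℂ)) :
    Filter.Tendsto (fun t : ℝ => sndOp (gaussianCutoff E t) K) (nhdsWithin 0 (Set.Ioi 0))
      (nhds K) := by
  simp only [sndOp_gaussianCutoff]
  exact tendsto_smulLeft_dilate _ (by simp) _ K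

/-- Two tempered distributions in different variables commute. -/
theorem apply_sndPair_comm (S : 𝓢'(E, ℂ)) (T : 𝓢'(F, ℂ)) (K : 𝓢(E × F, ℂ)) :
    S (sndPair T K) = T (sndPair S (swapCLM K)) := by
  let 𝓕₀ : 𝓢(E, ℂ) →L[ℂ] 𝓢(E, ℂ) := FourierTransform.fourierCLE ℂ 𝓢(E, ℂ)
  let 𝓕₁ : 𝓢(E, ℂ) →L[ℂ] 𝓢(E, ℂ) := (FourierTransform.fourierCLE ℂ 𝓢(E, ℂ)).symm
  have h10 : ∀ f, 𝓕₁ (𝓕₀ f) = f := fun f =>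
    (FourierTransform.fourierCLE ℂ 𝓢(E, ℂ)).symm_apply_apply f
  have hS : Continuous S := (S : 𝓢(E, ℂ) →L[ℂ] ℂ).continuous
  have hT : Continuous fun H : 𝓢(F × E, ℂ) => T (sndPair S H) :=
    (T : 𝓢(F, ℂ) →L[ℂ] ℂ).continuous.comp (sndPair S).continuous
  -- With both cutoffs present `S` is a Schwartz density, and `coe_schwartz_sndPair` applies.
  have h0 : ∀ t u : ℝ, 0 < t → 0 < u →
      S (regularize E t u (sndPair T K)) = T (sndPair S (sndOp (regularize E t u) (swapCLM K))) := by
    intro t u ht hu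
    obtain ⟨σ, hσ⟩ := exists_schwartz_density S ht.ne' hu.ne'
    rw [hσ, coe_schwartz_sndPair]
    congr 1
    ext y
    rw [sndPair_apply, ← hσ]
    rfl
  -- The frequency cutoff is removed first, `u → 0` with `t` fixed; both sides are continuous in the
  -- regularized function.
  have h1 : ∀ t : ℝ, 0 < t → S (gaussianCutoff E t (sndPair T K)) =
      T (sndPair S (sndOp (gaussianCutoff E t) (swapCLM K))) := by
    intro t ht
    have a : Filter.Tendsto (fun u => S (regularize E t u (sndPair T K)))
        (nhdsWithin 0 (Set.Ioi 0)) (nhds (S (gaussianCutoff E t (sndPair T K)))) := by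
      have := ((hS.comp (gaussianCutoff E t).continuous).comp 𝓕₁.continuous).tendsto
        (𝓕₀ (sndPair T K)) |>.comp (tendsto_gaussianCutoff (𝓕₀ (sndPair T K)))
      simp only [Function.comp_apply, h10] at this
      exact this
    have b : Filter.Tendsto (fun u => T (sndPair S (sndOp (regularize E t u) (swapCLM K))))
        (nhdsWithin 0 (Set.Ioi 0))
        (nhds (T (sndPair S (sndOp (gaussianCutoff E t) (swapCLM K))))) := by
      have e : sndOp 𝓕₁ (sndOp 𝓕₀ (swapCLM K)) = swapCLM K := by
        ext ⟨y, x⟩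
        exact congrArg (fun f : 𝓢(E, ℂ) => f x) (h10 (sliceCLM y (swapCLM K)))
      have := ((hT.comp (sndOp (E := F) (gaussianCutoff E t)).continuous).comp
        (sndOp (E := F) 𝓕₁).continuous).tendsto
        (sndOp 𝓕₀ (swapCLM K)) |>.comp (tendsto_sndOp_gaussianCutoff (sndOp 𝓕₀ (swapCLM K)))
      simp only [Function.comp_apply, e] at this
      exact this
    refine tendsto_nhds_unique (a.congr' ?_) b
    filter_upwards [self_mem_nhdsWithin] with u hu
    exact h0 t u ht hu
  -- Then the spatial cutoff is removed, `t → 0`.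
  refine tendsto_nhds_unique (((hS.tendsto _).comp (tendsto_gaussianCutoff _)).congr' ?_)
    ((hT.tendsto _).comp (tendsto_sndOp_gaussianCutoff _))
  filter_upwards [self_mem_nhdsWithin] with t ht
  exact h1 t ht

end Commutation

/-! ### Operators acting in the first variable. -/

section FirstVariable

variable {E F G : Type} [NormedAddCommGroup E] [InnerProductSpace ℝ E] [FiniteDimensional ℝ E]
  [MeasurableSpace E] [BorelSpace E] [NormedAddCommGroup F] [NormedSpace ℝ F]
  [FiniteDimensional ℝ F] [NormedAddCommGroup G] [NormedSpace ℝ G] [FiniteDimensional ℝ G]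

/-- The operator `B ⊗ 1`: it applies `B` to a Schwartz function `K(x, y)` in the variable `x`. -/
noncomputable def fstOp (B : 𝓢(E, ℂ) →L[ℂ] 𝓢(G, ℂ)) : 𝓢(E × F, ℂ) →L[ℂ] 𝓢(G × F, ℂ) :=
  swapCLM ∘L sndOp B ∘L swapCLM

omit [FiniteDimensional ℝ E] [MeasurableSpace E] [BorelSpace E] in
theorem fstOp_apply (B : 𝓢(E, ℂ) →L[ℂ] 𝓢(G, ℂ)) (K : 𝓢(E × F, ℂ)) (x : G) (y : F) :
    fstOp B K (x, y) = B (sliceCLM y (swapCLM K)) x := rfl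

/-- At each `x` this is the commutation of `T` with the distribution `f ↦ (B f)(x)`. -/
theorem apply_sndPair (B : 𝓢(E, ℂ) →L[ℂ] 𝓢(G, ℂ)) (T : 𝓢'(F, ℂ)) (K : 𝓢(E × F, ℂ)) :
    B (sndPair T K) = sndPair T (fstOp B K) := by
  ext x
  exact apply_sndPair_comm
    (PointwiseConvergenceCLM.precomp ℂ B (TemperedDistribution.delta x)) T K

end FirstVariable

/-! ### Covariance of the Wigner transform under chirps and dilations. -/

section Covariance

variable {n : ℕ} {ħ : ℝ}

/-- The operator `f ↦ conj (A (conj f))`. -/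
noncomputable def conjOp (A : 𝓢(Rn n, ℂ) →L[ℂ] 𝓢(Rn n, ℂ)) : 𝓢(Rn n, ℂ) →L[ℂ] 𝓢(Rn n, ℂ) :=
  conjSchwartz.comp (A.comp conjSchwartz)

theorem conjOp_apply (A : 𝓢(Rn n, ℂ) →L[ℂ] 𝓢(Rn n, ℂ)) (f : 𝓢(Rn n, ℂ)) :
    conjOp A f = conjSchwartz (A (conjSchwartz f)) := rfl

theorem conjSchwartz_conjSchwartz {E : Type} [NormedAddCommGroup E] [NormedSpace ℝ E]
    (f : 𝓢(E, ℂ)) : conjSchwartz (conjSchwartz f) = f := by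
  ext x
  simp

/-- The tempered distribution `φ ↦ ⟨ψ, conj (A (conj φ))⟩`. -/
noncomputable def transport (A : 𝓢(Rn n, ℂ) →L[ℂ] 𝓢(Rn n, ℂ)) (ψ : 𝓢'(Rn n, ℂ)) : 𝓢'(Rn n, ℂ) :=
  PointwiseConvergenceCLM.precomp ℂ (conjOp A) ψ

theorem transport_apply (A : 𝓢(Rn n, ℂ) →L[ℂ] 𝓢(Rn n, ℂ)) (ψ : 𝓢'(Rn n, ℂ)) (f : 𝓢(Rn n, ℂ)) :
    transport A ψ f = ψ (conjOp A f) := rfl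

/-- The order is reversed: for a unitary `A`, `transport A` extends `A⁻¹` to distributions. -/
theorem transport_transport (A B : 𝓢(Rn n, ℂ) →L[ℂ] 𝓢(Rn n, ℂ)) (ψ : 𝓢'(Rn n, ℂ)) :
    transport B (transport A ψ) = transport (A ∘L B) ψ := by
  ext f
  rw [transport_apply, transport_apply, transport_apply, conjOp_apply, conjOp_apply,
    conjSchwartz_conjSchwartz]
  rfl

theorem transport_id (ψ : 𝓢'(Rn n, ℂ)) : transport (ContinuousLinearMap.id ℂ _) ψ = ψ := by
  ext f
  rw [transport_apply, conjOp_apply]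
  simp only [ContinuousLinearMap.coe_id', id_eq, conjSchwartz_conjSchwartz]

/-- The two conjugations cancel, so on the conjugate distribution the plain transpose of `A` acts.
-/
theorem conjDistribution_transport (A : 𝓢(Rn n, ℂ) →L[ℂ] 𝓢(Rn n, ℂ)) (ψ : 𝓢'(Rn n, ℂ)) :
    conjDistribution (transport A ψ) = PointwiseConvergenceCLM.precomp ℂ A (conjDistribution ψ) := by
  ext f
  rw [conjDistribution_apply, transport_apply, conjOp_apply, conjSchwartz_conjSchwartz]
  rfl

theorem wigner_apply (hħ : 0 < ħ) (ψ : 𝓢'(Rn n, ℂ)) (Φ : 𝓢(Rn n × Rn n, ℂ)) :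
    wigner hħ ψ Φ = ψ (sndPair (conjDistribution ψ) (weylKernel hħ Φ)) := rfl

/-- The operator leaves the distributions and acts on the kernel: `A` in the second variable, its
conjugate in the first. `apply_sndPair` brings the latter inside the pairing with `ψ̄`. -/
theorem wigner_transport (hħ : 0 < ħ) (A : 𝓢(Rn n, ℂ) →L[ℂ] 𝓢(Rn n, ℂ)) (ψ : 𝓢'(Rn n, ℂ))
    (Φ : 𝓢(Rn n × Rn n, ℂ)) : wigner hħ (transport A ψ) Φ =
      ψ (sndPair (conjDistribution ψ) (fstOp (conjOp A) (sndOp A (weylKernel hħ Φ)))) := by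
  rw [wigner_apply, transport_apply, conjDistribution_transport, ← apply_sndPair]
  rfl

/-- The operator `A` implements the linear change of variables `s` on the Wigner transforms, up to
the factor `κ`. -/
def IsWignerCovariant (hħ : 0 < ħ) (κ : ℂ) (A : 𝓢(Rn n, ℂ) →L[ℂ] 𝓢(Rn n, ℂ))
    (s : (Rn n × Rn n) ≃L[ℝ] (Rn n × Rn n)) : Prop :=
  ∀ ψ Φ, wigner hħ (transport A ψ) (compCLMOfContinuousLinearEquiv ℂ s Φ) = κ * wigner hħ ψ Φ

namespace IsWignerCovariant

variable {hħ : 0 < ħ} {κ κ' : ℂ} {A A' : 𝓢(Rn n, ℂ) →L[ℂ] 𝓢(Rn n, ℂ)}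
  {s s' : (Rn n × Rn n) ≃L[ℝ] (Rn n × Rn n)}

/-- The distribution `ψ` drops out; only an identity between Schwartz functions remains. -/
theorem of_kernel (h : ∀ Φ u v, fstOp (conjOp A) (sndOp A (weylKernel hħ
    (compCLMOfContinuousLinearEquiv ℂ s Φ))) (u, v) = κ * weylKernel hħ Φ (u, v)) :
    IsWignerCovariant hħ κ A s := by
  intro ψ Φ
  have : fstOp (conjOp A) (sndOp A (weylKernel hħ (compCLMOfContinuousLinearEquiv ℂ s Φ))) =
      κ • weylKernel hħ Φ := by
    ext ⟨u, v⟩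
    rw [h, smul_apply, smul_eq_mul]
  rw [wigner_transport, this, map_smul, map_smul, smul_eq_mul, wigner_apply]

theorem comp (h : IsWignerCovariant hħ κ A s) (h' : IsWignerCovariant hħ κ' A' s') :
    IsWignerCovariant hħ (κ * κ') (A ∘L A') (s'.trans s) := by
  intro ψ Φ
  have e : compCLMOfContinuousLinearEquiv ℂ (s'.trans s) Φ =
      compCLMOfContinuousLinearEquiv ℂ s' (compCLMOfContinuousLinearEquiv ℂ s Φ) := rfl
  rw [← transport_transport, e, h', h]
  ring

theorem refl : IsWignerCovariant hħ 1 (ContinuousLinearMap.id ℂ 𝓢(Rn n, ℂ))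
    (ContinuousLinearEquiv.refl ℝ _) := by
  intro ψ Φ
  rw [transport_id, one_mul]
  rfl

/-- Apply covariance to `transport A.symm ψ` and to `Φ ∘ s⁻¹`. -/
theorem symm {A : 𝓢(Rn n, ℂ) ≃L[ℂ] 𝓢(Rn n, ℂ)} (h : IsWignerCovariant hħ 1 A s) :
    IsWignerCovariant hħ 1 A.symm s.symm := by
  intro ψ Φ
  have h1 := h (transport A.symm ψ) (compCLMOfContinuousLinearEquiv ℂ s.symm Φ)
  have e : compCLMOfContinuousLinearEquiv ℂ s (compCLMOfContinuousLinearEquiv ℂ s.symm Φ) = Φ := by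
    ext z
    simp
  have e' : (A.symm : 𝓢(Rn n, ℂ) →L[ℂ] 𝓢(Rn n, ℂ)) ∘L (A : 𝓢(Rn n, ℂ) →L[ℂ] 𝓢(Rn n, ℂ)) =
      ContinuousLinearMap.id ℂ _ := by
    ext1 f
    simp
  rw [transport_transport, e, e', transport_id, one_mul] at h1
  rw [h1, one_mul]

/-- Constants are not required to be unimodular. The factor `|c|²` will cancel the Jacobian of the
dilation. -/
theorem const (c : ℂ) : IsWignerCovariant hħ (conj c * c)
    (c • ContinuousLinearMap.id ℂ 𝓢(Rn n, ℂ)) (ContinuousLinearEquiv.refl ℝ _) := by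
  refine of_kernel fun Φ u v => ?_
  simp only [fstOp_apply, conjOp_apply, conjSchwartz_apply, swapCLM_apply, sliceCLM_apply,
    sndOp_apply, smul_apply, ContinuousLinearMap.coe_id', id_eq, smul_eq_mul, map_mul,
    Complex.conj_conj, mul_assoc]
  rfl

end IsWignerCovariant

theorem inner_toEuclideanCLM_transpose (P : Matrix (Fin n) (Fin n) ℝ) (x y : Rn n) :
    inner ℝ (Matrix.toEuclideanCLM (𝕜 := ℝ) P.transpose x) y =
      inner ℝ x (Matrix.toEuclideanCLM (𝕜 := ℝ) P y) := by
  rw [real_inner_comm, Matrix.inner_toEuclideanCLM, Matrix.inner_toEuclideanCLM,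
    Matrix.dotProduct_mulVec, Matrix.vecMul_transpose, dotProduct_comm]

theorem inner_toEuclideanCLM_symm {P : Matrix (Fin n) (Fin n) ℝ} (hP : P.IsSymm) (x y : Rn n) :
    inner ℝ (Matrix.toEuclideanCLM (𝕜 := ℝ) P x) y =
      inner ℝ x (Matrix.toEuclideanCLM (𝕜 := ℝ) P y) := by
  rw [← inner_toEuclideanCLM_transpose, hP]

theorem conj_chirp (P : Matrix (Fin n) (Fin n) ℝ) (x : Rn n) :
    conj (chirp ħ P x) = chirp ħ (-P) x := by
  rw [chirp, chirp, ← Complex.exp_conj, map_mul, Complex.conj_I, Complex.conj_ofReal, map_neg,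
    neg_apply, inner_neg_left, mul_neg, Complex.ofReal_neg, neg_mul, mul_neg]

/-- The shear `(x, p) ↦ (x, p + Px)` of phase space. -/
noncomputable def shearEquiv (P : Matrix (Fin n) (Fin n) ℝ) : (Rn n × Rn n) ≃L[ℝ] (Rn n × Rn n) :=
  ContinuousLinearEquiv.skewProd (.refl ℝ _) (.refl ℝ _) (Matrix.toEuclideanCLM (𝕜 := ℝ) P)

/-- Translating `p` by `Pm`, with `m` the midpoint of `u` and `v`, produces exactly the phase of the
two chirps. -/
theorem isWignerCovariant_chirp (hħ : 0 < ħ) {P : Matrix (Fin n) (Fin n) ℝ} (hP : P.IsSymm) :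
    IsWignerCovariant hħ 1 (chirpEquiv ħ P : 𝓢(Rn n, ℂ) →L[ℂ] 𝓢(Rn n, ℂ)) (shearEquiv P) := by
  refine .of_kernel fun Φ u v => ?_
  have e : fstOp (conjOp (chirpEquiv ħ P : 𝓢(Rn n, ℂ) →L[ℂ] 𝓢(Rn n, ℂ)))
      (sndOp (chirpEquiv ħ P : 𝓢(Rn n, ℂ) →L[ℂ] 𝓢(Rn n, ℂ)) (weylKernel hħ
        (compCLMOfContinuousLinearEquiv ℂ (shearEquiv P) Φ))) (u, v) =
      chirp ħ (-P) u * (chirp ħ P v *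
        weylKernel hħ (compCLMOfContinuousLinearEquiv ℂ (shearEquiv P) Φ) (u, v)) := by
    rw [fstOp_apply, conjOp_apply, conjSchwartz_apply, ContinuousLinearEquiv.coe_coe,
      chirpEquiv_apply, map_mul, conj_chirp, conjSchwartz_apply, Complex.conj_conj, sliceCLM_apply,
      swapCLM_apply, sndOp_apply, ContinuousLinearEquiv.coe_coe, chirpEquiv_apply]
    rfl
  rw [e, weylKernel_apply, weylKernel_apply, one_mul, mul_left_comm (chirp ħ P v), mul_left_comm,
    ← integral_const_mul, ← integral_const_mul]
  congr 1
  set m : Rn n := (1 / 2 : ℝ) • (u + v)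
  rw [← integral_add_right_eq_self (fun p => Complex.exp (-(Complex.I / ħ) *
    (inner ℝ p (u - v) : ℝ)) * Φ (m, p)) (Matrix.toEuclideanCLM (𝕜 := ℝ) P m)]
  refine integral_congr_ae (.of_forall fun p => ?_)
  have e1 : compCLMOfContinuousLinearEquiv ℂ (shearEquiv P) Φ (m, p) =
      Φ (m, p + Matrix.toEuclideanCLM (𝕜 := ℝ) P m) := rfl
  beta_reduce
  rw [e1, ← mul_assoc, ← mul_assoc, mul_assoc (chirp ħ (-P) u)]
  congr 1
  simp only [chirp]
  rw [← Complex.exp_add, ← Complex.exp_add]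
  congr 1
  -- Symmetry of `P` kills the mixed terms of `P(u + v) · (u - v)`.
  have h1 : inner ℝ (Matrix.toEuclideanCLM (𝕜 := ℝ) P m) (u - v) =
      1 / 2 * (inner ℝ (Matrix.toEuclideanCLM (𝕜 := ℝ) P u) u -
        inner ℝ (Matrix.toEuclideanCLM (𝕜 := ℝ) P v) v) := by
    have h2 : inner ℝ (Matrix.toEuclideanCLM (𝕜 := ℝ) P u) v =
        inner ℝ (Matrix.toEuclideanCLM (𝕜 := ℝ) P v) u := by
      rw [inner_toEuclideanCLM_symm hP, real_inner_comm]
    simp only [m, map_smul, map_add, inner_smul_left, inner_add_left, inner_sub_right, h2]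
    simp only [one_div, conj_trivial]
    ring
  rw [inner_add_left, h1, map_neg]
  simp only [neg_apply, inner_neg_left]
  have : (ħ : ℂ) ≠ 0 := by exact_mod_cast hħ.ne'
  push_cast
  field_simp
  ring

theorem integral_comp_equiv (g : Rn n ≃L[ℝ] Rn n) (f : Rn n → ℂ) :
    ∫ x, f (g x) = ((|LinearMap.det (g : Rn n →ₗ[ℝ] Rn n)|⁻¹ : ℝ) : ℂ) * ∫ x, f x := by
  have hdet : LinearMap.det (g : Rn n →ₗ[ℝ] Rn n) ≠ 0 :=
    (LinearEquiv.isUnit_det' g.toLinearEquiv).ne_zero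
  have h := Measure.map_linearMap_addHaar_eq_smul_addHaar (volume : Measure (Rn n)) hdet
  have h2 : ∫ x, f (g x) = ∫ x, f x ∂(Measure.map g volume) :=
    (g.toHomeomorph.toMeasurableEquiv.measurableEmbedding.integral_map f).symm
  rw [h2]
  change ∫ x, f x ∂(Measure.map (g : Rn n →ₗ[ℝ] Rn n) volume) = _
  rw [h, integral_smul_measure, ENNReal.toReal_ofReal (abs_nonneg _), abs_inv, Complex.real_smul]

/-- Here `h` is the adjoint of `g`. Since `p · (gu - gv) = hp · (u - v)`, the substitution `p ↦ hp`
gives the kernel at `(u, v)` and the Jacobian. -/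
theorem isWignerCovariant_comp (hħ : 0 < ħ) (g h : Rn n ≃L[ℝ] Rn n)
    (hgh : ∀ p u, inner ℝ (h p) u = inner ℝ p (g u)) :
    IsWignerCovariant hħ ((|LinearMap.det (h : Rn n →ₗ[ℝ] Rn n)|⁻¹ : ℝ) : ℂ)
      (compEquiv g : 𝓢(Rn n, ℂ) →L[ℂ] 𝓢(Rn n, ℂ)) (g.symm.prodCongr h) := by
  refine .of_kernel fun Φ u v => ?_
  have e : fstOp (conjOp (compEquiv g : 𝓢(Rn n, ℂ) →L[ℂ] 𝓢(Rn n, ℂ)))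
      (sndOp (compEquiv g : 𝓢(Rn n, ℂ) →L[ℂ] 𝓢(Rn n, ℂ)) (weylKernel hħ
        (compCLMOfContinuousLinearEquiv ℂ (g.symm.prodCongr h) Φ))) (u, v) =
      weylKernel hħ (compCLMOfContinuousLinearEquiv ℂ (g.symm.prodCongr h) Φ) (g u, g v) :=
    Complex.conj_conj _
  rw [e, weylKernel_apply, weylKernel_apply, mul_left_comm, ← integral_comp_equiv]
  congr 1
  refine integral_congr_ae (.of_forall fun p => ?_)
  have e1 : compCLMOfContinuousLinearEquiv ℂ (g.symm.prodCongr h) Φ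
      ((1 / 2 : ℝ) • (g u + g v), p) = Φ ((1 / 2 : ℝ) • (u + v), h p) := by
    change Φ (g.symm _, h p) = _
    rw [← map_add, ← map_smul, g.symm_apply_apply]
  beta_reduce
  rw [e1, hgh, map_sub]

end Covariance

/-! ### Covariance under the Fourier transform. -/

section FourierCovariance

variable {n : ℕ} {ħ : ℝ}

/-- The Fourier transform, as an operator on the Schwartz space. -/
noncomputable abbrev fourierOp (n : ℕ) : 𝓢(Rn n, ℂ) →L[ℂ] 𝓢(Rn n, ℂ) :=
  (FourierTransform.fourierCLE ℂ 𝓢(Rn n, ℂ) : 𝓢(Rn n, ℂ) →L[ℂ] 𝓢(Rn n, ℂ))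

theorem fourierOp_apply (f : 𝓢(Rn n, ℂ)) (x : Rn n) :
    fourierOp n f x =
      ∫ y, Complex.exp (Complex.I * ((-2 * Real.pi * inner ℝ y x : ℝ) : ℂ)) * f y := by
  change 𝓕 f x = _
  rw [SchwartzMap.fourier_coe, Real.fourier_eq']
  refine integral_congr_ae (.of_forall fun y => ?_)
  simp only [smul_eq_mul, mul_comm Complex.I]

theorem conjOp_fourierOp : conjOp (fourierOp n) =
    ((FourierTransform.fourierCLE ℂ 𝓢(Rn n, ℂ)).symm : 𝓢(Rn n, ℂ) →L[ℂ] 𝓢(Rn n, ℂ)) := by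
  ext f x
  change conj (𝓕 (conjSchwartz f) x) = 𝓕⁻ f x
  rw [SchwartzMap.fourier_coe, SchwartzMap.fourierInv_coe, Real.fourier_eq', Real.fourierInv_eq',
    ← integral_conj]
  refine integral_congr_ae (.of_forall fun y => ?_)
  simp only [smul_eq_mul, map_mul, conjSchwartz_apply, Complex.conj_conj, ← Complex.exp_conj,
    Complex.conj_I, Complex.conj_ofReal]
  congr 2
  push_cast
  ring

theorem integral_comp_smul_add {a : ℝ} (ha : a ≠ 0) (b : Rn n) (f : Rn n → ℂ) :
    ∫ x, f x = ((|a| ^ n : ℝ) : ℂ) * ∫ x, f (a • x + b) := by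
  have h1 := Measure.integral_comp_smul (volume : Measure (Rn n)) (fun x => f (x + b)) a
  rw [integral_add_right_eq_self] at h1
  rw [h1, finrank_euclideanSpace, Fintype.card_fin, Complex.real_smul, ← mul_assoc,
    ← Complex.ofReal_mul, abs_inv, abs_pow, mul_inv_cancel₀ (by positivity), Complex.ofReal_one,
    one_mul]

/-- The map `(x, p) ↦ (p / (2πħ), -2πħ x)` of phase space. -/
noncomputable def fourierEquiv (hħ : 0 < ħ) : (Rn n × Rn n) ≃L[ℝ] (Rn n × Rn n) :=
  (ContinuousLinearEquiv.prodComm ℝ (Rn n) (Rn n)).trans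
    ((ContinuousLinearEquiv.smulLeft
        (Units.mk0 (2 * Real.pi * ħ)⁻¹ (by have := Real.pi_pos; positivity))).prodCongr
      (ContinuousLinearEquiv.smulLeft
        (Units.mk0 (-(2 * Real.pi * ħ)) (by have := Real.pi_pos; simp [hħ.ne', this.ne']))))

theorem fourierEquiv_apply (hħ : 0 < ħ) (z : Rn n × Rn n) :
    fourierEquiv hħ z = ((2 * Real.pi * ħ)⁻¹ • z.2, (-(2 * Real.pi * ħ)) • z.1) := rfl

/-- Transforming one kernel in `v` and the other in `u` yields the same double integral of `Φ`
against a phase, in opposite orders of integration. Stating it with a Fourier transform on each side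
keeps the integrals absolutely convergent. -/
theorem fourier_weylKernel (hħ : 0 < ħ) (Φ : 𝓢(Rn n × Rn n, ℂ)) :
    sndOp (fourierOp n) (weylKernel hħ (compCLMOfContinuousLinearEquiv ℂ (fourierEquiv hħ) Φ)) =
      fstOp (fourierOp n) (weylKernel hħ Φ) := by
  have hπ := Real.pi_pos
  have hπc : (Real.pi : ℂ) ≠ 0 := by exact_mod_cast hπ.ne'
  have hħc : (ħ : ℂ) ≠ 0 := by exact_mod_cast hħ.ne'
  ext ⟨a, b⟩
  set c : ℂ := ((1 / (2 * Real.pi * ħ) : ℝ) ^ n : ℂ) with hc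
  -- The common phase, in the variables `z = (m, p)` in which `Φ` is evaluated.
  let θ : Rn n × Rn n → ℝ := fun z => -4 * Real.pi * inner ℝ z.1 a + 2 * Real.pi * inner ℝ a b -
    2 / ħ * inner ℝ z.2 z.1 + 2 / ħ * inner ℝ z.2 b
  let H : Rn n × Rn n → ℂ := fun z => Complex.exp (Complex.I * (θ z : ℂ)) * Φ z
  have hH : Integrable H := by
    have : (volume : Measure (Rn n × Rn n)).IsAddHaarMeasure :=
      Measure.prod.instIsAddHaarMeasure volume volume
    refine Φ.integrable.mono ?_ (.of_forall fun z => ?_)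
    · have := Φ.continuous
      have : Continuous H := by fun_prop
      exact this.aestronglyMeasurable
    · simp only [H]
      rw [norm_mul, mul_comm Complex.I, Complex.norm_exp_ofReal_mul_I, one_mul]
  have hl : sndOp (fourierOp n) (weylKernel hħ
      (compCLMOfContinuousLinearEquiv ℂ (fourierEquiv hħ) Φ)) (a, b) =
      ((2 ^ n : ℝ) : ℂ) * c * ∫ p, ∫ m, H (m, p) := by
    -- The substitution `v = -(πħ)⁻¹p - a` makes the midpoint with `a` equal to `-p / (2πħ)`. With
    -- momentum `2πħm`, `fourierEquiv` then lands on `(m, p)`. The Jacobians multiply to `2ⁿ`.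
    rw [sndOp_apply, fourierOp_apply, integral_comp_smul_add (a := -(Real.pi * ħ)⁻¹)
      (by simp [hħ.ne', hπ.ne']) (-a), ← integral_const_mul, ← integral_const_mul]
    refine integral_congr_ae (.of_forall fun p => ?_)
    simp only [sliceCLM_apply]
    rw [weylKernel_apply, integral_comp_smul_add (a := 2 * Real.pi * ħ) (by positivity) 0,
      ← hc]
    simp only [← integral_const_mul]
    refine integral_congr_ae (.of_forall fun m => ?_)
    have e1 : compCLMOfContinuousLinearEquiv ℂ (fourierEquiv hħ) Φ
        ((1 / 2 : ℝ) • (a + (-(Real.pi * ħ)⁻¹ • p + -a)), (2 * Real.pi * ħ) • m + 0) =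
        Φ (m, p) := by
      change Φ (fourierEquiv hħ _) = _
      rw [fourierEquiv_apply]
      congr 2
      · rw [add_zero, smul_smul, inv_mul_cancel₀ (by positivity), one_smul]
      · rw [add_neg_cancel_comm_assoc, smul_smul, smul_smul]
        have : -(2 * Real.pi * ħ) * (1 / 2) * -(Real.pi * ħ)⁻¹ = 1 := by field_simp
        rw [this, one_smul]
    beta_reduce
    rw [e1]
    have e2 : ((|-(Real.pi * ħ)⁻¹| ^ n : ℝ) : ℂ) * ((|2 * Real.pi * ħ| ^ n : ℝ) : ℂ) =
        ((2 ^ n : ℝ) : ℂ) := by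
      rw [← Complex.ofReal_mul, ← mul_pow, abs_neg, ← abs_mul]
      congr 2
      rw [abs_of_pos (by positivity)]
      field_simp
    have e3 : Complex.exp (Complex.I * ((-2 * Real.pi *
          inner ℝ (-(Real.pi * ħ)⁻¹ • p + -a) b : ℝ) : ℂ)) *
        Complex.exp (-(Complex.I / ħ) * (inner ℝ ((2 * Real.pi * ħ) • m + 0)
          (a - (-(Real.pi * ħ)⁻¹ • p + -a)) : ℝ)) = Complex.exp (Complex.I * (θ (m, p) : ℂ)) := by
      rw [← Complex.exp_add]
      congr 1
      simp only [θ, add_zero, inner_add_left, inner_smul_left, inner_neg_left, inner_sub_right,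
        inner_add_right, inner_smul_right, inner_neg_right, conj_trivial, real_inner_comm p m]
      push_cast
      field_simp
      ring
    simp only [H]
    rw [← e2, ← e3]
    ring
  have hr : fstOp (fourierOp n) (weylKernel hħ Φ) (a, b) =
      ((2 ^ n : ℝ) : ℂ) * c * ∫ m, ∫ p, H (m, p) := by
    -- With `u = 2m - b` the midpoint with `b` is `m`; the Jacobian is again `2ⁿ`.
    rw [fstOp_apply, fourierOp_apply, integral_comp_smul_add (a := 2) two_ne_zero (-b),
      ← integral_const_mul, ← integral_const_mul]
    refine integral_congr_ae (.of_forall fun m => ?_)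
    simp only [sliceCLM_apply, swapCLM_apply]
    rw [weylKernel_apply, ← hc]
    simp only [← integral_const_mul]
    refine integral_congr_ae (.of_forall fun p => ?_)
    have e1 : (1 / 2 : ℝ) • ((2 : ℝ) • m + -b + b) = m := by
      rw [neg_add_cancel_right, smul_smul]
      norm_num
    beta_reduce
    rw [e1]
    have e3 : Complex.exp (Complex.I * ((-2 * Real.pi * inner ℝ ((2 : ℝ) • m + -b) a : ℝ) : ℂ)) *
        Complex.exp (-(Complex.I / ħ) * (inner ℝ p ((2 : ℝ) • m + -b - b) : ℝ)) =
        Complex.exp (Complex.I * (θ (m, p) : ℂ)) := by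
      rw [← Complex.exp_add]
      congr 1
      simp only [θ, inner_add_left, inner_smul_left, inner_neg_left, inner_sub_right,
        inner_add_right, inner_smul_right, inner_neg_right, conj_trivial, real_inner_comm a b]
      push_cast
      field_simp
      ring
    simp only [H]
    rw [← e3, abs_of_pos (zero_lt_two' ℝ)]
    ring
  rw [hl, hr, integral_integral_swap (f := fun m p => H (m, p)) hH]

/-- The conjugate of the Fourier transform is its inverse, which cancels the transform in the first
variable left by `fourier_weylKernel`. -/
theorem isWignerCovariant_fourier (hħ : 0 < ħ) :
    IsWignerCovariant hħ 1 (fourierOp n) (fourierEquiv hħ) := by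
  refine .of_kernel fun Φ u v => ?_
  rw [fourier_weylKernel, conjOp_fourierOp, one_mul]
  exact congrArg (fun f : 𝓢(Rn n, ℂ) => f u) ((FourierTransform.fourierCLE ℂ 𝓢(Rn n, ℂ)).symm_apply_apply
    (sliceCLM v (swapCLM (weylKernel hħ Φ))))

end FourierCovariance

/-! ### Symplectic covariance of the Wigner transform. -/

section QuadraticFourier

variable {n : ℕ} {ħ : ℝ}

theorem quadraticFourierConst_ne_zero (hħ : 0 < ħ) {L : Matrix (Fin n) (Fin n) ℝ} (hL : L.det ≠ 0)
    (m : ℤ) : quadraticFourierConst ħ L m ≠ 0 := by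
  have := Real.pi_pos
  have : 0 < |L.det| := abs_pos.2 hL
  rw [quadraticFourierConst]
  refine mul_ne_zero (mul_ne_zero ?_ (Complex.exp_ne_zero _)) (zpow_ne_zero _ Complex.I_ne_zero)
  rw [Complex.ofReal_ne_zero]
  positivity

theorem norm_quadraticFourierConst (L : Matrix (Fin n) (Fin n) ℝ) (m : ℤ) :
    ‖quadraticFourierConst ħ L m‖ = (1 / √(2 * Real.pi * ħ)) ^ n * √|L.det| := by
  rw [quadraticFourierConst, norm_mul, norm_mul, norm_zpow, Complex.norm_I, one_zpow, mul_one,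
    ← Complex.ofReal_neg, Complex.norm_exp_ofReal_mul_I, mul_one, Complex.norm_real,
    Real.norm_of_nonneg (by positivity)]

/-- The quadratic Fourier transform on the Schwartz space. -/
noncomputable def quadraticFourierOp (hħ : 0 < ħ) (P L Q : Matrix (Fin n) (Fin n) ℝ) (m : ℤ)
    (hL : L.det ≠ 0) : 𝓢(Rn n, ℂ) ≃L[ℂ] 𝓢(Rn n, ℂ) :=
  (((chirpEquiv ħ Q).trans (FourierTransform.fourierCLE ℂ 𝓢(Rn n, ℂ))).trans
    (compEquiv (dilationEquiv hħ L hL))).trans ((chirpEquiv ħ P).trans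
      (ContinuousLinearEquiv.smulLeft (Units.mk0 _ (quadraticFourierConst_ne_zero hħ hL m))))

theorem quadraticFourierOp_apply (hħ : 0 < ħ) (P L Q : Matrix (Fin n) (Fin n) ℝ) (m : ℤ)
    (hL : L.det ≠ 0) (f : 𝓢(Rn n, ℂ)) (x : Rn n) :
    quadraticFourierOp hħ P L Q m hL f x = quadraticFourierConst ħ L m *
      ∫ x' : Rn n, Complex.exp (Complex.I / ħ * generatingForm P L Q x x') * f x' := by
  have e : quadraticFourierOp hħ P L Q m hL f x =
      quadraticFourierConst ħ L m * (chirp ħ P x * 𝓕 (chirpEquiv ħ Q f)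
        ((2 * Real.pi * ħ)⁻¹ • Matrix.toEuclideanCLM (𝕜 := ℝ) L x)) := by
    change quadraticFourierConst ħ L m * chirpEquiv ħ P (compEquiv (dilationEquiv hħ L hL)
      (𝓕 (chirpEquiv ħ Q f))) x = _
    rw [chirpEquiv_apply]
    rfl
  rw [e, SchwartzMap.fourier_coe, Real.fourier_eq', ← integral_const_mul (chirp ħ P x)]
  congr 1
  refine integral_congr_ae (.of_forall fun y => ?_)
  simp only [smul_eq_mul, chirpEquiv_apply, chirp, generatingForm, inner_smul_right, ← mul_assoc,
    ← Complex.exp_add]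
  congr 2
  have := Real.pi_pos
  rw [real_inner_comm (Matrix.toEuclideanCLM (𝕜 := ℝ) L x) y]
  push_cast
  field_simp
  ring

theorem IsQuadraticFourier.det_ne_zero {P L Q : Matrix (Fin n) (Fin n) ℝ} {m : ℤ}
    {U : L2 n ≃ₗᵢ[ℂ] L2 n} (h : IsQuadraticFourier ħ P L Q m U) : L.det ≠ 0 := fun h0 => by
  have := h.2.2.1
  rw [h0, mul_zero] at this
  exact lt_irrefl _ this

theorem IsQuadraticFourier.toLp_eq (hħ : 0 < ħ) {P L Q : Matrix (Fin n) (Fin n) ℝ} {m : ℤ}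
    {U : L2 n ≃ₗᵢ[ℂ] L2 n} (h : IsQuadraticFourier ħ P L Q m U) (f : 𝓢(Rn n, ℂ)) :
    U (f.toLp 2) = (quadraticFourierOp hħ P L Q m h.det_ne_zero f).toLp 2 := by
  refine Lp.ext ((h.2.2.2 f).trans (Filter.EventuallyEq.trans (.of_eq ?_)
    (SchwartzMap.coeFn_toLp _ 2 volume).symm))
  ext x
  rw [quadraticFourierOp_apply]

theorem phaseMap_fromBlocks (A B C D : Matrix (Fin n) (Fin n) ℝ) (z : Rn n × Rn n) :
    phaseMap (Matrix.fromBlocks A B C D) z =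
      (Matrix.toEuclideanCLM (𝕜 := ℝ) A z.1 + Matrix.toEuclideanCLM (𝕜 := ℝ) B z.2,
        Matrix.toEuclideanCLM (𝕜 := ℝ) C z.1 + Matrix.toEuclideanCLM (𝕜 := ℝ) D z.2) := by
  have h : ∀ M : Matrix (Fin n ⊕ Fin n) (Fin n ⊕ Fin n) ℝ, phaseMap M z =
    (WithLp.toLp 2 fun i => M.mulVec (Sum.elim z.1.ofLp z.2.ofLp) (Sum.inl i),
      WithLp.toLp 2 fun i => M.mulVec (Sum.elim z.1.ofLp z.2.ofLp) (Sum.inr i)) := fun _ => rfl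
  rw [h, Matrix.fromBlocks_mulVec]
  rfl

theorem toEuclideanCLM_mul_apply (A B : Matrix (Fin n) (Fin n) ℝ) (x : Rn n) :
    Matrix.toEuclideanCLM (𝕜 := ℝ) (A * B) x =
      Matrix.toEuclideanCLM (𝕜 := ℝ) A (Matrix.toEuclideanCLM (𝕜 := ℝ) B x) := by
  rw [map_mul]
  rfl

theorem det_dilationEquiv (hħ : 0 < ħ) (L : Matrix (Fin n) (Fin n) ℝ) (hL : L.det ≠ 0) :
    LinearMap.det (dilationEquiv hħ L hL : Rn n →ₗ[ℝ] Rn n) =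
      ((2 * Real.pi * ħ)⁻¹) ^ n * L.det := by
  have e : (dilationEquiv hħ L hL : Rn n →ₗ[ℝ] Rn n) =
      (2 * Real.pi * ħ)⁻¹ • Matrix.toEuclideanLin L := rfl
  rw [e, LinearMap.det_smul, finrank_euclideanSpace, Fintype.card_fin]
  congr 1
  rw [Matrix.toEuclideanLin_eq_toLin_orthonormal, LinearMap.det_toLin]

theorem inner_dilationEquiv (hħ : 0 < ħ) (L : Matrix (Fin n) (Fin n) ℝ) (hL : L.det ≠ 0)
    (hL' : L.transpose.det ≠ 0) (p u : Rn n) :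
    inner ℝ (dilationEquiv hħ L.transpose hL' p) u = inner ℝ p (dilationEquiv hħ L hL u) := by
  change inner ℝ ((2 * Real.pi * ħ)⁻¹ • Matrix.toEuclideanCLM (𝕜 := ℝ) L.transpose p) u =
    inner ℝ p ((2 * Real.pi * ħ)⁻¹ • Matrix.toEuclideanCLM (𝕜 := ℝ) L u)
  rw [real_inner_smul_left, real_inner_smul_right, inner_toEuclideanCLM_transpose]

/-- Compose the covariances of the factors: chirp `Q`, Fourier transform, dilation by `L / (2πħ)`,
chirp `P`, constant. The corresponding phase space maps compose to the free symplectic matrix. -/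
theorem isWignerCovariant_quadraticFourierOp (hħ : 0 < ħ) {P L Q : Matrix (Fin n) (Fin n) ℝ}
    (hP : P.IsSymm) (hQ : Q.IsSymm) (m : ℤ) (hL : L.det ≠ 0) :
    ∃ s : (Rn n × Rn n) ≃L[ℝ] (Rn n × Rn n), (∀ z, s z = phaseMap (freeSymplectic P L Q) z) ∧
      IsWignerCovariant hħ 1
        (quadraticFourierOp hħ P L Q m hL : 𝓢(Rn n, ℂ) →L[ℂ] 𝓢(Rn n, ℂ)) s := by
  have hπ := Real.pi_pos
  have hL' : L.transpose.det ≠ 0 := by rwa [Matrix.det_transpose]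
  have h := ((((IsWignerCovariant.const (hħ := hħ) (quadraticFourierConst ħ L m)).comp
    (isWignerCovariant_chirp hħ hP)).comp
    (isWignerCovariant_comp hħ (dilationEquiv hħ L hL) (dilationEquiv hħ L.transpose hL')
      (inner_dilationEquiv hħ L hL hL'))).comp (isWignerCovariant_fourier hħ)).comp
      (isWignerCovariant_chirp hħ hQ)
  -- The squared modulus of the constant is `(2πħ)⁻ⁿ|det L|`, the absolute determinant of the
  -- dilation.
  have hκ : conj (quadraticFourierConst ħ L m) * quadraticFourierConst ħ L m * 1 *
      ((|LinearMap.det (dilationEquiv hħ L.transpose hL' : Rn n →ₗ[ℝ] Rn n)|⁻¹ : ℝ) : ℂ) * 1 * 1 =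
      1 := by
    rw [mul_one, mul_one, mul_one, ← Complex.normSq_eq_conj_mul_self, Complex.normSq_eq_norm_sq,
      norm_quadraticFourierConst, det_dilationEquiv, ← Complex.ofReal_mul, ← Complex.ofReal_one]
    congr 1
    rw [mul_pow, Real.sq_sqrt (abs_nonneg _), ← pow_mul, mul_comm n 2, pow_mul, div_pow,
      Real.sq_sqrt (by positivity), Matrix.det_transpose, abs_mul, abs_pow,
      abs_of_pos (show 0 < (2 * Real.pi * ħ)⁻¹ by positivity)]
    have : |L.det| ≠ 0 := abs_ne_zero.2 hL
    field_simp
  rw [hκ] at h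
  refine ⟨_, fun z => ?_, h⟩
  · obtain ⟨x, p⟩ := z
    rw [freeSymplectic, phaseMap_fromBlocks]
    have h0 : 2 * Real.pi * ħ ≠ 0 := by positivity
    have h1 : ∀ y : Rn n, (dilationEquiv hħ L hL).symm ((2 * Real.pi * ħ)⁻¹ • y) =
        Matrix.toEuclideanCLM (𝕜 := ℝ) L⁻¹ y := fun y => by
      change (2 * Real.pi * ħ) • Matrix.toEuclideanCLM (𝕜 := ℝ) L⁻¹ ((2 * Real.pi * ħ)⁻¹ • y) = _
      rw [map_smul, smul_smul, mul_inv_cancel₀ h0, one_smul]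
    have h2 : dilationEquiv hħ L.transpose hL' ((-(2 * Real.pi * ħ)) • x) =
        -Matrix.toEuclideanCLM (𝕜 := ℝ) L.transpose x := by
      change (2 * Real.pi * ħ)⁻¹ • Matrix.toEuclideanCLM (𝕜 := ℝ) L.transpose
        ((-(2 * Real.pi * ħ)) • x) = _
      rw [map_smul, smul_smul, mul_neg, inv_mul_cancel₀ h0, neg_one_smul]
    change ((dilationEquiv hħ L hL).symm ((2 * Real.pi * ħ)⁻¹ •
        (p + Matrix.toEuclideanCLM (𝕜 := ℝ) Q x)),
      dilationEquiv hħ L.transpose hL' ((-(2 * Real.pi * ħ)) • x) +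
        Matrix.toEuclideanCLM (𝕜 := ℝ) P ((dilationEquiv hħ L hL).symm ((2 * Real.pi * ħ)⁻¹ •
        (p + Matrix.toEuclideanCLM (𝕜 := ℝ) Q x)))) = _
    rw [h1, h2]
    simp only [toEuclideanCLM_mul_apply, map_sub, map_add, sub_apply]
    refine Prod.ext (add_comm _ _) ?_
    dsimp only
    abel

/-- Induction over the graph handles operator and matrix together, so the covering projection need
not be known to be single-valued. -/
theorem exists_covariant_of_mem_metaplecticGraph (hħ : 0 < ħ)
    {a : (L2 n ≃ₗᵢ[ℂ] L2 n) × Matrix.symplecticGroup (Fin n) ℝ} (ha : a ∈ metaplecticGraph n ħ) :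
    ∃ (A : 𝓢(Rn n, ℂ) ≃L[ℂ] 𝓢(Rn n, ℂ)) (s : (Rn n × Rn n) ≃L[ℝ] (Rn n × Rn n)),
      (∀ f, a.1 (f.toLp 2) = (A f).toLp 2) ∧
      (∀ z, s z = phaseMap (a.2 : Matrix (Fin n ⊕ Fin n) (Fin n ⊕ Fin n) ℝ) z) ∧
      IsWignerCovariant hħ 1 (A : 𝓢(Rn n, ℂ) →L[ℂ] 𝓢(Rn n, ℂ)) s := by
  induction ha using Subgroup.closure_induction with
  | mem a ha =>
    obtain ⟨P, L, Q, m, h, hS⟩ := ha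
    obtain ⟨s, hs, hc⟩ :=
      isWignerCovariant_quadraticFourierOp hħ h.1 h.2.1 m h.det_ne_zero
    exact ⟨_, s, h.toLp_eq hħ, fun z => by rw [hs, hS], hc⟩
  | one => exact ⟨.refl ℂ _, .refl ℝ _, fun f => rfl, fun z => (phaseMap_one z).symm, .refl⟩
  | mul a b _ _ iha ihb =>
    obtain ⟨A, s, hA, hs, hc⟩ := iha
    obtain ⟨B, t, hB, ht, hd⟩ := ihb
    refine ⟨B.trans A, t.trans s, fun f => ?_, fun z => ?_, ?_⟩
    · change a.1 (b.1 (f.toLp 2)) = _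
      rw [hB, hA]
      rfl
    · change s (t z) = _
      rw [ht, hs, phaseMap_phaseMap]
      rfl
    · have := hc.comp hd
      rw [one_mul] at this
      exact this
  | inv a _ iha =>
    obtain ⟨A, s, hA, hs, hc⟩ := iha
    refine ⟨A.symm, s.symm, fun f => ?_, fun z => ?_, hc.symm⟩
    · change a.1.symm (f.toLp 2) = _
      rw [LinearIsometryEquiv.symm_apply_eq, hA, ContinuousLinearEquiv.apply_symm_apply]
    · rw [ContinuousLinearEquiv.symm_apply_eq, hs, phaseMap_phaseMap]
      have : (a.2 : Matrix (Fin n ⊕ Fin n) (Fin n ⊕ Fin n) ℝ) * ((a⁻¹).2 : Matrix _ _ ℝ) = 1 :=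
        congrArg Subtype.val (mul_inv_cancel a.2)
      rw [this, phaseMap_one]

/-- Symplectic covariance of the Wigner transform. -/
theorem wigner_metaplecticDistribution_inv (hħ : 0 < ħ) {U : metaplecticGroup n ħ}
    {S : Matrix.symplecticGroup (Fin n) ℝ} (hU : Covers U S) (ψ : 𝓢'(Rn n, ℂ))
    (Φ Φ' : 𝓢(Rn n × Rn n, ℂ))
    (h : ∀ z, Φ z = Φ' (phaseMap (S : Matrix (Fin n ⊕ Fin n) (Fin n ⊕ Fin n) ℝ) z)) :
    wigner hħ (metaplecticDistribution hħ U⁻¹ ψ) Φ = wigner hħ ψ Φ' := by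
  obtain ⟨A, s, hA, hs, hc⟩ := exists_covariant_of_mem_metaplecticGraph hħ hU
  have e1 : metaplecticDistribution hħ U⁻¹ ψ =
      transport (A : 𝓢(Rn n, ℂ) →L[ℂ] 𝓢(Rn n, ℂ)) ψ := by
    -- A Schwartz function is determined by its class in `L²`, so the restriction of `U` chosen in
    -- the definition is `A`.
    have hAU : ∀ f, metaplecticSchwartz hħ U f = A f := fun f =>
      SchwartzMap.injective_toLp 2 volume ((toLp_metaplecticSchwartz hħ U f).trans (hA f))
    ext f
    change ψ (conjSchwartz (metaplecticSchwartz hħ U⁻¹⁻¹ (conjSchwartz f))) = _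
    rw [inv_inv, hAU]
    rfl
  have e2 : Φ = compCLMOfContinuousLinearEquiv ℂ s Φ' := by
    ext z
    rw [h, ← hs]
    rfl
  rw [e1, e2, hc, one_mul]

end QuadraticFourier

/-! ### Existence of the quadratic Fourier transforms on `L²`. -/

section Unitary

variable {n : ℕ} {ħ : ℝ}

/-- Plancherel's formula; the chirps are unimodular and the constant compensates the Jacobian of the
dilation. -/
theorem inner_toLp_quadraticFourierOp (hħ : 0 < ħ) (P L Q : Matrix (Fin n) (Fin n) ℝ) (m : ℤ)
    (hL : L.det ≠ 0) (f : 𝓢(Rn n, ℂ)) :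
    inner ℂ ((quadraticFourierOp hħ P L Q m hL f).toLp 2 (volume : Measure (Rn n)))
      ((quadraticFourierOp hħ P L Q m hL f).toLp 2 volume) =
      inner ℂ (f.toLp 2 (volume : Measure (Rn n))) (f.toLp 2 volume) := by
  have hπ := Real.pi_pos
  have hchirp : ∀ (R : Matrix (Fin n) (Fin n) ℝ) (x : Rn n),
      conj (chirp ħ R x) * chirp ħ R x = 1 := fun R x => by
    rw [conj_chirp, mul_comm, chirp_mul_chirp_neg]
  have hκ : conj (quadraticFourierConst ħ L m) * quadraticFourierConst ħ L m *
      ((|LinearMap.det (dilationEquiv hħ L hL : Rn n →ₗ[ℝ] Rn n)|⁻¹ : ℝ) : ℂ) = 1 := by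
    rw [← Complex.normSq_eq_conj_mul_self, Complex.normSq_eq_norm_sq,
      norm_quadraticFourierConst, det_dilationEquiv, ← Complex.ofReal_mul, ← Complex.ofReal_one]
    congr 1
    rw [mul_pow, Real.sq_sqrt (abs_nonneg _), ← pow_mul, mul_comm n 2, pow_mul, div_pow,
      Real.sq_sqrt (by positivity), abs_mul, abs_pow,
      abs_of_pos (show 0 < (2 * Real.pi * ħ)⁻¹ by positivity)]
    have : |L.det| ≠ 0 := abs_ne_zero.2 hL
    field_simp
  have h1 : ∀ x, inner ℂ (quadraticFourierOp hħ P L Q m hL f x)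
      (quadraticFourierOp hħ P L Q m hL f x) =
      conj (quadraticFourierConst ħ L m) * quadraticFourierConst ħ L m *
        (fun y => inner ℂ (𝓕 (chirpEquiv ħ Q f) y) (𝓕 (chirpEquiv ħ Q f) y))
          (dilationEquiv hħ L hL x) := by
    intro x
    have e : quadraticFourierOp hħ P L Q m hL f x = quadraticFourierConst ħ L m *
        (chirp ħ P x * 𝓕 (chirpEquiv ħ Q f) (dilationEquiv hħ L hL x)) := by
      change quadraticFourierConst ħ L m * chirpEquiv ħ P (compEquiv (dilationEquiv hħ L hL)
        (𝓕 (chirpEquiv ħ Q f))) x = _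
      rw [chirpEquiv_apply]
      rfl
    have h := hchirp P x
    rw [e]
    simp only [RCLike.inner_apply, map_mul]
    linear_combination (conj (quadraticFourierConst ħ L m) * quadraticFourierConst ħ L m *
      conj (𝓕 (chirpEquiv ħ Q f) (dilationEquiv hħ L hL x)) *
      𝓕 (chirpEquiv ħ Q f) (dilationEquiv hħ L hL x)) * h
  rw [SchwartzMap.inner_toL2_toL2_eq _ _ volume]
  simp only [h1]
  have h2 := integral_comp_equiv (dilationEquiv hħ L hL)
    (fun y => inner ℂ (𝓕 (chirpEquiv ħ Q f) y) (𝓕 (chirpEquiv ħ Q f) y))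
  beta_reduce at h2
  rw [integral_const_mul, h2, ← mul_assoc, hκ, one_mul,
    SchwartzMap.integral_inner_fourier_fourier, SchwartzMap.inner_toL2_toL2_eq _ _ volume]
  refine integral_congr_ae (.of_forall fun x => ?_)
  have h := hchirp Q x
  simp only [chirpEquiv_apply, RCLike.inner_apply, map_mul]
  linear_combination (f x * conj (f x)) * h

theorem norm_toLp_quadraticFourierOp (hħ : 0 < ħ) (P L Q : Matrix (Fin n) (Fin n) ℝ) (m : ℤ)
    (hL : L.det ≠ 0) (f : 𝓢(Rn n, ℂ)) :
    ‖(quadraticFourierOp hħ P L Q m hL f).toLp 2 (volume : Measure (Rn n))‖ =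
      ‖f.toLp 2 (volume : Measure (Rn n))‖ := by
  simp_rw [norm_eq_sqrt_re_inner (𝕜 := ℂ), inner_toLp_quadraticFourierOp]

/-- The operator is an isometric bijection of the Schwartz space, which is dense in `L²`, and
therefore extends to a unitary. The sign of `det L` decides the parity of `m`. -/
theorem exists_isQuadraticFourier (hħ : 0 < ħ) {P L Q : Matrix (Fin n) (Fin n) ℝ}
    (hP : P.IsSymm) (hQ : Q.IsSymm) (hL : L.det ≠ 0) :
    ∃ (U : L2 n ≃ₗᵢ[ℂ] L2 n) (m : ℤ), IsQuadraticFourier ħ P L Q m U := by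
  obtain ⟨m, hm⟩ : ∃ m : ℤ, 0 < (-1 : ℝ) ^ m * L.det := by
    rcases lt_or_gt_of_ne hL with h | h
    · exact ⟨1, by simpa using h⟩
    · exact ⟨0, by simpa using h⟩
  have hd : DenseRange (SchwartzMap.toLpCLM ℂ ℂ 2 (volume : Measure (Rn n))).toLinearMap :=
    SchwartzMap.denseRange_toLpCLM ENNReal.ofNat_ne_top
  let U : L2 n ≃ₗᵢ[ℂ] L2 n := LinearEquiv.extendOfIsometry
    (quadraticFourierOp hħ P L Q m hL).toLinearEquiv
    (SchwartzMap.toLpCLM ℂ ℂ 2 (volume : Measure (Rn n))).toLinearMap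
    (SchwartzMap.toLpCLM ℂ ℂ 2 (volume : Measure (Rn n))).toLinearMap hd hd
    (norm_toLp_quadraticFourierOp hħ P L Q m hL)
  refine ⟨U, m, hP, hQ, hm, fun f => ?_⟩
  have hU : U (f.toLp 2) = (quadraticFourierOp hħ P L Q m hL f).toLp 2 :=
    LinearEquiv.extendOfIsometry_eq _ _ _ hd hd (norm_toLp_quadraticFourierOp hħ P L Q m hL) f
  rw [hU]
  refine (SchwartzMap.coeFn_toLp _ 2 volume).trans (.of_eq ?_)
  ext x
  rw [quadraticFourierOp_apply]

end Unitary

/-! ### The metaplectic group covers the symplectic group. -/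

section Symplectic

open Matrix

variable {n : ℕ} {ħ : ℝ}

/-- The block relations of the matrix and of its transpose give the symmetry of `DB⁻¹` and `B⁻¹A`,
and `DᵀA - BᵀC = 1` determines `C`. -/
theorem eq_freeSymplectic {A B C D : Matrix (Fin n) (Fin n) ℝ}
    (h : fromBlocks A B C D ∈ symplecticGroup (Fin n) ℝ) (hB : B.det ≠ 0) :
    (D * B⁻¹).IsSymm ∧ (B⁻¹ * A).IsSymm ∧
      fromBlocks A B C D = freeSymplectic (D * B⁻¹) B⁻¹ (B⁻¹ * A) := by
  have hu : IsUnit B.det := isUnit_iff_ne_zero.2 hB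
  have hut : IsUnit Bᵀ.det := by rwa [det_transpose]
  obtain ⟨h1, h2, h3⟩ := SymplecticGroup.fromBlocks_mem_iff.1 h
  have ht := SymplecticGroup.transpose_mem h
  rw [fromBlocks_transpose] at ht
  obtain ⟨h4, -, -⟩ := SymplecticGroup.fromBlocks_mem_iff.1 ht
  rw [transpose_transpose, transpose_transpose] at h4
  have hP : (D * B⁻¹)ᵀ = D * B⁻¹ := by
    rw [transpose_mul, transpose_nonsing_inv]
    calc Bᵀ⁻¹ * Dᵀ = Bᵀ⁻¹ * (Dᵀ * B) * B⁻¹ := by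
          rw [Matrix.mul_assoc, Matrix.mul_assoc, mul_nonsing_inv _ hu, Matrix.mul_one]
      _ = D * B⁻¹ := by
          rw [← h2, ← Matrix.mul_assoc, nonsing_inv_mul _ hut, Matrix.one_mul]
  have hQ : (B⁻¹ * A)ᵀ = B⁻¹ * A := by
    rw [transpose_mul, transpose_nonsing_inv]
    calc Aᵀ * Bᵀ⁻¹ = B⁻¹ * (B * Aᵀ) * Bᵀ⁻¹ := by
          rw [← Matrix.mul_assoc, nonsing_inv_mul _ hu, Matrix.one_mul]
      _ = B⁻¹ * A := by
          rw [← h4, Matrix.mul_assoc, Matrix.mul_assoc, mul_nonsing_inv _ hut, Matrix.mul_one]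
  refine ⟨hP, hQ, ?_⟩
  rw [freeSymplectic, nonsing_inv_nonsing_inv _ hu, ← Matrix.mul_assoc, mul_nonsing_inv _ hu,
    Matrix.one_mul, Matrix.mul_assoc D, nonsing_inv_mul _ hu, Matrix.mul_one]
  congr 1
  have h5 : Dᵀ * A - Bᵀ * C = 1 := by
    have := congrArg transpose h3
    simpa [transpose_sub, transpose_mul] using this
  have h6 : Bᵀ * C = Dᵀ * A - 1 := by rw [← h5]; abel
  calc C = Bᵀ⁻¹ * (Bᵀ * C) := by rw [← Matrix.mul_assoc, nonsing_inv_mul _ hut, Matrix.one_mul]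
    _ = (D * B⁻¹)ᵀ * A - Bᵀ⁻¹ := by
        rw [h6, transpose_mul, transpose_nonsing_inv, Matrix.mul_sub, Matrix.mul_one,
          Matrix.mul_assoc]
    _ = _ := by
        rw [hP, transpose_nonsing_inv, ← Matrix.mul_assoc]

theorem I_smul_add_mul {X Y X' Y' : Matrix (Fin n) (Fin n) ℂ} (h : X * Y' = Y * X') :
    (Complex.I • X + Y) * (-(Complex.I • X') + Y') = X * X' + Y * Y' := by
  rw [Matrix.add_mul, Matrix.mul_add, Matrix.mul_add, Matrix.mul_neg, Matrix.mul_neg,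
    Matrix.smul_mul, Matrix.smul_mul, Matrix.mul_smul, Matrix.mul_smul, smul_smul,
    Complex.I_mul_I, h]
  module

/-- Otherwise the polynomial `det(tA + B)` vanishes identically, hence also at `t = i`. There it is
governed by the positive semidefinite matrix `AAᵀ + BBᵀ`, whose kernel is trivial. -/
theorem exists_det_smul_add_ne_zero {A B C D : Matrix (Fin n) (Fin n) ℝ}
    (h : fromBlocks A B C D ∈ symplecticGroup (Fin n) ℝ) : ∃ t : ℝ, (t • A + B).det ≠ 0 := by
  have ht := SymplecticGroup.transpose_mem h
  rw [fromBlocks_transpose] at ht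
  obtain ⟨h1, -, h2⟩ := SymplecticGroup.fromBlocks_mem_iff.1 ht
  rw [transpose_transpose, transpose_transpose] at h1
  rw [transpose_transpose, transpose_transpose] at h2
  by_contra! hall
  let p : Polynomial ℝ :=
    ((Polynomial.X : Polynomial ℝ) • A.map Polynomial.C + B.map Polynomial.C).det
  have hp0 : p = 0 := Polynomial.funext fun t => by
    rw [← Polynomial.coe_evalRingHom, RingHom.map_det, map_zero, ← hall t]
    congr 1
    ext i j
    simp
    ring
  have hc : (Complex.I • A.map Complex.ofRealHom + B.map Complex.ofRealHom).det = 0 := by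
    have := congrArg (Polynomial.eval₂RingHom Complex.ofRealHom Complex.I) hp0
    rw [RingHom.map_det, map_zero] at this
    rw [← this]
    congr 1
    ext i j
    simp
    ring
  -- `(iA + B)(-iAᵀ + Bᵀ) = AAᵀ + BBᵀ`, because `ABᵀ` is symmetric.
  have hdet : (A * Aᵀ + B * Bᵀ).det = 0 := by
    have e : (Complex.I • A.map Complex.ofRealHom + B.map Complex.ofRealHom) *
        (-(Complex.I • Aᵀ.map Complex.ofRealHom) + Bᵀ.map Complex.ofRealHom) =
        (A * Aᵀ + B * Bᵀ).map Complex.ofRealHom := by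
      have h1' := congrArg (fun M => M.map Complex.ofRealHom) h1
      simp only [Matrix.map_mul] at h1'
      rw [Matrix.map_add _ (map_add _), Matrix.map_mul, Matrix.map_mul]
      exact I_smul_add_mul h1'
    have h3 := congrArg det e
    rw [det_mul, hc, zero_mul] at h3
    have h4 : ((A * Aᵀ + B * Bᵀ).map Complex.ofRealHom).det =
        Complex.ofRealHom (A * Aᵀ + B * Bᵀ).det := (RingHom.map_det _ _).symm
    rw [h4] at h3
    exact Complex.ofReal_eq_zero.1 h3.symm
  obtain ⟨v, hv, hv0⟩ := exists_mulVec_eq_zero_iff.2 hdet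
  have h5 : (Aᵀ *ᵥ v) ⬝ᵥ (Aᵀ *ᵥ v) + (Bᵀ *ᵥ v) ⬝ᵥ (Bᵀ *ᵥ v) = 0 := by
    have := congrArg (fun w => v ⬝ᵥ w) hv0
    simp only [add_mulVec, dotProduct_add, dotProduct_zero, ← mulVec_mulVec] at this
    rwa [dotProduct_mulVec v A, dotProduct_mulVec v B, ← mulVec_transpose, ← mulVec_transpose] at this
  have h7 : ∀ w : Fin n → ℝ, 0 ≤ w ⬝ᵥ w := fun w =>
    Finset.sum_nonneg fun i _ => mul_self_nonneg (w i)
  have hA : Aᵀ *ᵥ v = 0 := dotProduct_self_eq_zero.1 (by linarith [h7 (Aᵀ *ᵥ v), h7 (Bᵀ *ᵥ v)])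
  have hB : Bᵀ *ᵥ v = 0 := dotProduct_self_eq_zero.1 (by linarith [h7 (Aᵀ *ᵥ v), h7 (Bᵀ *ᵥ v)])
  apply hv
  -- A vector killed by both `Aᵀ` and `Bᵀ` contradicts this relation.
  have h6 : D * Aᵀ - C * Bᵀ = 1 := by
    have := congrArg transpose h2
    simpa [transpose_sub, transpose_mul] using this
  rw [← one_mulVec v, ← h6, sub_mulVec, ← mulVec_mulVec, ← mulVec_mulVec, hA, hB]
  simp

theorem fromBlocks_shear_mem (t : ℝ) :
    fromBlocks 1 (t • 1) 0 1 ∈ symplecticGroup (Fin n) ℝ := by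
  rw [SymplecticGroup.fromBlocks_mem_iff]
  simp

/-- Such a matrix is free, with generating form given by `eq_freeSymplectic`, and thus lies under a
generator. -/
theorem exists_covers_of_det_ne_zero (hħ : 0 < ħ) (S : symplecticGroup (Fin n) ℝ)
    (h : (S : Matrix (Fin n ⊕ Fin n) (Fin n ⊕ Fin n) ℝ).toBlocks₁₂.det ≠ 0) :
    S ∈ (metaplecticGraph n ħ).map (MonoidHom.snd _ _) := by
  obtain ⟨S, hS⟩ := S
  have hS' := hS
  rw [← fromBlocks_toBlocks S] at hS'
  obtain ⟨hP, hQ, hf⟩ := eq_freeSymplectic hS' h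
  obtain ⟨U, m, hU⟩ := exists_isQuadraticFourier hħ hP hQ (L := S.toBlocks₁₂⁻¹)
    (by rw [det_nonsing_inv]; simpa using h)
  refine ⟨(U, ⟨S, hS⟩), Subgroup.subset_closure ⟨_, _, _, m, hU, ?_⟩, rfl⟩
  rw [← hf, fromBlocks_toBlocks]

/-- The covering projection of the metaplectic group is onto. -/
theorem exists_covers (hħ : 0 < ħ) (S : symplecticGroup (Fin n) ℝ) :
    ∃ U : metaplecticGroup n ħ, Covers U S := by
  suffices h : S ∈ (metaplecticGraph n ħ).map (MonoidHom.snd _ _) by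
    obtain ⟨⟨U, S⟩, hU, rfl⟩ := h
    exact ⟨⟨U, _, hU, rfl⟩, hU⟩
  have hS := S.2
  rw [← fromBlocks_toBlocks (S : Matrix (Fin n ⊕ Fin n) (Fin n ⊕ Fin n) ℝ)] at hS
  obtain ⟨t, ht⟩ := exists_det_smul_add_ne_zero hS
  -- The upper right block of `SV` is `tA + B`, so `SV` is free. The shear `V` need not be free, but
  -- `W` and `VW` are, with upper right block `-1`.
  let V : symplecticGroup (Fin n) ℝ := ⟨_, fromBlocks_shear_mem t⟩
  let W : symplecticGroup (Fin n) ℝ := ⟨J (Fin n) ℝ, SymplecticGroup.J_mem _ _⟩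
  have h1 : S * V ∈ (metaplecticGraph n ħ).map (MonoidHom.snd _ _) := by
    refine exists_covers_of_det_ne_zero hħ _ ?_
    change ((S : Matrix (Fin n ⊕ Fin n) (Fin n ⊕ Fin n) ℝ) *
      fromBlocks 1 (t • 1) 0 1).toBlocks₁₂.det ≠ 0
    rw [← fromBlocks_toBlocks (S : Matrix (Fin n ⊕ Fin n) (Fin n ⊕ Fin n) ℝ), fromBlocks_multiply,
      toBlocks_fromBlocks₁₂]
    simpa using ht
  have hW : W ∈ (metaplecticGraph n ħ).map (MonoidHom.snd _ _) := by
    refine exists_covers_of_det_ne_zero hħ _ ?_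
    change (fromBlocks 0 (-1) 1 0 : Matrix (Fin n ⊕ Fin n) (Fin n ⊕ Fin n) ℝ).toBlocks₁₂.det ≠ 0
    rw [toBlocks_fromBlocks₁₂, det_neg, det_one]
    simp
  have hVW : V * W ∈ (metaplecticGraph n ħ).map (MonoidHom.snd _ _) := by
    refine exists_covers_of_det_ne_zero hħ _ ?_
    change (fromBlocks 1 (t • 1) 0 1 *
      fromBlocks 0 (-1) 1 0 : Matrix (Fin n ⊕ Fin n) (Fin n ⊕ Fin n) ℝ).toBlocks₁₂.det ≠ 0
    rw [fromBlocks_multiply, toBlocks_fromBlocks₁₂]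
    simp [det_neg]
  have hV : V ∈ (metaplecticGraph n ħ).map (MonoidHom.snd _ _) :=
    (Subgroup.mul_mem_cancel_right _ hW).1 hVW
  exact (Subgroup.mul_mem_cancel_right _ hV).1 h1

end Symplectic

/-! ### Complex conjugation and reversal of momentum. -/

section Reflection

variable {n : ℕ} {ħ : ℝ}

theorem conjDistribution_conjDistribution (ψ : 𝓢'(Rn n, ℂ)) :
    conjDistribution (conjDistribution ψ) = ψ := by
  ext f
  rw [conjDistribution_apply, conjDistribution_apply, conjSchwartz_conjSchwartz, Complex.conj_conj]

theorem phaseMap_reflectionMatrix (z : Rn n × Rn n) :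
    phaseMap (reflectionMatrix n) z = (z.1, -z.2) := by
  rw [reflectionMatrix, phaseMap_fromBlocks]
  simp

/-- The substitution `p ↦ -p` changes the sign of `u - v` and leaves the midpoint alone. -/
theorem weylKernel_reflection (hħ : 0 < ħ) {Φ Φ' : 𝓢(Rn n × Rn n, ℂ)}
    (h : ∀ z, Φ' z = Φ (phaseMap (reflectionMatrix n) z)) :
    weylKernel hħ Φ' = swapCLM (weylKernel hħ Φ) := by
  ext ⟨u, v⟩
  rw [swapCLM_apply, weylKernel_apply, weylKernel_apply, ← integral_neg_eq_self]
  congr 1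
  refine integral_congr_ae (.of_forall fun p => ?_)
  beta_reduce
  rw [h, phaseMap_reflectionMatrix, neg_neg, add_comm u v, ← neg_sub v u, inner_neg_neg]

/-- Complex conjugation reverses the momentum. -/
theorem wigner_conjDistribution (hħ : 0 < ħ) (ψ : 𝓢'(Rn n, ℂ)) {Φ Φ' : 𝓢(Rn n × Rn n, ℂ)}
    (h : ∀ z, Φ' z = Φ (phaseMap (reflectionMatrix n) z)) :
    wigner hħ (conjDistribution ψ) Φ = wigner hħ ψ Φ' := by
  rw [wigner_apply, wigner_apply, conjDistribution_conjDistribution, weylKernel_reflection hħ h,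
    apply_sndPair_comm]

end Reflection

/-! ### Covariance under symplectic and antisymplectic matrices. -/

section Sufficiency

open Matrix

variable {n : ℕ} {ħ : ℝ}

theorem reflectionMatrix_mul_self : reflectionMatrix n * reflectionMatrix n = 1 := by
  simp [reflectionMatrix, fromBlocks_multiply]

theorem reflectionMatrix_mul_J_mul :
    (reflectionMatrix n)ᵀ * J (Fin n) ℝ * reflectionMatrix n = -J (Fin n) ℝ := by
  simp [reflectionMatrix, J, fromBlocks_multiply, fromBlocks_transpose, fromBlocks_neg]

theorem mem_symplecticGroup_iff_transpose {M : Matrix (Fin n ⊕ Fin n) (Fin n ⊕ Fin n) ℝ} :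
    M ∈ symplecticGroup (Fin n) ℝ ↔ Mᵀ * J (Fin n) ℝ * M = J (Fin n) ℝ := by
  rw [SymplecticGroup.mem_iff']

theorem reflectionMatrix_mul_mem {M : Matrix (Fin n ⊕ Fin n) (Fin n ⊕ Fin n) ℝ}
    (hM : IsAntisymplectic M) : reflectionMatrix n * M ∈ symplecticGroup (Fin n) ℝ := by
  rw [mem_symplecticGroup_iff_transpose, transpose_mul]
  calc Mᵀ * (reflectionMatrix n)ᵀ * J (Fin n) ℝ * (reflectionMatrix n * M)
      = Mᵀ * ((reflectionMatrix n)ᵀ * J (Fin n) ℝ * reflectionMatrix n) * M := by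
        simp only [Matrix.mul_assoc]
    _ = J (Fin n) ℝ := by
        rw [reflectionMatrix_mul_J_mul, Matrix.mul_neg, Matrix.neg_mul, hM, neg_neg]

theorem abs_det_reflectionMatrix : |(reflectionMatrix n).det| = 1 := by
  have h := congrArg det (reflectionMatrix_mul_self (n := n))
  rw [det_mul, det_one] at h
  rcases mul_self_eq_one_iff.1 h with h | h <;> simp [h]

theorem compGL_apply (T : 𝓢'(Rn n × Rn n, ℂ)) (M : GL (Fin n ⊕ Fin n) ℝ)
    (Φ : 𝓢(Rn n × Rn n, ℂ)) : compGL T M Φ =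
      ((|(M : Matrix (Fin n ⊕ Fin n) (Fin n ⊕ Fin n) ℝ).det|⁻¹ : ℝ) : ℂ) *
        T (compCLMOfContinuousLinearEquiv ℂ (phaseEquiv M).symm Φ) := rfl

theorem phaseEquiv_symm_phaseMap (M : GL (Fin n ⊕ Fin n) ℝ) (z : Rn n × Rn n) :
    (phaseEquiv M).symm (phaseMap (M : Matrix (Fin n ⊕ Fin n) (Fin n ⊕ Fin n) ℝ) z) = z :=
  (phaseEquiv M).symm_apply_apply z

theorem compGL_wigner_of_symplectic (hħ : 0 < ħ) {M : GL (Fin n ⊕ Fin n) ℝ}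
    (hM : (M : Matrix (Fin n ⊕ Fin n) (Fin n ⊕ Fin n) ℝ) ∈ symplecticGroup (Fin n) ℝ)
    {U : metaplecticGroup n ħ} (hU : Covers U ⟨_, hM⟩) (ψ : 𝓢'(Rn n, ℂ)) :
    compGL (wigner hħ ψ) M = wigner hħ (metaplecticDistribution hħ U⁻¹ ψ) := by
  ext Φ
  rw [compGL_apply, SymplecticGroup.det_eq_one hM, abs_one, inv_one, Complex.ofReal_one, one_mul]
  refine (wigner_metaplecticDistribution_inv hħ hU ψ _ _ fun z => ?_).symm
  change _ = Φ ((phaseEquiv M).symm (phaseMap _ z))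
  rw [phaseEquiv_symm_phaseMap]

/-- Write `M = CS`: composing with `C` conjugates `ψ`, and then symplectic covariance applies. Both
determinants have absolute value 1. -/
theorem compGL_wigner_of_antisymplectic (hħ : 0 < ħ) {M : GL (Fin n ⊕ Fin n) ℝ}
    {S : symplecticGroup (Fin n) ℝ}
    (hS : (S : Matrix (Fin n ⊕ Fin n) (Fin n ⊕ Fin n) ℝ) = reflectionMatrix n * M)
    {U : metaplecticGroup n ħ} (hU : Covers U S) (ψ : 𝓢'(Rn n, ℂ)) :
    compGL (wigner hħ ψ) M =
      wigner hħ (metaplecticDistribution hħ U⁻¹ (conjDistribution ψ)) := by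
  have hdet : |(M : Matrix (Fin n ⊕ Fin n) (Fin n ⊕ Fin n) ℝ).det| = 1 := by
    have h := congrArg (fun A => |det A|) hS
    rw [SymplecticGroup.det_eq_one S.2, det_mul, abs_mul, abs_det_reflectionMatrix, one_mul,
      abs_one] at h
    exact h.symm
  let R : (Rn n × Rn n) ≃L[ℝ] (Rn n × Rn n) :=
    (ContinuousLinearEquiv.refl ℝ _).prodCongr (ContinuousLinearEquiv.neg ℝ)
  have hR : ∀ z, R z = phaseMap (reflectionMatrix n) z := fun z =>
    (phaseMap_reflectionMatrix z).symm
  ext Φ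
  rw [compGL_apply, hdet, inv_one, Complex.ofReal_one, one_mul]
  have h1 := wigner_conjDistribution hħ ψ
    (Φ := compCLMOfContinuousLinearEquiv ℂ R
      (compCLMOfContinuousLinearEquiv ℂ (phaseEquiv M).symm Φ))
    (Φ' := compCLMOfContinuousLinearEquiv ℂ (phaseEquiv M).symm Φ) (fun z => by
      change _ = Φ ((phaseEquiv M).symm (R _))
      rw [hR, phaseMap_phaseMap, reflectionMatrix_mul_self, phaseMap_one]
      rfl)
  rw [← h1]
  refine (wigner_metaplecticDistribution_inv hħ hU _ _ _ fun z => ?_).symm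
  change _ = Φ ((phaseEquiv M).symm (R (phaseMap _ z)))
  rw [hR, phaseMap_phaseMap, hS, ← Matrix.mul_assoc, reflectionMatrix_mul_self, Matrix.one_mul,
    phaseEquiv_symm_phaseMap]

theorem exists_wigner_eq_compGL (hħ : 0 < ħ) {M : GL (Fin n ⊕ Fin n) ℝ}
    (hM : (M : Matrix (Fin n ⊕ Fin n) (Fin n ⊕ Fin n) ℝ) ∈ symplecticGroup (Fin n) ℝ ∨
      IsAntisymplectic (M : Matrix (Fin n ⊕ Fin n) (Fin n ⊕ Fin n) ℝ)) (ψ : 𝓢'(Rn n, ℂ)) :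
    ∃ ψ' : 𝓢'(Rn n, ℂ), compGL (wigner hħ ψ) M = wigner hħ ψ' := by
  rcases hM with hM | hM
  · obtain ⟨U, hU⟩ := exists_covers hħ ⟨_, hM⟩
    exact ⟨_, compGL_wigner_of_symplectic hħ hM hU ψ⟩
  · obtain ⟨U, hU⟩ := exists_covers hħ ⟨_, reflectionMatrix_mul_mem hM⟩
    exact ⟨_, compGL_wigner_of_antisymplectic hħ rfl hU ψ⟩

end Sufficiency

/-! ### Multiplication by linear forms. -/

section PositionOperators

variable {D : Type} [NormedAddCommGroup D] [NormedSpace ℝ D]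

/-- Multiplication by a real linear form. -/
noncomputable def mulForm (ℓ : D →L[ℝ] ℝ) : 𝓢(D, ℂ) →L[ℂ] 𝓢(D, ℂ) :=
  smulLeftCLM ℂ fun z => ((ℓ z : ℝ) : ℂ)

theorem hasTemperateGrowth_ofReal_form (ℓ : D →L[ℝ] ℝ) :
    Function.HasTemperateGrowth fun z => ((ℓ z : ℝ) : ℂ) :=
  (Complex.ofRealCLM ∘L ℓ).hasTemperateGrowth

theorem mulForm_apply (ℓ : D →L[ℝ] ℝ) (f : 𝓢(D, ℂ)) (z : D) : mulForm ℓ f z = (ℓ z : ℂ) * f z :=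
  smulLeftCLM_apply_apply (hasTemperateGrowth_ofReal_form ℓ) f z

/-- The canonical commutation relation, from which all commutators below come. -/
theorem lineDeriv_mulForm (ℓ : D →L[ℝ] ℝ) (v : D) (f : 𝓢(D, ℂ)) :
    (∂_{v} (mulForm ℓ f) : 𝓢(D, ℂ)) = (ℓ v : ℂ) • f + mulForm ℓ (∂_{v} f) := by
  ext z
  have h : HasFDerivAt (fun z => (ℓ z : ℂ) * f z)
      ((ℓ z : ℂ) • fderiv ℝ f z + f z • (Complex.ofRealCLM ∘L ℓ)) z :=
    (Complex.ofRealCLM ∘L ℓ).hasFDerivAt.mul (f.hasFDerivAt z)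
  have e : (mulForm ℓ f : D → ℂ) = fun z => (ℓ z : ℂ) * f z := funext (mulForm_apply ℓ f)
  rw [lineDerivOp_apply_eq_fderiv, e, h.fderiv]
  simp only [add_apply, smul_apply, mulForm_apply, lineDerivOp_apply_eq_fderiv,
    ContinuousLinearMap.comp_apply, Complex.ofRealCLM_apply, smul_eq_mul]
  ring

end PositionOperators

/-! ### The ground state of the harmonic oscillator. -/

section Gaussian

variable {n : ℕ} {ħ : ℝ}

/-- The ground state `x ↦ exp(-‖x‖² / (2ħ))` of the harmonic oscillator. -/
noncomputable def groundState (n : ℕ) (hħ : 0 < ħ) : 𝓢(Rn n, ℂ) :=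
  gaussianSchwartz (Rn n) (b := (2 * ħ)⁻¹) (by positivity)

theorem lineDeriv_groundState (hħ : 0 < ħ) (a : Rn n) :
    (ħ : ℂ) • (∂_{a} (groundState n hħ) : 𝓢(Rn n, ℂ)) = -mulForm (innerSL ℝ a) (groundState n hħ) := by
  ext x
  have h1 : HasFDerivAt (fun x : Rn n => ‖x‖ ^ 2) (2 • (innerSL ℝ x)) x :=
    (hasStrictFDerivAt_norm_sq x).hasFDerivAt
  have h2 : HasFDerivAt (fun x : Rn n => ((‖x‖ ^ 2 : ℝ) : ℂ))
      (Complex.ofRealCLM ∘L (2 • (innerSL ℝ x))) x :=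
    Complex.ofRealCLM.hasFDerivAt.comp x h1
  have h3 := (h2.const_mul (-((((2 * ħ)⁻¹ : ℝ)) : ℂ))).cexp
  rw [smul_apply, lineDerivOp_apply_eq_fderiv, neg_apply, mulForm_apply]
  change (ħ : ℂ) • fderiv ℝ (fun x : Rn n => Complex.exp (-((((2 * ħ)⁻¹ : ℝ)) : ℂ) *
    ((‖x‖ ^ 2 : ℝ) : ℂ))) x a = -(_ * Complex.exp (-((((2 * ħ)⁻¹ : ℝ)) : ℂ) *
    ((‖x‖ ^ 2 : ℝ) : ℂ)))
  rw [h3.fderiv]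
  have : (ħ : ℂ) ≠ 0 := by exact_mod_cast hħ.ne'
  simp [real_inner_comm a x]
  field_simp

/-- Integration by parts turns `ħ∂_a φ₀ = -(a·x)φ₀` into an identity between functionals, the form
used against kernels. -/
theorem apply_lineDeriv_groundState (hħ : 0 < ħ) (a : Rn n) (h : 𝓢(Rn n, ℂ)) :
    (ħ : ℂ) * (groundState n hħ : 𝓢'(Rn n, ℂ)) (∂_{a} h) =
      (groundState n hħ : 𝓢'(Rn n, ℂ)) (mulForm (innerSL ℝ a) h) := by
  rw [coe_schwartz_apply, coe_schwartz_apply]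
  have h1 := integral_mul_lineDerivOp_right_eq_neg_left (μ := volume) (groundState n hħ) h a
  have h2 : ∀ x, (ħ : ℂ) * (∂_{a} (groundState n hħ) : 𝓢(Rn n, ℂ)) x =
      -((innerSL ℝ a x : ℝ) * groundState n hħ x) := fun x => by
    have := congrArg (fun f : 𝓢(Rn n, ℂ) => f x) (lineDeriv_groundState hħ a)
    simpa [mulForm_apply] using this
  calc _ = (ħ : ℂ) * ∫ x, groundState n hħ x * (∂_{a} h) x := by simp only [mul_comm]
    _ = ∫ x, -((ħ : ℂ) * (∂_{a} (groundState n hħ) : 𝓢(Rn n, ℂ)) x * h x) := by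
        rw [h1, mul_neg, integral_neg, ← integral_const_mul]
        simp only [mul_assoc]
    _ = _ := by
        refine integral_congr_ae (.of_forall fun x => ?_)
        simp only [h2, mulForm_apply]
        ring

theorem conjDistribution_groundState (hħ : 0 < ħ) :
    conjDistribution (groundState n hħ : 𝓢'(Rn n, ℂ)) = groundState n hħ := by
  ext f
  rw [conjDistribution_apply, coe_schwartz_apply, coe_schwartz_apply, ← integral_conj]
  refine integral_congr_ae (.of_forall fun x => ?_)
  simp only [conjSchwartz_apply, map_mul, Complex.conj_conj]
  congr 1
  change conj (Complex.exp _) = Complex.exp _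
  rw [← Complex.exp_conj]
  congr 1
  rw [map_mul, map_neg, Complex.conj_ofReal, Complex.conj_ofReal]

theorem groundState_apply_self_ne_zero (hħ : 0 < ħ) :
    (groundState n hħ : 𝓢'(Rn n, ℂ)) (groundState n hħ) ≠ 0 := by
  rw [coe_schwartz_apply]
  have h1 : ∀ x : Rn n, groundState n hħ x * groundState n hħ x =
      Complex.exp (-((ħ⁻¹ : ℝ) : ℂ) * (‖x‖ : ℂ) ^ 2) := fun x => by
    change Complex.exp _ * Complex.exp _ = _
    rw [← Complex.exp_add]
    congr 1
    have : (ħ : ℂ) ≠ 0 := by exact_mod_cast hħ.ne'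
    push_cast
    field_simp
    ring
  simp only [h1]
  have hb : 0 < (((ħ⁻¹ : ℝ)) : ℂ).re := by simpa using hħ
  rw [GaussianFourier.integral_cexp_neg_mul_sq_norm hb]
  rw [Complex.cpow_def_of_ne_zero]
  · exact Complex.exp_ne_zero _
  · have := Real.pi_pos
    simp [hħ.ne', this.ne']

end Gaussian

/-! ### Derivatives and multiplications carried over to the kernel. -/

section Kernel

variable {n : ℕ} {ħ : ℝ}

/-- The linear form `z ↦ b₁ · z₁ + b₂ · z₂`. -/
noncomputable def pairForm (b : Rn n × Rn n) : (Rn n × Rn n) →L[ℝ] ℝ :=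
  (innerSL ℝ b.1).coprod (innerSL ℝ b.2)

theorem pairForm_apply (b z : Rn n × Rn n) :
    pairForm b z = inner ℝ b.1 z.1 + inner ℝ b.2 z.2 := rfl

theorem weylKernel_eq (hħ : 0 < ħ) (Φ : 𝓢(Rn n × Rn n, ℂ)) : weylKernel hħ Φ =
    ((1 / (2 * Real.pi * ħ) : ℝ) ^ n : ℂ) • compCLMOfContinuousLinearEquiv ℂ (midpointEquiv hħ)
      (sndOp (fourierOp n) Φ) := rfl

/-- Up to a nonzero constant the map is a partial Fourier transform followed by a linear change of
variables. Hence any kernel, in particular a tensor product, may be used as a test. -/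
theorem weylKernel_surjective (hħ : 0 < ħ) : Function.Surjective (weylKernel (n := n) hħ) := by
  intro K
  have hc : ((1 / (2 * Real.pi * ħ) : ℝ) ^ n : ℂ) ≠ 0 := by
    have := Real.pi_pos
    rw [← Complex.ofReal_pow, Complex.ofReal_ne_zero]
    positivity
  refine ⟨(((1 / (2 * Real.pi * ħ) : ℝ) ^ n : ℂ))⁻¹ •
    sndOp ((FourierTransform.fourierCLE ℂ 𝓢(Rn n, ℂ)).symm : 𝓢(Rn n, ℂ) →L[ℂ] 𝓢(Rn n, ℂ))
      (compCLMOfContinuousLinearEquiv ℂ (midpointEquiv hħ).symm K), ?_⟩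
  rw [map_smul, weylKernel_eq, smul_smul, inv_mul_cancel₀ hc, one_smul]
  ext w
  have e : ∀ H : 𝓢(Rn n × Rn n, ℂ), sndOp (fourierOp n)
      (sndOp ((FourierTransform.fourierCLE ℂ 𝓢(Rn n, ℂ)).symm : 𝓢(Rn n, ℂ) →L[ℂ] 𝓢(Rn n, ℂ)) H) =
      H := fun H => by
    ext ⟨x, y⟩
    exact congrArg (fun f : 𝓢(Rn n, ℂ) => f y)
      ((FourierTransform.fourierCLE ℂ 𝓢(Rn n, ℂ)).apply_symm_apply (sliceCLM x H))
  rw [e]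
  simp

/-- The first of four rules: `∂_x` becomes `∂_u + ∂_v`, `2x` becomes `u + v`, `ħ∂_p` becomes `i(u -
v)`, and `2p` becomes `iħ(∂_u - ∂_v)`. -/
theorem weylKernel_lineDeriv_fst (hħ : 0 < ħ) (a : Rn n) (Φ : 𝓢(Rn n × Rn n, ℂ)) :
    weylKernel hħ (∂_{((a, 0) : Rn n × Rn n)} Φ) = ∂_{((a, a) : Rn n × Rn n)} (weylKernel hħ Φ) := by
  have e : midpointEquiv hħ (a, a) = (a, 0) := by
    change ((1 / 2 : ℝ) • (a + a), (2 * Real.pi * ħ)⁻¹ • (a - a)) = _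
    rw [sub_self, smul_zero, ← two_smul ℝ a, smul_smul]
    norm_num
  rw [weylKernel_eq, weylKernel_eq, lineDerivOp_smul, lineDerivOp_compCLMOfContinuousLinearEquiv, e,
    lineDeriv_fst_sndOp]

theorem weylKernel_mulForm_fst (hħ : 0 < ħ) (a : Rn n) (Φ : 𝓢(Rn n × Rn n, ℂ)) :
    (2 : ℂ) • weylKernel hħ (mulForm (pairForm (a, 0)) Φ) =
      mulForm (pairForm (a, a)) (weylKernel hħ Φ) := by
  ext ⟨u, v⟩
  rw [smul_apply, mulForm_apply, weylKernel_apply, weylKernel_apply]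
  have h : ∀ p, mulForm (pairForm (a, 0)) Φ ((1 / 2 : ℝ) • (u + v), p) =
      ((1 / 2 * (inner ℝ a u + inner ℝ a v) : ℝ) : ℂ) * Φ ((1 / 2 : ℝ) • (u + v), p) := fun p => by
    rw [mulForm_apply, pairForm_apply, real_inner_smul_right, inner_zero_left, add_zero,
      inner_add_right]
  simp only [h, mul_left_comm _ ((1 / 2 * (inner ℝ a u + inner ℝ a v) : ℝ) : ℂ)]
  rw [integral_const_mul, pairForm_apply]
  push_cast
  simp only [smul_eq_mul]
  ring

theorem weylKernel_lineDeriv_snd (hħ : 0 < ħ) (a : Rn n) (Φ : 𝓢(Rn n × Rn n, ℂ)) :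
    (ħ : ℂ) • weylKernel hħ (∂_{((0, a) : Rn n × Rn n)} Φ) =
      Complex.I • mulForm (pairForm (a, -a)) (weylKernel hħ Φ) := by
  ext ⟨u, v⟩
  have h : ∀ Ψ : 𝓢(Rn n × Rn n, ℂ), weylKernel hħ Ψ (u, v) = ((1 / (2 * Real.pi * ħ) : ℝ) ^ n : ℂ) *
      𝓕 (sliceCLM ((1 / 2 : ℝ) • (u + v)) Ψ) ((2 * Real.pi * ħ)⁻¹ • (u - v)) := fun Ψ => rfl
  have hg : Function.HasTemperateGrowth fun x : Rn n => inner ℝ x a := by fun_prop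
  have hπ := Real.pi_pos
  have hħc : (ħ : ℂ) ≠ 0 := by exact_mod_cast hħ.ne'
  rw [smul_apply, smul_apply, mulForm_apply, h, h, ← lineDeriv_slice, fourier_lineDerivOp_eq,
    smul_apply, smulLeftCLM_apply_apply hg, pairForm_apply, real_inner_smul_left,
    inner_neg_left, inner_sub_left, real_inner_comm a u, real_inner_comm a v]
  simp only [smul_eq_mul, Complex.real_smul]
  push_cast
  field_simp
  ring

theorem weylKernel_mulForm_snd (hħ : 0 < ħ) (a : Rn n) (Φ : 𝓢(Rn n × Rn n, ℂ)) :
    (2 : ℂ) • weylKernel hħ (mulForm (pairForm (0, a)) Φ) =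
      (Complex.I * ħ) • (∂_{((a, -a) : Rn n × Rn n)} (weylKernel hħ Φ) : 𝓢(Rn n × Rn n, ℂ)) := by
  have hπ := Real.pi_pos
  have hg : Function.HasTemperateGrowth fun x : Rn n => inner ℝ x a := by fun_prop
  have hħc : (ħ : ℂ) ≠ 0 := by exact_mod_cast hħ.ne'
  have hπc : (Real.pi : ℂ) ≠ 0 := by exact_mod_cast hπ.ne'
  have e : midpointEquiv hħ (a, -a) = (Real.pi * ħ)⁻¹ • (0, a) := by
    change ((1 / 2 : ℝ) • (a + -a), (2 * Real.pi * ħ)⁻¹ • (a - -a)) = _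
    rw [add_neg_cancel, smul_zero, sub_neg_eq_add, ← two_smul ℝ a, smul_smul, Prod.smul_mk,
      smul_zero]
    congr 2
    field_simp
  have h1 : (lineDerivOpCLM ℂ 𝓢(Rn n, ℂ) a ∘L fourierOp n) =
      (-(2 * Real.pi * Complex.I)) • (fourierOp n ∘L mulForm (innerSL ℝ a)) := by
    ext1 f
    change ∂_{a} (𝓕 f) = (-(2 * Real.pi * Complex.I)) • 𝓕 (mulForm (innerSL ℝ a) f)
    rw [lineDerivOp_fourier_eq]
    have : smulLeftCLM ℂ (fun x : Rn n => inner ℝ x a) f = mulForm (innerSL ℝ a) f := by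
      ext x
      rw [smulLeftCLM_apply_apply hg, mulForm_apply, Complex.real_smul, real_inner_comm]
      rfl
    rw [this, FourierTransform.fourier_smul]
  have h2 : sndOp (lineDerivOpCLM ℂ 𝓢(Rn n, ℂ) a ∘L fourierOp n) Φ =
      (-(2 * Real.pi * Complex.I)) • sndOp (fourierOp n) (mulForm (pairForm (0, a)) Φ) := by
    rw [h1]
    ext ⟨x, p⟩
    have : mulForm (innerSL ℝ a) (sliceCLM x Φ) = sliceCLM x (mulForm (pairForm (0, a)) Φ) := by
      ext q
      rw [mulForm_apply, sliceCLM_apply, sliceCLM_apply, mulForm_apply, pairForm_apply,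
        inner_zero_left, zero_add]
      rfl
    change (-(2 * Real.pi * Complex.I)) • fourierOp n (mulForm (innerSL ℝ a) (sliceCLM x Φ)) p = _
    rw [this]
    rfl
  rw [weylKernel_eq, weylKernel_eq, lineDerivOp_smul, lineDerivOp_compCLMOfContinuousLinearEquiv, e,
    lineDerivOp_left_smul, lineDeriv_snd_sndOp, h2]
  ext w
  generalize hc : ((1 / (2 * Real.pi * ħ) : ℝ) ^ n : ℂ) = c
  set y : ℂ := compCLMOfContinuousLinearEquiv ℂ (midpointEquiv hħ)
    (sndOp (fourierOp n) (mulForm (pairForm (0, a)) Φ)) w with hy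
  change 2 * (c * y) =
    (Complex.I * ħ) * (c * ((Real.pi * ħ)⁻¹ • (-(2 * Real.pi * Complex.I) * y)))
  rw [Complex.real_smul]
  push_cast
  field_simp
  linear_combination c * y * Complex.I_sq

end Kernel

/-! ### A commutator argument for Gaussian Wigner transforms. -/

section Commutator

variable {n : ℕ} {ħ : ℝ}

/-- The operator that corresponds to `Φ ↦ ħ ∂_a Φ - 2 (b · z) Φ` under `weylKernel`. -/
noncomputable def kernelOp (ħ : ℝ) (a b : Rn n × Rn n) (K : 𝓢(Rn n × Rn n, ℂ)) :
    𝓢(Rn n × Rn n, ℂ) :=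
  (ħ : ℂ) • ∂_{((a.1, a.1) : Rn n × Rn n)} K + Complex.I • mulForm (pairForm (a.2, -a.2)) K -
    (mulForm (pairForm (b.1, b.1)) K + (Complex.I * ħ) • ∂_{((b.2, -b.2) : Rn n × Rn n)} K)

theorem weylKernel_lineDeriv_sub_mulForm (hħ : 0 < ħ) (a b : Rn n × Rn n)
    (Φ : 𝓢(Rn n × Rn n, ℂ)) :
    weylKernel hħ ((ħ : ℂ) • ∂_{a} Φ - (2 : ℂ) • mulForm (pairForm b) Φ) =
      kernelOp ħ a b (weylKernel hħ Φ) := by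
  have h1 : (∂_{a} Φ : 𝓢(Rn n × Rn n, ℂ)) =
      ∂_{((a.1, 0) : Rn n × Rn n)} Φ + ∂_{((0, a.2) : Rn n × Rn n)} Φ := by
    rw [← lineDerivOp_left_add, Prod.mk_add_mk, add_zero, zero_add]
  have h2 : mulForm (pairForm b) Φ =
      mulForm (pairForm (b.1, 0)) Φ + mulForm (pairForm (0, b.2)) Φ := by
    ext z
    simp only [add_apply, mulForm_apply, pairForm_apply, inner_zero_left, add_zero, zero_add]
    push_cast
    ring
  rw [h1, h2, map_sub, map_smul, map_smul, map_add, map_add, smul_add, smul_add,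
    weylKernel_lineDeriv_fst, weylKernel_lineDeriv_snd, weylKernel_mulForm_fst,
    weylKernel_mulForm_snd, kernelOp]

theorem lineDeriv_tensorSchwartz_fst (a : Rn n) (f g : 𝓢(Rn n, ℂ)) :
    (∂_{((a, 0) : Rn n × Rn n)} (tensorSchwartz f g) : 𝓢(Rn n × Rn n, ℂ)) =
      tensorSchwartz (∂_{a} f) g := by
  rw [tensorSchwartz, lineDeriv_fst_sndOp, lineDerivOp_compCLMOfContinuousLinearEquiv]
  rfl

theorem lineDeriv_tensorSchwartz_snd (a : Rn n) (f g : 𝓢(Rn n, ℂ)) :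
    (∂_{((0, a) : Rn n × Rn n)} (tensorSchwartz f g) : 𝓢(Rn n × Rn n, ℂ)) =
      tensorSchwartz f (∂_{a} g) := by
  ext ⟨x, y⟩
  have h : ∀ K : 𝓢(Rn n × Rn n, ℂ), (∂_{((0, a) : Rn n × Rn n)} K) (x, y) =
      ∂_{a} (sliceCLM x K) y := fun K => by rw [lineDeriv_slice]; rfl
  have e : sliceCLM x (tensorSchwartz f g) = f x • g := by ext y; rfl
  rw [h, e, lineDerivOp_smul]
  rfl

/-- The action of `kernelOp` in the first variable. -/
noncomputable def leftOp (ħ : ℝ) (a b : Rn n × Rn n) (f : 𝓢(Rn n, ℂ)) : 𝓢(Rn n, ℂ) :=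
  (ħ : ℂ) • ∂_{a.1} f - (Complex.I * ħ) • ∂_{b.2} f + Complex.I • mulForm (innerSL ℝ a.2) f -
    mulForm (innerSL ℝ b.1) f

/-- The action of `kernelOp` in the second variable. -/
noncomputable def rightOp (ħ : ℝ) (a b : Rn n × Rn n) (g : 𝓢(Rn n, ℂ)) : 𝓢(Rn n, ℂ) :=
  (ħ : ℂ) • ∂_{a.1} g + (Complex.I * ħ) • ∂_{b.2} g - Complex.I • mulForm (innerSL ℝ a.2) g -
    mulForm (innerSL ℝ b.1) g

/-- None of the terms couples `u` and `v`; this splitting makes `ψ` an eigenvector in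
`symplectic_of_wigner`. -/
theorem kernelOp_tensorSchwartz (a b : Rn n × Rn n) (f g : 𝓢(Rn n, ℂ)) :
    kernelOp ħ a b (tensorSchwartz f g) =
      tensorSchwartz (leftOp ħ a b f) g + tensorSchwartz f (rightOp ħ a b g) := by
  have h1 : ∀ c d : Rn n, (∂_{((c, d) : Rn n × Rn n)} (tensorSchwartz f g) :
      𝓢(Rn n × Rn n, ℂ)) = tensorSchwartz (∂_{c} f) g + tensorSchwartz f (∂_{d} g) :=
    fun c d => by
      rw [← lineDeriv_tensorSchwartz_fst, ← lineDeriv_tensorSchwartz_snd, ← lineDerivOp_left_add,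
        Prod.mk_add_mk, add_zero, zero_add]
  rw [kernelOp, h1, h1, lineDerivOp_left_neg]
  ext ⟨x, y⟩
  simp only [leftOp, rightOp, add_apply, sub_apply, smul_apply, mulForm_apply, pairForm_apply,
    tensorSchwartz_apply, innerSL_apply_apply, smul_eq_mul, neg_apply, inner_neg_left]
  push_cast
  ring

theorem lineDeriv_comm (v w : Rn n) (f : 𝓢(Rn n, ℂ)) :
    (∂_{v} (∂_{w} f) : 𝓢(Rn n, ℂ)) = ∂_{w} (∂_{v} f) := by
  have h : ∀ (v w x : Rn n), (∂_{v} (∂_{w} f) : 𝓢(Rn n, ℂ)) x = fderiv ℝ (fderiv ℝ f) x v w := by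
    intro v w x
    have e : ((∂_{w} f : 𝓢(Rn n, ℂ)) : Rn n → ℂ) = fun y => fderiv ℝ f y w :=
      funext (lineDerivOp_apply_eq_fderiv w f)
    have hd : DifferentiableAt ℝ (fderiv ℝ f) x := (fderivCLM ℝ (Rn n) ℂ f).differentiableAt
    rw [lineDerivOp_apply_eq_fderiv, e, fderiv_clm_apply hd (differentiableAt_const w)]
    simp
  ext x
  rw [h, h]
  exact (f.smooth 2).contDiffAt.isSymmSndFDerivAt (by simp) v w

/-- Each operator is linear in positions and derivatives, so the commutator is a scalar. Its
imaginary part compares the symplectic form on `(a, a')` with that on `(b, b')`. -/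
theorem leftOp_commutator (a b a' b' : Rn n × Rn n) (f : 𝓢(Rn n, ℂ)) :
    leftOp ħ a b (leftOp ħ a' b' f) - leftOp ħ a' b' (leftOp ħ a b f) =
      ((ħ : ℂ) * ((inner ℝ b.2 a'.2 - inner ℝ b'.2 a.2 + inner ℝ a'.1 b.1 - inner ℝ a.1 b'.1 : ℝ) +
        (inner ℝ a.1 a'.2 - inner ℝ a'.1 a.2 + inner ℝ b.2 b'.1 - inner ℝ b'.2 b.1 : ℝ) *
          Complex.I)) • f := by
  ext x
  simp only [leftOp, sub_eq_add_neg, lineDerivOp_add, lineDerivOp_neg, lineDerivOp_smul, lineDeriv_mulForm,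
    add_apply, neg_apply, smul_apply, mulForm_apply, innerSL_apply_apply, smul_eq_mul]
  rw [lineDeriv_comm a'.1 a.1, lineDeriv_comm b'.2 a.1, lineDeriv_comm b'.2 b.2,
    lineDeriv_comm a'.1 b.2]
  rw [real_inner_comm a.1 b'.1, real_inner_comm a.1 a'.2, real_inner_comm b.2 b'.1,
    real_inner_comm b.2 a'.2, real_inner_comm a'.1 a.2, real_inner_comm a'.1 b.1,
    real_inner_comm b'.2 b.1, real_inner_comm b'.2 a.2]
  push_cast
  linear_combination ((ħ : ℂ) * f x * ((inner ℝ b'.2 a.2 : ℝ) - (inner ℝ b.2 a'.2 : ℝ))) *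
    Complex.I_sq

/-- If a nonzero Wigner transform satisfies the equations `ħ ∂_a = 2 (Fa · z)`, then `F` is
symplectic. -/
theorem symplectic_of_wigner (hħ : 0 < ħ) {ψ : 𝓢'(Rn n, ℂ)} (hψ : ψ ≠ 0)
    (F : Rn n × Rn n → Rn n × Rn n)
    (hF : ∀ a Φ, wigner hħ ψ ((ħ : ℂ) • ∂_{a} Φ - (2 : ℂ) • mulForm (pairForm (F a)) Φ) = 0)
    (a a' : Rn n × Rn n) :
    inner ℝ a.1 a'.2 - inner ℝ a.2 a'.1 = inner ℝ (F a).1 (F a').2 - inner ℝ (F a).2 (F a').1 := by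
  obtain ⟨f₀, hf₀⟩ : ∃ f, ψ f ≠ 0 := by
    by_contra! h
    exact hψ (by ext f; exact h f)
  have hg₀ : conjDistribution ψ (conjSchwartz f₀) ≠ 0 := by
    rw [conjDistribution_apply, conjSchwartz_conjSchwartz]
    exact (map_ne_zero _).2 hf₀
  set g₀ := conjSchwartz f₀
  have key : ∀ a, ∃ c : ℂ, ∀ f, ψ (leftOp ħ a (F a) f) = c * ψ f := by
    intro a
    refine ⟨-(conjDistribution ψ (rightOp ħ a (F a) g₀) / conjDistribution ψ g₀), fun f => ?_⟩
    -- Testing on `f ⊗ g₀` with `ψ̄(g₀) ≠ 0` isolates the action in the first variable and reads off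
    -- the eigenvalue.
    obtain ⟨Φ, hΦ⟩ := weylKernel_surjective hħ (tensorSchwartz f g₀)
    have h := hF a Φ
    rw [wigner_apply, weylKernel_lineDeriv_sub_mulForm, hΦ, kernelOp_tensorSchwartz, map_add,
      sndPair_tensorSchwartz, sndPair_tensorSchwartz, map_add, map_smul, map_smul, smul_eq_mul,
      smul_eq_mul] at h
    field_simp
    linear_combination h
  obtain ⟨c, hc⟩ := key a
  obtain ⟨c', hc'⟩ := key a'
  have h := congrArg ψ (leftOp_commutator (ħ := ħ) a (F a) a' (F a') f₀)
  -- A common eigenvector kills the commutator, since `cc' = c'c`.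
  rw [map_sub, hc, hc', hc', hc, map_smul, smul_eq_mul] at h
  have hħc : (ħ : ℂ) ≠ 0 := by exact_mod_cast hħ.ne'
  have h1 : ((ħ : ℂ) * ((inner ℝ (F a).2 a'.2 - inner ℝ (F a').2 a.2 + inner ℝ a'.1 (F a).1 -
      inner ℝ a.1 (F a').1 : ℝ) + (inner ℝ a.1 a'.2 - inner ℝ a'.1 a.2 +
        inner ℝ (F a).2 (F a').1 - inner ℝ (F a').2 (F a).1 : ℝ) * Complex.I)) * ψ f₀ = 0 := by
    rw [← h]; ring
  have h2 := (mul_eq_zero.1 ((mul_eq_zero.1 h1).resolve_right hf₀)).resolve_left hħc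
  have h3 := congrArg Complex.im h2
  rw [Complex.add_im, Complex.ofReal_im, Complex.im_ofReal_mul, Complex.I_im, Complex.zero_im] at h3
  linarith [real_inner_comm a'.1 a.2, real_inner_comm (F a').2 (F a).1]

/-- The Wigner transform of the ground state satisfies `ħ ∂_a = 2 (a · z)`. -/
theorem wigner_groundState (hħ : 0 < ħ) (a : Rn n × Rn n) (Φ : 𝓢(Rn n × Rn n, ℂ)) :
    wigner hħ (groundState n hħ : 𝓢'(Rn n, ℂ))
      ((ħ : ℂ) • ∂_{a} Φ - (2 : ℂ) • mulForm (pairForm a) Φ) = 0 := by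
  rw [wigner_apply, weylKernel_lineDeriv_sub_mulForm, conjDistribution_groundState]
  set T : 𝓢'(Rn n, ℂ) := (groundState n hħ : 𝓢'(Rn n, ℂ)) with hT
  generalize weylKernel hħ Φ = K
  -- In either variable the functional `T` turns `v·x` into `ħ∂_v`; with this the four terms of
  -- `kernelOp ħ a a` cancel in pairs.
  have hsnd : ∀ v : Rn n, sndPair T (mulForm (pairForm (0, v)) K) =
      (ħ : ℂ) • sndPair T (∂_{((0, v) : Rn n × Rn n)} K) := fun v => by
    ext x
    have e : sliceCLM x (mulForm (pairForm (0, v)) K) = mulForm (innerSL ℝ v) (sliceCLM x K) := by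
      ext y
      rw [mulForm_apply, sliceCLM_apply, sliceCLM_apply, mulForm_apply, pairForm_apply,
        inner_zero_left, zero_add]
      rfl
    rw [smul_apply, sndPair_apply, sndPair_apply, e, ← apply_lineDeriv_groundState,
      ← lineDeriv_slice, smul_eq_mul]
  have hfst : ∀ v : Rn n, T (sndPair T (mulForm (pairForm (v, 0)) K)) =
      (ħ : ℂ) * T (sndPair T (∂_{((v, 0) : Rn n × Rn n)} K)) := fun v => by
    rw [← lineDeriv_sndPair, apply_lineDeriv_groundState]
    congr 1
    ext x
    have e : sliceCLM x (mulForm (pairForm (v, 0)) K) = ((inner ℝ v x : ℝ) : ℂ) • sliceCLM x K := by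
      ext y
      rw [sliceCLM_apply, mulForm_apply, pairForm_apply, inner_zero_left, add_zero]
      rfl
    rw [mulForm_apply, sndPair_apply, sndPair_apply, e, map_smul]
    rfl
  have hd : ∀ v w : Rn n, (∂_{((v, w) : Rn n × Rn n)} K : 𝓢(Rn n × Rn n, ℂ)) =
      ∂_{((v, 0) : Rn n × Rn n)} K + ∂_{((0, w) : Rn n × Rn n)} K := fun v w => by
    rw [← lineDerivOp_left_add, Prod.mk_add_mk, add_zero, zero_add]
  have hm : ∀ v w : Rn n, mulForm (pairForm (v, w)) K =
      mulForm (pairForm (v, 0)) K + mulForm (pairForm (0, w)) K := fun v w => by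
    ext z
    simp only [add_apply, mulForm_apply, pairForm_apply, inner_zero_left, add_zero, zero_add]
    push_cast
    ring
  rw [kernelOp, hd, hm, hd a.2, hm a.1]
  simp only [map_add, map_sub, map_smul, hsnd, hfst, smul_eq_mul]
  ring

end Commutator

/-! ### Matrices compatible with all symplectic changes of variables. -/

section MatrixAlgebra

open Matrix

variable {n : ℕ}

theorem mem_range_scalar_of_commute_transpose_mul {Y : Matrix (Fin n) (Fin n) ℝ}
    (h : ∀ R R' : Matrix (Fin n) (Fin n) ℝ, R * R' = 1 → Commute (Rᵀ * R) Y) :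
    Y ∈ Set.range (Matrix.scalar (Fin n)) := by
  have hd : ∀ i, Commute (single i i 1) Y := by
    intro i
    -- With `R = 1 + Eᵢᵢ` one gets `RᵀR = 1 + 3Eᵢᵢ`, so `Y` commutes with `Eᵢᵢ`.
    have h1 := h (1 + single i i 1) (1 - (1 / 2 : ℝ) • single i i 1) (by
      simp only [Matrix.add_mul, Matrix.mul_sub, Matrix.mul_smul, Matrix.one_mul,
        single_mul_single_same, mul_one]
      module)
    have e : (1 + single i i (1 : ℝ))ᵀ * (1 + single i i 1) =
        (1 : Matrix (Fin n) (Fin n) ℝ) + (3 : ℝ) • single i i 1 := by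
      simp only [transpose_add, transpose_one, transpose_single, Matrix.add_mul, Matrix.mul_add,
        Matrix.one_mul, single_mul_single_same, mul_one]
      module
    rw [e] at h1
    have h2 := h1.sub_left (Commute.one_left Y)
    rw [add_sub_cancel_left] at h2
    have h3 := h2.smul_left (1 / 3 : ℝ)
    rw [smul_smul] at h3
    norm_num at h3
    simpa using h3
  refine mem_range_scalar_of_commute_single fun i j hij => ?_
  -- With `R = 1 + Eᵢⱼ` one gets commutation with `Eᵢⱼ + Eⱼᵢ`; multiplying by `Eᵢᵢ` on the left
  -- isolates `Eᵢⱼ`.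
  have h1 := h (1 + single i j 1) (1 - single i j 1) (by
    simp only [Matrix.add_mul, Matrix.mul_sub, Matrix.one_mul, Matrix.mul_one,
      single_mul_single_of_ne _ _ _ _ hij.symm]
    module)
  have e : (1 + single i j (1 : ℝ))ᵀ * (1 + single i j 1) =
      (1 : Matrix (Fin n) (Fin n) ℝ) + single j j 1 + single i j 1 + single j i 1 := by
    simp only [transpose_add, transpose_one, transpose_single, Matrix.add_mul, Matrix.mul_add,
      Matrix.one_mul, single_mul_single_same, mul_one]
    module
  rw [e] at h1
  have h2 := ((h1.sub_left (Commute.one_left Y)).sub_left (hd j))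
  have e2 : (1 : Matrix (Fin n) (Fin n) ℝ) + single j j 1 + single i j 1 + single j i 1 - 1 -
      single j j 1 = single i j 1 + single j i 1 := by abel
  rw [e2] at h2
  have h3 := (hd i).mul_left h2
  rwa [Matrix.mul_add, single_mul_single_same, single_mul_single_of_ne _ _ _ _ hij, add_zero,
    mul_one] at h3

/-- The block diagonal matrices with blocks `R` and `R⁻ᵀ` suffice. Scalar `R` kill the diagonal
blocks of `N`, general `R` make `Y` commute with every `RᵀR` and hence scalar, and antisymmetry
determines the last block. -/
theorem eq_smul_J_of_forall {N : Matrix (Fin n ⊕ Fin n) (Fin n ⊕ Fin n) ℝ} (hN : Nᵀ = -N)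
    (h : ∀ S ∈ symplecticGroup (Fin n) ℝ, (Sᵀ * S) * N * (Sᵀ * S) = N) :
    ∃ β : ℝ, N = β • J (Fin n) ℝ := by
  rw [← fromBlocks_toBlocks N] at hN h
  obtain ⟨X, Y, Z, W, rfl⟩ : ∃ X Y Z W, N = fromBlocks X Y Z W :=
    ⟨_, _, _, _, (fromBlocks_toBlocks N).symm⟩
  simp only [toBlocks_fromBlocks₁₁, toBlocks_fromBlocks₁₂, toBlocks_fromBlocks₂₁,
    toBlocks_fromBlocks₂₂] at hN h
  have key : ∀ R R' : Matrix (Fin n) (Fin n) ℝ, R * R' = 1 →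
      (Rᵀ * R) * X * (Rᵀ * R) = X ∧ (Rᵀ * R) * Y * (R' * R'ᵀ) = Y ∧
        (R' * R'ᵀ) * W * (R' * R'ᵀ) = W := by
    intro R R' hR
    have hS : fromBlocks R 0 0 R'ᵀ ∈ symplecticGroup (Fin n) ℝ := by
      rw [SymplecticGroup.fromBlocks_mem_iff]
      refine ⟨by simp, by simp, ?_⟩
      rw [← transpose_mul, mul_eq_one_comm.1 hR]
      simp
    have := h _ hS
    rw [fromBlocks_transpose, fromBlocks_multiply, fromBlocks_multiply, fromBlocks_multiply,
      fromBlocks_inj] at this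
    simp only [transpose_transpose, transpose_zero, Matrix.zero_mul, Matrix.mul_zero, add_zero,
      zero_add] at this
    exact ⟨this.1, this.2.1, this.2.2.2⟩
  have hX : X = 0 := by
    -- Here `RᵀR = 4`, so the relation reads `16X = X`.
    have := (key ((2 : ℝ) • 1) ((1 / 2 : ℝ) • 1) (by simp [smul_smul])).1
    simp only [transpose_smul, transpose_one, Matrix.smul_mul, Matrix.mul_smul, Matrix.one_mul,
      Matrix.mul_one, smul_smul] at this
    ext i j
    have h1 := congrFun (congrFun this i) j
    simp only [Matrix.smul_apply, smul_eq_mul] at h1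
    rw [Matrix.zero_apply]
    linarith
  have hW : W = 0 := by
    have := (key ((1 / 2 : ℝ) • 1) ((2 : ℝ) • 1) (by simp [smul_smul])).2.2
    simp only [transpose_smul, transpose_one, Matrix.smul_mul, Matrix.mul_smul, Matrix.one_mul,
      Matrix.mul_one, smul_smul] at this
    ext i j
    have h1 := congrFun (congrFun this i) j
    simp only [Matrix.smul_apply, smul_eq_mul] at h1
    rw [Matrix.zero_apply]
    linarith
  obtain ⟨y, rfl⟩ := mem_range_scalar_of_commute_transpose_mul (Y := Y) fun R R' hR => by
    have h1 := (key R R' hR).2.1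
    have h2 : (R' * R'ᵀ) * (Rᵀ * R) = 1 := by
      rw [Matrix.mul_assoc, ← Matrix.mul_assoc R'ᵀ, ← transpose_mul, hR, transpose_one,
        Matrix.one_mul, mul_eq_one_comm.1 hR]
    have h3 := congrArg (· * (Rᵀ * R)) h1
    rwa [Matrix.mul_assoc, h2, Matrix.mul_one] at h3
  rw [fromBlocks_transpose, fromBlocks_neg, fromBlocks_inj] at hN
  have hZ : Z = -Matrix.scalar (Fin n) y := by
    rw [← neg_neg Z, ← hN.2.2.1]
    simp
  refine ⟨-y, ?_⟩
  rw [hX, hW, hZ, J, fromBlocks_smul]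
  congr 1 <;> simp [← Matrix.smul_one_eq_diagonal]

/-- The hypothesis for `S`, compared with that for `S = 1` after cancelling `M`, says that `N =
MJMᵀ` is fixed by `N ↦ (SᵀS)N(SᵀS)`. -/
theorem symplectic_or_antisymplectic {M : Matrix (Fin n ⊕ Fin n) (Fin n ⊕ Fin n) ℝ}
    (hM : IsUnit M.det) (h : ∀ S ∈ symplecticGroup (Fin n) ℝ,
      ((S * M)ᵀ * (S * M)) * J (Fin n) ℝ * ((S * M)ᵀ * (S * M)) = J (Fin n) ℝ) :
    M ∈ symplecticGroup (Fin n) ℝ ∨ IsAntisymplectic M := by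
  have hMt : IsUnit Mᵀ.det := by rwa [det_transpose]
  have h' : ∀ S ∈ symplecticGroup (Fin n) ℝ,
      Mᵀ * ((Sᵀ * S) * (M * J (Fin n) ℝ * Mᵀ) * (Sᵀ * S)) * M = J (Fin n) ℝ := fun S hS => by
    refine Eq.trans ?_ (h S hS)
    rw [transpose_mul]
    simp only [Matrix.mul_assoc]
  have h1 : Mᵀ * (M * J (Fin n) ℝ * Mᵀ) * M = J (Fin n) ℝ := by
    have := h' 1 (one_mem _)
    simpa using this
  obtain ⟨β, hβ⟩ := eq_smul_J_of_forall (N := M * J (Fin n) ℝ * Mᵀ)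
    (by simp [transpose_mul, J_transpose, Matrix.mul_assoc]) (fun S hS => by
      have h2 := (h' S hS).trans h1.symm
      have h3 := congrArg (fun A => Mᵀ⁻¹ * A * M⁻¹) h2
      simpa only [Matrix.mul_assoc, mul_nonsing_inv _ hM, Matrix.mul_one,
        nonsing_inv_mul_cancel_left _ _ hMt] using h3)
  rw [hβ, Matrix.mul_smul, Matrix.smul_mul] at h1
  -- For `n = 0` all matrices agree and `β` is undetermined; otherwise a diagonal entry exists from
  -- which `β² = 1` can be read.
  rcases n with - | n
  · exact Or.inr (Subsingleton.elim _ _)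
  have h2 : β ^ 2 = 1 := by
    -- Multiplying `βMᵀJM = J` by `MJ` on the left makes `MJMᵀ = βJ` appear again, and `J² = -1`
    -- leaves `β²M = M`.
    have h3 := congrArg (fun A => M * J _ ℝ * A) h1
    rw [Matrix.mul_smul, Matrix.mul_assoc Mᵀ, ← Matrix.mul_assoc _ Mᵀ, hβ, Matrix.smul_mul,
      ← Matrix.mul_assoc, J_squared, Matrix.mul_assoc M, J_squared, smul_smul, Matrix.neg_mul,
      Matrix.mul_neg, Matrix.one_mul, Matrix.mul_one, smul_neg, neg_inj] at h3
    have h4 := congrArg (· * M⁻¹) h3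
    rw [Matrix.smul_mul, mul_nonsing_inv _ hM] at h4
    have h5 := congrFun (congrFun h4 (Sum.inl 0)) (Sum.inl 0)
    simpa [pow_two] using h5
  rcases (by simpa using h2 : β = 1 ∨ β = -1) with rfl | rfl
  · left
    rw [mem_symplecticGroup_iff_transpose]
    simpa using h1
  · right
    rw [neg_one_smul] at h1
    rw [IsAntisymplectic, ← neg_eq_iff_eq_neg]
    exact h1

/-- The minus sign is there because `Matrix.J` has upper right block `-1`. -/
theorem inner_sub_inner_eq (a b : Rn n × Rn n) :
    inner ℝ a.1 b.2 - inner ℝ a.2 b.1 =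
      -(Sum.elim a.1.ofLp a.2.ofLp ⬝ᵥ (J (Fin n) ℝ *ᵥ Sum.elim b.1.ofLp b.2.ofLp)) := by
  rw [J, fromBlocks_mulVec, sumElim_dotProduct_sumElim, neg_mulVec, dotProduct_add, dotProduct_neg]
  simp [EuclideanSpace.inner_eq_star_dotProduct, dotProduct_comm]
  ring

theorem phaseMap_elim (A : Matrix (Fin n ⊕ Fin n) (Fin n ⊕ Fin n) ℝ) (z : Rn n × Rn n) :
    Sum.elim (phaseMap A z).1.ofLp (phaseMap A z).2.ofLp =
      A *ᵥ Sum.elim z.1.ofLp z.2.ofLp := by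
  ext i; rcases i with i | i <;> rfl

theorem pairForm_eq_dotProduct (a b : Rn n × Rn n) :
    pairForm a b = Sum.elim a.1.ofLp a.2.ofLp ⬝ᵥ Sum.elim b.1.ofLp b.2.ofLp := by
  rw [pairForm_apply, sumElim_dotProduct_sumElim]
  simp [EuclideanSpace.inner_eq_star_dotProduct, dotProduct_comm]

theorem transpose_mul_J_mul_eq {F : Matrix (Fin n ⊕ Fin n) (Fin n ⊕ Fin n) ℝ}
    (h : ∀ a a' : Rn n × Rn n, inner ℝ a.1 a'.2 - inner ℝ a.2 a'.1 =
      inner ℝ (phaseMap F a).1 (phaseMap F a').2 - inner ℝ (phaseMap F a).2 (phaseMap F a').1) :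
    Fᵀ * J (Fin n) ℝ * F = J (Fin n) ℝ := by
  have h1 : ∀ v w : Fin n ⊕ Fin n → ℝ,
      v ⬝ᵥ ((Fᵀ * J (Fin n) ℝ * F) *ᵥ w) = v ⬝ᵥ (J (Fin n) ℝ *ᵥ w) := by
    intro v w
    have h2 := h (WithLp.toLp 2 (v ∘ Sum.inl), WithLp.toLp 2 (v ∘ Sum.inr))
      (WithLp.toLp 2 (w ∘ Sum.inl), WithLp.toLp 2 (w ∘ Sum.inr))
    rw [inner_sub_inner_eq, inner_sub_inner_eq, phaseMap_elim, phaseMap_elim, neg_inj] at h2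
    simp only [Sum.elim_comp_inl_inr] at h2
    rw [h2, ← mulVec_mulVec, ← mulVec_mulVec, dotProduct_mulVec v, vecMul_transpose]
  ext i j
  have h3 := h1 (Pi.single i 1) (Pi.single j 1)
  simpa using h3

end MatrixAlgebra

/-! ### Only symplectic and antisymplectic matrices preserve Wigner transforms. -/

section Necessity

open Matrix

variable {n : ℕ} {ħ : ℝ}

theorem wigner_groundState_ne_zero (hħ : 0 < ħ) :
    ∃ Φ, wigner hħ (groundState n hħ : 𝓢'(Rn n, ℂ)) Φ ≠ 0 := by
  obtain ⟨Φ, hΦ⟩ := weylKernel_surjective hħ (tensorSchwartz (groundState n hħ) (groundState n hħ))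
  refine ⟨Φ, ?_⟩
  rw [wigner_apply, hΦ, sndPair_tensorSchwartz, conjDistribution_groundState, map_smul, smul_eq_mul]
  exact mul_ne_zero (groundState_apply_self_ne_zero hħ) (groundState_apply_self_ne_zero hħ)

theorem wigner_zero (hħ : 0 < ħ) (Φ : 𝓢(Rn n × Rn n, ℂ)) : wigner hħ (0 : 𝓢'(Rn n, ℂ)) Φ = 0 := rfl

/-- If `Wψ'` is proportional to the composition of the Wigner transform of the ground state with
`P`, then `PᵀP` is symplectic. -/
theorem transpose_mul_self_symplectic (hħ : 0 < ħ) (P : GL (Fin n ⊕ Fin n) ℝ) {c : ℂ} (hc : c ≠ 0)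
    {ψ' : 𝓢'(Rn n, ℂ)} (h : ∀ Φ, wigner hħ ψ' Φ = c * wigner hħ (groundState n hħ : 𝓢'(Rn n, ℂ))
      (compCLMOfContinuousLinearEquiv ℂ (phaseEquiv P).symm Φ)) :
    ((P : Matrix (Fin n ⊕ Fin n) (Fin n ⊕ Fin n) ℝ)ᵀ * P) * J (Fin n) ℝ *
      ((P : Matrix (Fin n ⊕ Fin n) (Fin n ⊕ Fin n) ℝ)ᵀ * P) = J (Fin n) ℝ := by
  set F := (P : Matrix (Fin n ⊕ Fin n) (Fin n ⊕ Fin n) ℝ)ᵀ * P with hF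
  -- The commutator argument needs a nonzero `ψ'`; otherwise the Wigner transform of the ground
  -- state would vanish.
  have hψ' : ψ' ≠ 0 := by
    rintro rfl
    obtain ⟨Φ, hΦ⟩ := wigner_groundState_ne_zero (n := n) hħ
    have h1 := h (compCLMOfContinuousLinearEquiv ℂ (phaseEquiv P) Φ)
    have e : compCLMOfContinuousLinearEquiv ℂ (phaseEquiv P).symm
        (compCLMOfContinuousLinearEquiv ℂ (phaseEquiv P) Φ) = Φ := by
      ext z
      simp
    rw [wigner_zero, e] at h1
    exact mul_ne_zero hc hΦ h1.symm
  have hFt : Fᵀ = F := by rw [hF, transpose_mul, transpose_transpose]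
  have h1 := transpose_mul_J_mul_eq (F := F)
    (symplectic_of_wigner hħ hψ' (phaseMap F) fun a Φ => ?_)
  · rwa [hFt] at h1
  have e1 : compCLMOfContinuousLinearEquiv ℂ (phaseEquiv P).symm (∂_{a} Φ) =
      ∂_{phaseEquiv P a} (compCLMOfContinuousLinearEquiv ℂ (phaseEquiv P).symm Φ) := by
    rw [lineDerivOp_compCLMOfContinuousLinearEquiv, ContinuousLinearEquiv.symm_apply_apply]
  -- `Fa · w = Pa · Pw` for `F = PᵀP`, so the equation for `ψ'` in direction `a` is the ground state
  -- equation in direction `Pa`.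
  have e2 : compCLMOfContinuousLinearEquiv ℂ (phaseEquiv P).symm
      (mulForm (pairForm (phaseMap F a)) Φ) = mulForm (pairForm (phaseEquiv P a))
        (compCLMOfContinuousLinearEquiv ℂ (phaseEquiv P).symm Φ) := by
    ext z
    obtain ⟨w, rfl⟩ := (phaseEquiv P).surjective z
    rw [mulForm_apply]
    change mulForm (pairForm (phaseMap F a)) Φ ((phaseEquiv P).symm (phaseEquiv P w)) =
      _ * Φ ((phaseEquiv P).symm (phaseEquiv P w))
    rw [ContinuousLinearEquiv.symm_apply_apply, mulForm_apply]
    congr 2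
    change pairForm (phaseMap F a) w = pairForm (phaseMap _ a) (phaseMap _ w)
    rw [pairForm_eq_dotProduct, pairForm_eq_dotProduct, phaseMap_elim, phaseMap_elim, phaseMap_elim,
      hF, ← mulVec_mulVec, mulVec_transpose, ← dotProduct_mulVec]
  rw [h, map_sub, map_smul, map_smul, e1, e2, wigner_groundState, mul_zero]

/-- The ground state alone would only give the condition for `S = 1`. Its metaplectic images give it
for `SM` with every symplectic `S`, as `symplectic_or_antisymplectic` requires. -/
theorem symplectic_or_antisymplectic_of_forall_exists_wigner (hħ : 0 < ħ)
    (M : GL (Fin n ⊕ Fin n) ℝ) (h : ∀ ψ : 𝓢(Rn n, ℂ), ∃ ψ' : 𝓢'(Rn n, ℂ),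
      compGL (wigner hħ (ψ : 𝓢'(Rn n, ℂ))) M = wigner hħ ψ') :
    (M : Matrix (Fin n ⊕ Fin n) (Fin n ⊕ Fin n) ℝ) ∈ symplecticGroup (Fin n) ℝ ∨
      IsAntisymplectic (M : Matrix (Fin n ⊕ Fin n) (Fin n ⊕ Fin n) ℝ) := by
  have hM : IsUnit (M : Matrix (Fin n ⊕ Fin n) (Fin n ⊕ Fin n) ℝ).det :=
    (isUnit_iff_isUnit_det _).1 M.isUnit
  refine symplectic_or_antisymplectic hM fun S hS => ?_
  obtain ⟨U, hU⟩ := exists_covers hħ ⟨S, hS⟩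
  obtain ⟨ψ', hψ'⟩ := h (metaplecticSchwartz hħ U⁻¹ (groundState n hħ))
  rw [← coe_metaplecticDistribution] at hψ'
  let G : GL (Fin n ⊕ Fin n) ℝ := ((isUnit_iff_isUnit_det S).2 (by
    rw [SymplecticGroup.det_eq_one hS]; exact isUnit_one)).unit
  have hG : (G : Matrix (Fin n ⊕ Fin n) (Fin n ⊕ Fin n) ℝ) = S := rfl
  have hc : ((|(M : Matrix (Fin n ⊕ Fin n) (Fin n ⊕ Fin n) ℝ).det|⁻¹ : ℝ) : ℂ) ≠ 0 := by
    rw [Complex.ofReal_ne_zero]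
    exact inv_ne_zero (abs_ne_zero.2 hM.ne_zero)
  -- Symplectic covariance rewrites the Wigner transform of the chosen state composed with `M` as
  -- that of the ground state composed with `SM`, up to `|det M|⁻¹`.
  have := transpose_mul_self_symplectic hħ (G * M) hc (ψ' := ψ') fun Φ => by
    rw [← hψ', compGL_apply]
    congr 1
    refine wigner_metaplecticDistribution_inv hħ hU _ _ _ fun z => ?_
    obtain ⟨w, rfl⟩ := (phaseEquiv M).surjective z
    change Φ ((phaseEquiv M).symm (phaseEquiv M w)) =
      Φ ((phaseEquiv (G * M)).symm (phaseMap S (phaseMap _ w)))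
    rw [ContinuousLinearEquiv.symm_apply_apply, phaseMap_phaseMap, ← hG, ← Units.val_mul,
      phaseEquiv_symm_phaseMap]
  rwa [Units.val_mul, hG] at this

end Necessity

theorem theorem1 (n : ℕ) (ħ : ℝ) (hħ : 0 < ħ) (M : GL (Fin n ⊕ Fin n) ℝ) :
    (IsAntisymplectic (M : Matrix (Fin n ⊕ Fin n) (Fin n ⊕ Fin n) ℝ) →
      ∃ S : Matrix.symplecticGroup (Fin n) ℝ,
        (S : Matrix (Fin n ⊕ Fin n) (Fin n ⊕ Fin n) ℝ) = reflectionMatrix n * M ∧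
        (∃ U : metaplecticGroup n ħ, Covers U S) ∧
        ∀ U : metaplecticGroup n ħ, Covers U S → ∀ ψ : 𝓢'(Rn n, ℂ),
          compGL (wigner hħ ψ) M =
            wigner hħ (metaplecticDistribution hħ U⁻¹ (conjDistribution ψ))) ∧
    ((∀ ψ : 𝓢(Rn n, ℂ), ∃ ψ' : 𝓢'(Rn n, ℂ),
        compGL (wigner hħ (ψ : 𝓢'(Rn n, ℂ))) M = wigner hħ ψ') →
      (M : Matrix (Fin n ⊕ Fin n) (Fin n ⊕ Fin n) ℝ) ∈ Matrix.symplecticGroup (Fin n) ℝ ∨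
        IsAntisymplectic (M : Matrix (Fin n ⊕ Fin n) (Fin n ⊕ Fin n) ℝ)) ∧
    ((M : Matrix (Fin n ⊕ Fin n) (Fin n ⊕ Fin n) ℝ) ∈ Matrix.symplecticGroup (Fin n) ℝ ∨
        IsAntisymplectic (M : Matrix (Fin n ⊕ Fin n) (Fin n ⊕ Fin n) ℝ) →
      ∀ ψ : 𝓢'(Rn n, ℂ), ∃ ψ' : 𝓢'(Rn n, ℂ), compGL (wigner hħ ψ) M = wigner hħ ψ') :=
  ⟨fun hM => ⟨⟨_, reflectionMatrix_mul_mem hM⟩, rfl, exists_covers hħ _,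
      fun _ hU ψ => compGL_wigner_of_antisymplectic hħ rfl hU ψ⟩,
    symplectic_or_antisymplectic_of_forall_exists_wigner hħ M,
    fun hM ψ => exists_wigner_eq_compGL hħ hM ψ⟩
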